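/- Let $R=\mathbb{R}[x,y,z]$, graded by putting $x,y,z$ in degree $2$, let $S_3$ act on $R$ by permuting the variables, and let $s$ (resp. $r$) be the simple reflection that interchanges $x$ and $y$ (resp. $y$ and $z$). For a $\mathbb{Z}$-graded $R$-bimodule $M$ (with $\mathbb{R}$ acting in the same way on both sides) let $M(n)$ be the shift $M(n)_i=M_{n+i}$, and write $MN:=M\otimes_R N$. Put $B_t:=R\otimes_{R^t}R(1)$ for $t\in\{s,r\}$ and $B_{srs}:=R\otimes_{R^{S_3}}R(3)$. Let $\mathcal{B}(S_3)$ be the category of those $\mathbb{Z}$-graded $R$-bimodules that are isomorphic (as graded bimodules) to a finite direct sum of shifts of the bimodules $R,\ B_s,\ B_r,\ B_sB_r,\ B_rB_s,\ B_{srs}$. Theorem. If $M$ and $N$ belong to $\mathcal{B}(S_3)$, then so does $M\otimes_R N$. Moreover, there are isomorphisms of graded $R$-bimodules, for $\{t,u\}=\{s,r\}$: 1. $B_tB_t\cong B_t(1)\oplus B_t(-1)$; 2. $B_tB_{srs}\cong B_{srs}(1)\oplus B_{srs}(-1)$; 3. $B_{srs}B_{srs}\cong B_{srs}(-3)\oplus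 B_{srs}(-1)^{\oplus 2}\oplus B_{srs}(1)^{\oplus 2}\oplus B_{srs}(3)$; 4. $B_tB_uB_t\cong B_{srs}\oplus B_t$. Furthermore, let $\alpha_s=y-x$, $\alpha_r=z-y$ and $\partial_t(p)=\frac{p-t\cdot p}{2\alpha_t}$ for $p\in R$, and consider the bimodule morphisms $m_u:B_u\to R$, $p\otimes q\mapsto pq$; $m_u^a:R\to B_u$, $1\mapsto \alpha_u\otimes 1+1\otimes\alpha_u$; $j_t:B_tB_t\cong R\otimes_{R^t}R\otimes_{R^t}R(2)\to B_t$, $p\otimes q\otimes h\mapsto p\,\partial_t(q)\otimes h$; and $j_t^a:B_t\to B_tB_t$, $p\otimes q\mapsto p\otimes 1\otimes q$. Then $$e:=-(\mathrm{id}\otimes m_u^a\otimes\mathrm{id})\circ j_t^a\circ j_t\circ(\mathrm{id}\otimes m_u\otimes\mathrm{id})\in\mathrm{End}(B_tB_uB_t)$$ is an idempotent of degree $0$, with $\mathrm{im}(e)\cong B_t$ and $\mathrm{im}(1-e)\cong B_{srs}$ as graded $R$-bimodules. -/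

import Mathlib

open scoped TensorProduct

noncomputable section

namespace Soergel

/-! ### The polynomial ring `R = ℝ[x, y, z]`, its grading and the action of `S₃` -/

/-- `R = ℝ[x, y, z]`, with `x = X 0`, `y = X 1`, `z = X 2`. -/
abbrev R : Type := MvPolynomial (Fin 3) ℝ

/-- The degree `k` part `R_k` of `R`, where `x`, `y`, `z` have degree `2`. -/
def R.deg (k : ℤ) : Submodule ℝ R :=
  MvPolynomial.weightedHomogeneousSubmodule ℝ (fun _ => (2 : ℤ)) k

/-- The subalgebra `R^T` of the polynomials fixed by all permutations in `T`, where a permutation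
`σ` of the variables acts by `(σ f)(x₀, x₁, x₂) = f(x_{σ 0}, x_{σ 1}, x_{σ 2})`. -/
def invariants (T : Set (Equiv.Perm (Fin 3))) : Subalgebra ℝ R where
  carrier := {f | ∀ σ ∈ T, MvPolynomial.rename σ f = f}
  mul_mem' := fun ha hb σ hσ => by rw [map_mul, ha σ hσ, hb σ hσ]
  add_mem' := fun ha hb σ hσ => by rw [map_add, ha σ hσ, hb σ hσ]
  algebraMap_mem' := fun c σ _ => AlgHom.commutes _ c

/-- The two simple reflections of `S₃`. -/
inductive Simple
  | s
  | r

/-- `s` interchanges `x` and `y`; `r` interchanges `y` and `z`. -/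
def Simple.perm : Simple → Equiv.Perm (Fin 3)
  | .s => Equiv.swap 0 1
  | .r => Equiv.swap 1 2

/-- `α_s = y - x` and `α_r = z - y`. -/
def Simple.root : Simple → R
  | .s => MvPolynomial.X 1 - MvPolynomial.X 0
  | .r => MvPolynomial.X 2 - MvPolynomial.X 1

/-! ### Graded bimodules -/

/-- A `ℤ`-graded `R`-bimodule (with the same `ℝ`-structure on both sides): a real vector space
with two commuting actions of `R` and a decomposition into homogeneous parts that is compatible
with the actions. Here `left f m = f · m` and `right f m = m · f`; as `R` is commutative,
`right` is a ring homomorphism as well. -/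
structure GradedBimodule where
  carrier : Type*
  [addCommGroup : AddCommGroup carrier]
  [module : Module ℝ carrier]
  left : R →ₐ[ℝ] Module.End ℝ carrier
  right : R →ₐ[ℝ] Module.End ℝ carrier
  left_right : ∀ f g m, left f (right g m) = right g (left f m)
  deg : ℤ → Submodule ℝ carrier
  isInternal : DirectSum.IsInternal deg
  left_mem : ∀ {i j : ℤ} {f m}, f ∈ R.deg i → m ∈ deg j → left f m ∈ deg (i + j)
  right_mem : ∀ {i j : ℤ} {f m}, f ∈ R.deg i → m ∈ deg j → right f m ∈ deg (i + j)

attribute [instance] GradedBimodule.addCommGroup GradedBimodule.module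

/-- A homomorphism of `R`-bimodules (not necessarily homogeneous). -/
@[ext]
structure Hom (M N : GradedBimodule) where
  toLin : M.carrier →ₗ[ℝ] N.carrier
  map_left : ∀ f m, toLin (M.left f m) = N.left f (toLin m)
  map_right : ∀ f m, toLin (M.right f m) = N.right f (toLin m)

namespace Hom

variable {M N P M' N' : GradedBimodule}

/-- `φ` is homogeneous of degree `d`. -/
def HasDegree (φ : Hom M N) (d : ℤ) : Prop :=
  ∀ k, ∀ m ∈ M.deg k, φ.toLin m ∈ N.deg (k + d)

/-- The identity morphism. -/
def id (M : GradedBimodule) : Hom M M := ⟨LinearMap.id, fun _ _ => rfl, fun _ _ => rfl⟩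

/-- The composition `ψ ∘ φ`. -/
def comp (ψ : Hom N P) (φ : Hom M N) : Hom M P :=
  ⟨ψ.toLin ∘ₗ φ.toLin, fun f m => by simp [φ.map_left, ψ.map_left],
    fun f m => by simp [φ.map_right, ψ.map_right]⟩

/-- The difference of two morphisms. -/
def sub (φ ψ : Hom M N) : Hom M N :=
  ⟨φ.toLin - ψ.toLin, fun f m => by simp [φ.map_left, ψ.map_left],
    fun f m => by simp [φ.map_right, ψ.map_right]⟩

/-- The negative of a morphism. -/
def neg (φ : Hom M N) : Hom M N :=
  ⟨-φ.toLin, fun f m => by simp [φ.map_left], fun f m => by simp [φ.map_right]⟩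

end Hom

/-- An isomorphism of graded `R`-bimodules (homogeneous of degree `0`). -/
structure Iso (M N : GradedBimodule) where
  toEquiv : M.carrier ≃ₗ[ℝ] N.carrier
  map_left : ∀ f m, toEquiv (M.left f m) = N.left f (toEquiv m)
  map_right : ∀ f m, toEquiv (M.right f m) = N.right f (toEquiv m)
  map_deg : ∀ k m, m ∈ M.deg k ↔ toEquiv m ∈ N.deg k

/-- `M ≅ᵍ N`: the graded bimodules `M` and `N` are isomorphic. -/
def IsIsomorphic (M N : GradedBimodule) : Prop := Nonempty (Iso M N)

infix:50 " ≅ᵍ " => IsIsomorphic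

theorem R.deg_isInternal : DirectSum.IsInternal R.deg := by
  classical
  let _ := MvPolynomial.weightedDecomposition ℝ (fun _ : Fin 3 => (2 : ℤ))
  exact DirectSum.Decomposition.isInternal
    (MvPolynomial.weightedHomogeneousSubmodule ℝ (fun _ : Fin 3 => (2 : ℤ)))

theorem R.mul_mem_deg {i j : ℤ} {f g : R} (hf : f ∈ R.deg i) (hg : g ∈ R.deg j) :
    f * g ∈ R.deg (i + j) :=
  MvPolynomial.IsWeightedHomogeneous.mul hf hg

/-- `R` as a graded bimodule over itself. -/
def unit : GradedBimodule where
  carrier := R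
  left := Algebra.lmul ℝ R
  right := Algebra.lmul ℝ R
  left_right := fun f g m => mul_left_comm f g m
  deg := R.deg
  isInternal := R.deg_isInternal
  left_mem := R.mul_mem_deg
  right_mem := R.mul_mem_deg

/-- The shift `M(n)`, with `M(n)_i = M_{n + i}`. -/
def GradedBimodule.shift (M : GradedBimodule) (n : ℤ) : GradedBimodule where
  carrier := M.carrier
  left := M.left
  right := M.right
  left_right := M.left_right
  deg := fun i => M.deg (n + i)
  isInternal := by
    have h := (DirectSum.isInternal_submodule_iff_iSupIndep_and_iSup_eq_top _).1 M.isInternal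
    refine DirectSum.isInternal_submodule_of_iSupIndep_of_iSup_eq_top
      (h.1.comp (add_right_injective n)) ?_
    rw [← h.2]
    exact (Equiv.addLeft n).iSup_comp (g := M.deg)
  left_mem := fun {i j _ _} hf hm => by
    have := M.left_mem hf hm
    rwa [add_left_comm] at this
  right_mem := fun {i j _ _} hf hm => by
    have := M.right_mem hf hm
    rwa [add_left_comm] at this

/-- The direct sum of a finite family of graded bimodules. -/
def directSum {ι : Type} [Fintype ι] (M : ι → GradedBimodule) : GradedBimodule where
  carrier := ∀ i, (M i).carrier
  left :=
    { toFun := fun f => LinearMap.pi fun i => (M i).left f ∘ₗ LinearMap.proj i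
      map_one' := by ext m i; simp
      map_mul' := fun f g => by ext m i; simp
      map_zero' := by ext m i; simp
      map_add' := fun f g => by ext m i; simp
      commutes' := fun c => by ext m i; simp }
  right :=
    { toFun := fun f => LinearMap.pi fun i => (M i).right f ∘ₗ LinearMap.proj i
      map_one' := by ext m i; simp
      map_mul' := fun f g => by ext m i; simp
      map_zero' := by ext m i; simp
      map_add' := fun f g => by ext m i; simp
      commutes' := fun c => by ext m i; simp }
  left_right := fun f g m => funext fun i => (M i).left_right f g (m i)
  deg := fun k => Submodule.pi Set.univ fun i => (M i).deg k
  isInternal := by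
    classical
    have h := fun i =>
      (DirectSum.isInternal_submodule_iff_iSupIndep_and_iSup_eq_top _).1 (M i).isInternal
    refine DirectSum.isInternal_submodule_of_iSupIndep_of_iSup_eq_top ?_ ?_
    · intro k
      rw [Submodule.disjoint_def]
      intro m hm hm'
      funext i
      have h1 := (h i).1 k
      rw [Submodule.disjoint_def] at h1
      refine h1 (m i) (hm i trivial) ?_
      have h2 := Submodule.mem_map_of_mem (f := LinearMap.proj (R := ℝ) (φ := fun i => (M i).carrier) i) hm'
      simp only [Submodule.map_iSup] at h2
      refine Set.mem_of_subset_of_mem (SetLike.coe_subset_coe.2 (iSup₂_mono fun j hj => ?_)) h2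
      rintro _ ⟨x, hx, rfl⟩
      exact hx i trivial
    · rw [eq_top_iff]
      intro m _
      rw [← Finset.univ_sum_single m]
      refine Submodule.sum_mem _ fun i _ => ?_
      have h3 : (⊤ : Submodule ℝ (M i).carrier) ≤ Submodule.comap (LinearMap.single ℝ (fun i => (M i).carrier) i)
          (⨆ k, Submodule.pi Set.univ fun i => (M i).deg k) := by
        rw [← (h i).2, iSup_le_iff]
        intro k x hx
        refine Submodule.mem_iSup_of_mem k ?_
        intro j _
        by_cases hj : j = i
        · subst hj; simpa using hx
        · simp [hj]
      exact h3 (Submodule.mem_top (x := m i))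
  left_mem := fun hf hm i _ => (M i).left_mem hf (hm i trivial)
  right_mem := fun hf hm i _ => (M i).right_mem hf (hm i trivial)

/-- The image of a morphism of degree `0`, graded as a subobject of the target. -/
def Hom.image {M N : GradedBimodule} (φ : Hom M N) (hφ : φ.HasDegree 0) : GradedBimodule where
  carrier := LinearMap.range φ.toLin
  left :=
    { toFun := fun f => (N.left f).restrict (p := LinearMap.range φ.toLin)
        (q := LinearMap.range φ.toLin) (by
          rintro _ ⟨m, rfl⟩; exact ⟨M.left f m, φ.map_left f m⟩)
      map_one' := by ext m; simp
      map_mul' := fun f g => by ext m; simp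
      map_zero' := by ext m; simp
      map_add' := fun f g => by ext m; simp
      commutes' := fun c => by ext m; simp }
  right :=
    { toFun := fun f => (N.right f).restrict (p := LinearMap.range φ.toLin)
        (q := LinearMap.range φ.toLin) (by
          rintro _ ⟨m, rfl⟩; exact ⟨M.right f m, φ.map_right f m⟩)
      map_one' := by ext m; simp
      map_mul' := fun f g => by ext m; simp
      map_zero' := by ext m; simp
      map_add' := fun f g => by ext m; simp
      commutes' := fun c => by ext m; simp }
  left_right := fun f g m => Subtype.ext (N.left_right f g m)
  deg := fun k => (N.deg k).comap (LinearMap.range φ.toLin).subtype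
  isInternal := by
    have hM := (DirectSum.isInternal_submodule_iff_iSupIndep_and_iSup_eq_top _).1 M.isInternal
    have hN := (DirectSum.isInternal_submodule_iff_iSupIndep_and_iSup_eq_top _).1 N.isInternal
    refine DirectSum.isInternal_submodule_of_iSupIndep_of_iSup_eq_top ?_ ?_
    · intro k
      rw [Submodule.disjoint_def]
      intro m hm hm'
      have h1 := hN.1 k
      rw [Submodule.disjoint_def] at h1
      refine Subtype.ext (h1 m hm ?_)
      have h2 := Submodule.mem_map_of_mem (f := (LinearMap.range φ.toLin).subtype) hm'
      simp only [Submodule.map_iSup] at h2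
      refine Set.mem_of_subset_of_mem (SetLike.coe_subset_coe.2 (iSup₂_mono fun j hj => ?_)) h2
      exact Submodule.map_comap_le _ _
    · rw [eq_top_iff]
      rintro ⟨_, m, rfl⟩ -
      have h3 : (⊤ : Submodule ℝ M.carrier) ≤ Submodule.comap φ.toLin.rangeRestrict
          (⨆ k, (N.deg k).comap (LinearMap.range φ.toLin).subtype) := by
        rw [← hM.2, iSup_le_iff]
        intro k x hx
        refine Submodule.mem_iSup_of_mem k ?_
        have := hφ k x hx
        rw [add_zero] at this
        exact this
      exact h3 (Submodule.mem_top (x := m))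
  left_mem := fun hf hm => N.left_mem hf hm
  right_mem := fun hf hm => N.right_mem hf hm

/-! ### Tensor products -/

section TensorGrading

variable {S M N : Type*} [CommRing S] [Algebra ℝ S]
  [AddCommGroup M] [Module ℝ M] [Module S M] [IsScalarTower ℝ S M]
  [AddCommGroup N] [Module ℝ N] [Module S N]

/-- The grading of `M ⊗_S N`: its part of degree `k` is spanned by the elements `m ⊗ n` with
`m`, `n` homogeneous and `deg m + deg n = k`. -/
def tensorDeg (S : Type*) {M N : Type*} [CommRing S] [Algebra ℝ S]
    [AddCommGroup M] [Module ℝ M] [Module S M] [IsScalarTower ℝ S M]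
    [AddCommGroup N] [Module ℝ N] [Module S N]
    (ℳ : ℤ → Submodule ℝ M) (𝒩 : ℤ → Submodule ℝ N) (k : ℤ) : Submodule ℝ (M ⊗[S] N) :=
  Submodule.span ℝ {t | ∃ i j : ℤ, i + j = k ∧ ∃ m ∈ ℳ i, ∃ n ∈ 𝒩 j, t = m ⊗ₜ[S] n}

/-- A linear map that sends each homogeneous `m` of degree `i` to `single i m`. -/
theorem exists_components {M : Type*} [AddCommGroup M] [Module ℝ M] {ℳ : ℤ → Submodule ℝ M}
    (hM : DirectSum.IsInternal ℳ) :
    ∃ d : M →ₗ[ℝ] (ℤ →₀ M), ∀ i, ∀ m ∈ ℳ i, d m = Finsupp.single i m := by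
  classical
  let e := LinearEquiv.ofBijective (DirectSum.coeLinearMap ℳ) hM
  let c : (DirectSum ℤ fun i => ℳ i) →ₗ[ℝ] (ℤ →₀ M) :=
    DirectSum.toModule ℝ ℤ _ fun i => Finsupp.lsingle i ∘ₗ (ℳ i).subtype
  refine ⟨c ∘ₗ e.symm.toLinearMap, fun i m hm => ?_⟩
  have : e.symm m = DirectSum.lof ℝ ℤ (fun i => ℳ i) i ⟨m, hm⟩ := by
    rw [LinearEquiv.symm_apply_eq]
    exact (DirectSum.coeLinearMap_lof (R := ℝ) ℳ i ⟨m, hm⟩).symm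
  simp [c, this]

theorem tensorDeg_isInternal {𝒮 : ℤ → Submodule ℝ S} {ℳ : ℤ → Submodule ℝ M}
    {𝒩 : ℤ → Submodule ℝ N} (hS : ⨆ k, 𝒮 k = ⊤)
    (hM : DirectSum.IsInternal ℳ) (hN : DirectSum.IsInternal 𝒩)
    (hSM : ∀ {i j : ℤ} {a : S} {m : M}, a ∈ 𝒮 i → m ∈ ℳ j → a • m ∈ ℳ (i + j))
    (hSN : ∀ {i j : ℤ} {a : S} {n : N}, a ∈ 𝒮 i → n ∈ 𝒩 j → a • n ∈ 𝒩 (i + j)) :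
    DirectSum.IsInternal (tensorDeg S ℳ 𝒩) := by
  classical
  have hMt := hM.submodule_iSup_eq_top
  have hNt := hN.submodule_iSup_eq_top
  obtain ⟨dM, hdM⟩ := exists_components hM
  obtain ⟨dN, hdN⟩ := exists_components hN
  let T : M →+ N →+ M ⊗[S] N :=
    AddMonoidHom.mk' (fun m => AddMonoidHom.mk' (fun n => m ⊗ₜ[S] n)
      (fun a b => TensorProduct.tmul_add m a b))
      (fun a b => by ext n; exact TensorProduct.add_tmul a b n)
  let B : (ℤ →₀ M) →+ (ℤ →₀ N) →+ (ℤ →₀ M ⊗[S] N) :=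
    Finsupp.liftAddHom fun i => AddMonoidHom.flip (Finsupp.liftAddHom fun j =>
      AddMonoidHom.flip ((AddMonoidHom.compHom (Finsupp.singleAddHom (i + j))).comp T))
  have hB : ∀ i m j n, B (Finsupp.single i m) (Finsupp.single j n)
      = Finsupp.single (i + j) (m ⊗ₜ[S] n) := by
    intro i m j n
    simp [B, T]
  let F : M →+ N →+ (ℤ →₀ M ⊗[S] N) :=
    ((AddMonoidHom.compHom' dN.toAddMonoidHom).comp B).comp dM.toAddMonoidHom
  have hF : ∀ m n, F m n = B (dM m) (dN n) := fun m n => rfl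
  have hbal : ∀ (a : S) (m : M) (n : N), F (a • m) n = F m (a • n) := by
    intro a m n
    have ha : a ∈ ⨆ k, 𝒮 k := hS ▸ Submodule.mem_top
    have hm : m ∈ ⨆ k, ℳ k := hMt ▸ Submodule.mem_top
    have hn : n ∈ ⨆ k, 𝒩 k := hNt ▸ Submodule.mem_top
    induction ha using Submodule.iSup_induction' with
    | zero => simp
    | add a b _ _ h1 h2 => simp only [add_smul, map_add, AddMonoidHom.add_apply, h1, h2]
    | mem k a ha =>
      induction hm using Submodule.iSup_induction' with
      | zero => simp
      | add a b _ _ h1 h2 => simp only [smul_add, map_add, AddMonoidHom.add_apply, h1, h2]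
      | mem i m hm =>
        induction hn using Submodule.iSup_induction' with
        | zero => simp
        | add a b _ _ h1 h2 => simp only [smul_add, map_add, h1, h2]
        | mem j n hn =>
          rw [hF, hF, hdM _ _ hm, hdN _ _ hn, hdM _ _ (hSM ha hm), hdN _ _ (hSN ha hn), hB, hB,
            TensorProduct.smul_tmul, add_left_comm, add_assoc]
  let D : M ⊗[S] N →+ (ℤ →₀ M ⊗[S] N) := TensorProduct.liftAddHom F hbal
  have hDt : ∀ m n, D (m ⊗ₜ n) = F m n := fun m n => TensorProduct.liftAddHom_tmul ..
  have hDsmul : ∀ (c : ℝ) t, D (c • t) = c • D t := by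
    intro c t
    induction t with
    | zero => simp
    | add a b h1 h2 => rw [smul_add, map_add, map_add, h1, h2, smul_add]
    | tmul m n =>
      have hm : m ∈ ⨆ k, ℳ k := hMt ▸ Submodule.mem_top
      have hn : n ∈ ⨆ k, 𝒩 k := hNt ▸ Submodule.mem_top
      rw [TensorProduct.smul_tmul', hDt, hDt]
      induction hm using Submodule.iSup_induction' with
      | zero => simp
      | add a b _ _ h1 h2 => simp only [smul_add, map_add, AddMonoidHom.add_apply, h1, h2]
      | mem i m hm =>
        induction hn using Submodule.iSup_induction' with
        | zero => simp
        | add a b _ _ h1 h2 => simp only [smul_add, map_add, h1, h2]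
        | mem j n hn =>
          rw [hF, hF, hdM _ _ hm, hdN _ _ hn, hdM _ _ ((ℳ i).smul_mem c hm), hB, hB,
            Finsupp.smul_single, TensorProduct.smul_tmul']
  have hD : ∀ k, ∀ t ∈ tensorDeg S ℳ 𝒩 k, D t = Finsupp.single k t := by
    intro k t ht
    induction ht using Submodule.span_induction with
    | mem t ht =>
      obtain ⟨i, j, rfl, m, hm, n, hn, rfl⟩ := ht
      rw [hDt, hF, hdM _ _ hm, hdN _ _ hn, hB]
    | zero => simp
    | add a b _ _ h1 h2 => rw [map_add, h1, h2, Finsupp.single_add]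
    | smul c a _ h => rw [hDsmul, h, Finsupp.smul_single]
  refine DirectSum.isInternal_submodule_of_iSupIndep_of_iSup_eq_top ?_ ?_
  · intro k
    rw [Submodule.disjoint_def]
    intro t ht ht'
    have h1 : ∀ u ∈ ⨆ j, ⨆ (_ : j ≠ k), tensorDeg S ℳ 𝒩 j, D u k = 0 := by
      intro u hu
      induction hu using Submodule.iSup_induction' with
      | zero => simp
      | add a b _ _ h1 h2 => rw [map_add, Finsupp.add_apply, h1, h2, add_zero]
      | mem j u hu =>
        by_cases hj : j = k
        · subst hj
          simp at hu
          simp [hu]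
        · simp only [ne_eq, hj, not_false_eq_true, iSup_pos] at hu
          rw [hD j u hu, Finsupp.single_eq_of_ne (Ne.symm hj)]
    have h2 := h1 t ht'
    rwa [hD k t ht, Finsupp.single_eq_same] at h2
  · rw [eq_top_iff]
    rintro t -
    induction t with
    | zero => exact Submodule.zero_mem _
    | add a b h1 h2 => exact Submodule.add_mem _ h1 h2
    | tmul m n =>
      have hm : m ∈ ⨆ k, ℳ k := hMt ▸ Submodule.mem_top
      have hn : n ∈ ⨆ k, 𝒩 k := hNt ▸ Submodule.mem_top
      induction hm using Submodule.iSup_induction' with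
      | zero => simp
      | add a b _ _ h1 h2 => rw [TensorProduct.add_tmul]; exact Submodule.add_mem _ h1 h2
      | mem i m hm =>
        induction hn using Submodule.iSup_induction' with
        | zero => simp
        | add a b _ _ h1 h2 => rw [TensorProduct.tmul_add]; exact Submodule.add_mem _ h1 h2
        | mem j n hn =>
          exact Submodule.mem_iSup_of_mem (i + j)
            (Submodule.subset_span ⟨i, j, rfl, m, hm, n, hn, rfl⟩)

end TensorGrading

/-- The vector space underlying `M`, as an `R`-module through the left action. -/
def GradedBimodule.LeftMod (M : GradedBimodule) := M.carrier

/-- The vector space underlying `M`, as an `R`-module through the right action. -/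
def GradedBimodule.RightMod (M : GradedBimodule) := M.carrier

namespace GradedBimodule

instance (M : GradedBimodule) : AddCommGroup M.LeftMod := M.addCommGroup
instance (M : GradedBimodule) : Module ℝ M.LeftMod := M.module
instance (M : GradedBimodule) : Module R M.LeftMod :=
  Module.compHom M.carrier M.left.toRingHom
instance (M : GradedBimodule) : AddCommGroup M.RightMod := M.addCommGroup
instance (M : GradedBimodule) : Module ℝ M.RightMod := M.module
instance (M : GradedBimodule) : Module R M.RightMod :=
  Module.compHom M.carrier M.right.toRingHom

theorem LeftMod.smul_def (M : GradedBimodule) (f : R) (m : M.LeftMod) : f • m = M.left f m := rfl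
theorem RightMod.smul_def (M : GradedBimodule) (f : R) (m : M.RightMod) :
    f • m = M.right f m := rfl

instance (M : GradedBimodule) : IsScalarTower ℝ R M.LeftMod :=
  ⟨fun c f m => by
    rw [LeftMod.smul_def, LeftMod.smul_def, map_smul]; exact LinearMap.smul_apply c (M.left f) m⟩
instance (M : GradedBimodule) : IsScalarTower ℝ R M.RightMod :=
  ⟨fun c f m => by
    rw [RightMod.smul_def, RightMod.smul_def, map_smul]
    exact LinearMap.smul_apply c (M.right f) m⟩

end GradedBimodule

theorem R.iSup_deg : ⨆ k, R.deg k = ⊤ := R.deg_isInternal.submodule_iSup_eq_top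

namespace GradedBimodule

/-- The left action of `f`, as an endomorphism of the right module. -/
def leftEnd (M : GradedBimodule) (f : R) : M.RightMod →ₗ[R] M.RightMod where
  toFun := M.left f
  map_add' := (M.left f).map_add
  map_smul' := fun g m => M.left_right f g m

/-- The right action of `f`, as an endomorphism of the left module. -/
def rightEnd (M : GradedBimodule) (f : R) : M.LeftMod →ₗ[R] M.LeftMod where
  toFun := M.right f
  map_add' := (M.right f).map_add
  map_smul' := fun g m => (M.left_right g f m).symm

end GradedBimodule

/-- The tensor product `M ⊗_R N`: the right action of `R` on `M` is balanced against the left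
action on `N`; `R` acts on the left through `M` and on the right through `N`. -/
def tensor (M N : GradedBimodule) : GradedBimodule where
  carrier := M.RightMod ⊗[R] N.LeftMod
  left :=
    { toFun := fun f => (TensorProduct.map (M.leftEnd f) LinearMap.id).restrictScalars ℝ
      map_one' := by
        ext t
        induction t with
        | zero => simp
        | add a b h1 h2 => rw [map_add, map_add, h1, h2]
        | tmul m n =>
          change (show M.RightMod from M.left 1 m) ⊗ₜ[R] n = _
          rw [map_one]; rfl
      map_mul' := fun f g => by
        ext t
        induction t with
        | zero => simp
        | add a b h1 h2 => rw [map_add, map_add, h1, h2]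
        | tmul m n =>
          change (show M.RightMod from M.left (f * g) m) ⊗ₜ[R] n = (show M.RightMod from M.left f (M.left g m)) ⊗ₜ[R] n
          rw [map_mul]; rfl
      map_zero' := by
        ext t
        induction t with
        | zero => simp
        | add a b h1 h2 => rw [map_add, map_add, h1, h2]
        | tmul m n =>
          change (show M.RightMod from M.left 0 m) ⊗ₜ[R] n = 0
          rw [map_zero]; exact TensorProduct.zero_tmul _ _
      map_add' := fun f g => by
        ext t
        induction t with
        | zero => simp
        | add a b h1 h2 => rw [map_add, map_add, h1, h2]
        | tmul m n =>
          change (show M.RightMod from M.left (f + g) m) ⊗ₜ[R] n = (show M.RightMod from M.left f m) ⊗ₜ[R] n + (show M.RightMod from M.left g m) ⊗ₜ[R] n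
          rw [map_add]; exact TensorProduct.add_tmul _ _ _
      commutes' := fun c => by
        ext t
        induction t with
        | zero => simp
        | add a b h1 h2 => rw [map_add, map_add, h1, h2]
        | tmul m n =>
          change (show M.RightMod from M.left (algebraMap ℝ R c) m) ⊗ₜ[R] n = c • (m ⊗ₜ[R] n)
          rw [AlgHom.commutes]; exact (TensorProduct.smul_tmul' c m n).symm }
  right :=
    { toFun := fun f => (TensorProduct.map LinearMap.id (N.rightEnd f)).restrictScalars ℝ
      map_one' := by
        ext t
        induction t with
        | zero => simp
        | add a b h1 h2 => rw [map_add, map_add, h1, h2]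
        | tmul m n =>
          change m ⊗ₜ[R] (show N.LeftMod from N.right 1 n) = _
          rw [map_one]; rfl
      map_mul' := fun f g => by
        ext t
        induction t with
        | zero => simp
        | add a b h1 h2 => rw [map_add, map_add, h1, h2]
        | tmul m n =>
          change m ⊗ₜ[R] (show N.LeftMod from N.right (f * g) n) = m ⊗ₜ[R] (show N.LeftMod from N.right f (N.right g n))
          rw [map_mul]; rfl
      map_zero' := by
        ext t
        induction t with
        | zero => simp
        | add a b h1 h2 => rw [map_add, map_add, h1, h2]
        | tmul m n =>
          change m ⊗ₜ[R] (show N.LeftMod from N.right 0 n) = 0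
          rw [map_zero]; exact TensorProduct.tmul_zero _ _
      map_add' := fun f g => by
        ext t
        induction t with
        | zero => simp
        | add a b h1 h2 => rw [map_add, map_add, h1, h2]
        | tmul m n =>
          change m ⊗ₜ[R] (show N.LeftMod from N.right (f + g) n) = m ⊗ₜ[R] (show N.LeftMod from N.right f n) + m ⊗ₜ[R] (show N.LeftMod from N.right g n)
          rw [map_add]; exact TensorProduct.tmul_add _ _ _
      commutes' := fun c => by
        ext t
        induction t with
        | zero => simp
        | add a b h1 h2 => rw [map_add, map_add, h1, h2]
        | tmul m n =>
          change m ⊗ₜ[R] (show N.LeftMod from N.right (algebraMap ℝ R c) n) = c • (m ⊗ₜ[R] n)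
          rw [AlgHom.commutes]; exact TensorProduct.tmul_smul c m n }
  left_right := fun f g t => by
    induction t with
    | zero => simp
    | add a b h1 h2 => simp only [map_add, h1, h2]
    | tmul m n => rfl
  deg := tensorDeg R (M := M.RightMod) (N := N.LeftMod) M.deg N.deg
  isInternal := tensorDeg_isInternal R.iSup_deg M.isInternal N.isInternal M.right_mem N.left_mem
  left_mem := fun {i j f t} hf ht => by
    induction ht using Submodule.span_induction with
    | mem t ht =>
      obtain ⟨k, l, rfl, m, hm, n, hn, rfl⟩ := ht
      exact Submodule.subset_span
        ⟨i + k, l, add_assoc .., _, M.left_mem hf hm, n, hn, rfl⟩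
    | zero => rw [map_zero]; exact Submodule.zero_mem _
    | add a b _ _ h1 h2 => rw [map_add]; exact Submodule.add_mem _ h1 h2
    | smul c a _ h => rw [map_smul]; exact Submodule.smul_mem _ c h
  right_mem := fun {i j f t} hf ht => by
    induction ht using Submodule.span_induction with
    | mem t ht =>
      obtain ⟨k, l, rfl, m, hm, n, hn, rfl⟩ := ht
      exact Submodule.subset_span
        ⟨k, i + l, add_left_comm .., m, hm, _, N.right_mem hf hn, rfl⟩
    | zero => rw [map_zero]; exact Submodule.zero_mem _
    | add a b _ _ h1 h2 => rw [map_add]; exact Submodule.add_mem _ h1 h2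
    | smul c a _ h => rw [map_smul]; exact Submodule.smul_mem _ c h

infixl:70 " ⊗ᵍ " => tensor

theorem rename_coeff_iff (σ : Equiv.Perm (Fin 3)) (f : R) :
    MvPolynomial.rename σ f = f ↔ ∀ d : Fin 3 →₀ ℕ, f.coeff (d.mapDomain σ) = f.coeff d := by
  constructor
  · intro h d
    conv_lhs => rw [← h]
    exact MvPolynomial.coeff_rename_mapDomain σ σ.injective f d
  · intro h
    ext d
    obtain ⟨d, rfl⟩ : ∃ d' : Fin 3 →₀ ℕ, d'.mapDomain σ = d :=
      ⟨d.mapDomain σ.symm, by rw [← Finsupp.mapDomain_comp]; simp⟩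
    rw [MvPolynomial.coeff_rename_mapDomain σ σ.injective, h]

theorem component_mem_invariants {T : Set (Equiv.Perm (Fin 3))} {f : R} (hf : f ∈ invariants T)
    (k : ℤ) : MvPolynomial.weightedHomogeneousComponent (fun _ : Fin 3 => (2 : ℤ)) k f
      ∈ invariants T := by
  classical
  intro σ hσ
  rw [rename_coeff_iff]
  intro d
  have h := (rename_coeff_iff σ f).1 (hf σ hσ) d
  have hw : Finsupp.weight (fun _ : Fin 3 => (2 : ℤ)) (d.mapDomain σ)
      = Finsupp.weight (fun _ : Fin 3 => (2 : ℤ)) d := by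
    rw [Finsupp.weight_apply, Finsupp.weight_apply,
      Finsupp.sum_mapDomain_index (by simp) (by intros; rw [add_smul])]
  rw [MvPolynomial.coeff_weightedHomogeneousComponent,
    MvPolynomial.coeff_weightedHomogeneousComponent, hw, h]

theorem invariants_iSup_deg (T : Set (Equiv.Perm (Fin 3))) :
    ⨆ k, (R.deg k).comap (invariants T).val.toLinearMap = ⊤ := by
  classical
  rw [eq_top_iff]
  rintro ⟨f, hf⟩ -
  have h : (⟨f, hf⟩ : invariants T) = ∑ᶠ k : ℤ,
      ⟨MvPolynomial.weightedHomogeneousComponent (fun _ : Fin 3 => (2 : ℤ)) k f,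
        component_mem_invariants hf k⟩ := by
    refine Subtype.ext ?_
    have := AddMonoidHom.map_finsum_of_injective (invariants T).val.toLinearMap.toAddMonoidHom
      Subtype.val_injective (fun k : ℤ => (⟨MvPolynomial.weightedHomogeneousComponent
        (fun _ : Fin 3 => (2 : ℤ)) k f, component_mem_invariants hf k⟩ : invariants T))
    exact (MvPolynomial.sum_weightedHomogeneousComponent (fun _ : Fin 3 => (2 : ℤ)) f).symm.trans
      this.symm
  rw [h]
  refine finsum_induction _ (Submodule.zero_mem _) (fun _ _ => Submodule.add_mem _) fun k => ?_
  refine Submodule.mem_iSup_of_mem k ?_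
  exact MvPolynomial.weightedHomogeneousComponent_mem _ f k

/-- The graded bimodule `R ⊗_{R^T} R` (without shift). -/
def induced (T : Set (Equiv.Perm (Fin 3))) : GradedBimodule where
  carrier := R ⊗[invariants T] R
  left := (Algebra.lmul ℝ (R ⊗[invariants T] R)).comp Algebra.TensorProduct.includeLeft
  right := (Algebra.lmul ℝ (R ⊗[invariants T] R)).comp
    ((Algebra.TensorProduct.includeRight : R →ₐ[invariants T] R ⊗[invariants T] R).restrictScalars ℝ)
  left_right := fun f g t => mul_left_comm _ _ t
  deg := tensorDeg (invariants T) R.deg R.deg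
  isInternal := tensorDeg_isInternal (invariants_iSup_deg T) R.deg_isInternal R.deg_isInternal
    R.mul_mem_deg R.mul_mem_deg
  left_mem := fun {i j f t} hf ht => by
    induction ht using Submodule.span_induction with
    | mem t ht =>
      obtain ⟨k, l, rfl, m, hm, n, hn, rfl⟩ := ht
      exact Submodule.subset_span
        ⟨i + k, l, add_assoc .., f * m, R.mul_mem_deg hf hm, n, hn, by simp⟩
    | zero => rw [map_zero]; exact Submodule.zero_mem _
    | add a b _ _ h1 h2 => rw [map_add]; exact Submodule.add_mem _ h1 h2
    | smul c a _ h => rw [map_smul]; exact Submodule.smul_mem _ c h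
  right_mem := fun {i j f t} hf ht => by
    induction ht using Submodule.span_induction with
    | mem t ht =>
      obtain ⟨k, l, rfl, m, hm, n, hn, rfl⟩ := ht
      exact Submodule.subset_span
        ⟨k, i + l, add_left_comm .., m, hm, f * n, R.mul_mem_deg hf hn, by simp⟩
    | zero => rw [map_zero]; exact Submodule.zero_mem _
    | add a b _ _ h1 h2 => rw [map_add]; exact Submodule.add_mem _ h1 h2
    | smul c a _ h => rw [map_smul]; exact Submodule.smul_mem _ c h

/-! ### Soergel bimodules for `S₃` -/

/-- `B_t = R ⊗_{R^t} R(1)` for a simple reflection `t`. -/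
def B (t : Simple) : GradedBimodule := (induced {t.perm}).shift 1

/-- `B_{srs} = R ⊗_{R^{s,r}} R(3)`, where `R^{s,r} = R^{S₃}`. -/
def Bsrs : GradedBimodule := (induced {Simple.s.perm, Simple.r.perm}).shift 3

/-- Labels for the six bimodules `R, B_s, B_r, B_{sr}, B_{rs}, B_{srs}`. -/
inductive Label
  | e
  | s
  | r
  | sr
  | rs
  | srs

/-- The six bimodules `R, B_s, B_r, B_{sr} = B_s B_r, B_{rs} = B_r B_s, B_{srs}`. -/
def Label.bimodule : Label → GradedBimodule.{0}
  | .e => unit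
  | .s => B .s
  | .r => B .r
  | .sr => B .s ⊗ᵍ B .r
  | .rs => B .r ⊗ᵍ B .s
  | .srs => Bsrs

/-- Membership in the category `𝓑(S₃)`: `M` is isomorphic to a finite direct sum of shifts of the
six bimodules above. -/
def IsSoergel (M : GradedBimodule) : Prop :=
  ∃ (n : ℕ) (w : Fin n → Label) (d : Fin n → ℤ),
    M ≅ᵍ directSum fun i => (w i).bimodule.shift (d i)

/-! ### The morphisms that make up the idempotent -/

/-- The pure tensor `m ⊗ n` in `M ⊗_R N`. -/
def tmul {M N : GradedBimodule} (m : M.carrier) (n : N.carrier) : (M ⊗ᵍ N).carrier :=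
  (show M.RightMod from m) ⊗ₜ[R] (show N.LeftMod from n)

theorem tensor_induction {M N : GradedBimodule} {motive : (M ⊗ᵍ N).carrier → Prop}
    (zero : motive 0) (tmul : ∀ m n, motive (tmul m n))
    (add : ∀ a b, motive a → motive b → motive (a + b)) (t : (M ⊗ᵍ N).carrier) : motive t :=
  TensorProduct.induction_on t zero tmul add

theorem tmul_add {M N : GradedBimodule} (m : M.carrier) (n n' : N.carrier) :
    (tmul m (n + n') : (M ⊗ᵍ N).carrier) = tmul m n + tmul m n' :=
  TensorProduct.tmul_add (R := R) (M := M.RightMod) (N := N.LeftMod) m n n'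

theorem add_tmul {M N : GradedBimodule} (m m' : M.carrier) (n : N.carrier) :
    (tmul (m + m') n : (M ⊗ᵍ N).carrier) = tmul m n + tmul m' n :=
  TensorProduct.add_tmul (R := R) (M := M.RightMod) (N := N.LeftMod) m m' n

theorem tmul_balanced {M N : GradedBimodule} (f : R) (m : M.carrier) (n : N.carrier) :
    (tmul (M.right f m) n : (M ⊗ᵍ N).carrier) = tmul m (N.left f n) :=
  TensorProduct.smul_tmul (R := R) (M := M.RightMod) (N := N.LeftMod) f m n

theorem left_tmul {M N : GradedBimodule} (f : R) (m : M.carrier) (n : N.carrier) :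
    (M ⊗ᵍ N).left f (tmul m n) = tmul (M.left f m) n := rfl

theorem right_tmul {M N : GradedBimodule} (f : R) (m : M.carrier) (n : N.carrier) :
    (M ⊗ᵍ N).right f (tmul m n) = tmul m (N.right f n) := rfl

theorem left_algebraMap (M : GradedBimodule) (c : ℝ) (m : M.carrier) :
    M.left (algebraMap ℝ R c) m = c • m := by
  rw [AlgHom.commutes]; rfl

/-- An additive map that commutes with the two actions is a morphism of bimodules. -/
def Hom.ofAdd {M N : GradedBimodule} (φ : M.carrier →+ N.carrier)
    (hl : ∀ f m, φ (M.left f m) = N.left f (φ m))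
    (hr : ∀ f m, φ (M.right f m) = N.right f (φ m)) : Hom M N where
  toLin :=
    { toFun := φ
      map_add' := φ.map_add
      map_smul' := fun c m => by
        rw [← left_algebraMap, hl, left_algebraMap]; rfl }
  map_left := hl
  map_right := hr

/-- The additive map `m ⊗ n ↦ φ m n` given by a balanced biadditive map `φ`. -/
def liftAdd {M N : GradedBimodule} {P : Type*} [AddCommGroup P]
    (φ : M.carrier →+ N.carrier →+ P)
    (hb : ∀ f m n, φ (M.right f m) n = φ m (N.left f n)) : (M ⊗ᵍ N).carrier →+ P :=
  TensorProduct.liftAddHom (R := R) (M := M.RightMod) (N := N.LeftMod) φ hb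

theorem liftAdd_tmul {M N : GradedBimodule} {P : Type*} [AddCommGroup P]
    (φ : M.carrier →+ N.carrier →+ P)
    (hb : ∀ f m n, φ (M.right f m) n = φ m (N.left f n)) (m : M.carrier) (n : N.carrier) :
    liftAdd φ hb (tmul m n) = φ m n := rfl

/-- The morphism `M N → P` given by a balanced biadditive map `φ`, `m ⊗ n ↦ φ m n`. -/
def Hom.ofTensor {M N P : GradedBimodule} (φ : M.carrier →+ N.carrier →+ P.carrier)
    (hb : ∀ f m n, φ (M.right f m) n = φ m (N.left f n))
    (hl : ∀ f m n, φ (M.left f m) n = P.left f (φ m n))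
    (hr : ∀ f m n, φ m (N.right f n) = P.right f (φ m n)) : Hom (M ⊗ᵍ N) P :=
  Hom.ofAdd (liftAdd φ hb)
    (fun f t => by
      induction t using tensor_induction with
      | zero => rw [map_zero, map_zero, map_zero]
      | add a b h1 h2 => rw [map_add, map_add, map_add, map_add, h1, h2]
      | tmul m n => rw [left_tmul, liftAdd_tmul, liftAdd_tmul, hl])
    (fun f t => by
      induction t using tensor_induction with
      | zero => rw [map_zero, map_zero, map_zero]
      | add a b h1 h2 => rw [map_add, map_add, map_add, map_add, h1, h2]
      | tmul m n => rw [right_tmul, liftAdd_tmul, liftAdd_tmul, hr])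

/-- `(m, n) ↦ m ⊗ n`. -/
def tmulHom (M N : GradedBimodule) : M.carrier →+ N.carrier →+ (M ⊗ᵍ N).carrier :=
  AddMonoidHom.mk' (fun m => AddMonoidHom.mk' (fun n => tmul m n) (tmul_add m))
    (fun m m' => AddMonoidHom.ext fun n => add_tmul m m' n)

theorem tmulHom_apply {M N : GradedBimodule} (m : M.carrier) (n : N.carrier) :
    tmulHom M N m n = tmul m n := rfl

/-- `φ ⊗ id : M N → M' N`. -/
def Hom.whiskerRight {M M' : GradedBimodule} (φ : Hom M M') (N : GradedBimodule) :
    Hom (M ⊗ᵍ N) (M' ⊗ᵍ N) :=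
  Hom.ofTensor ((tmulHom M' N).comp φ.toLin.toAddMonoidHom)
    (fun f m n => by
      change tmul (φ.toLin (M.right f m)) n = tmul (φ.toLin m) (N.left f n)
      rw [φ.map_right, tmul_balanced])
    (fun f m n => by
      change tmul (φ.toLin (M.left f m)) n = (M' ⊗ᵍ N).left f (tmul (φ.toLin m) n)
      rw [φ.map_left, left_tmul])
    (fun f m n => rfl)

/-- `id ⊗ φ : M N → M N'`. -/
def Hom.whiskerLeft (M : GradedBimodule) {N N' : GradedBimodule} (φ : Hom N N') :
    Hom (M ⊗ᵍ N) (M ⊗ᵍ N') :=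
  Hom.ofTensor ((AddMonoidHom.compHom' φ.toLin.toAddMonoidHom).comp (tmulHom M N'))
    (fun f m n => by
      change tmul (M.right f m) (φ.toLin n) = tmul m (φ.toLin (N.left f n))
      rw [φ.map_left, tmul_balanced])
    (fun f m n => rfl)
    (fun f m n => by
      change tmul m (φ.toLin (N.right f n)) = (M ⊗ᵍ N').right f (tmul m (φ.toLin n))
      rw [φ.map_right, right_tmul])

/-- The canonical map `M R → M`, `m ⊗ f ↦ m f`. -/
def rightUnitor (M : GradedBimodule) : Hom (M ⊗ᵍ unit) M :=
  Hom.ofTensor (N := unit)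
    (AddMonoidHom.mk' (fun m => AddMonoidHom.mk' (fun f : R => M.right f m)
        (fun f g : R => LinearMap.congr_fun (M.right.map_add f g) m))
      (fun m m' => AddMonoidHom.ext fun f : R => (M.right f).map_add m m'))
    (fun f m (g : R) => by
      change M.right g (M.right f m) = M.right (f * g) m
      rw [mul_comm, map_mul]; rfl)
    (fun f m (g : R) => (M.left_right f g m).symm)
    (fun f m (g : R) => by
      change M.right (f * g) m = M.right f (M.right g m)
      rw [map_mul]; rfl)

/-- The canonical map `M → M R`, `m ↦ m ⊗ 1`. -/
def rightUnitorInv (M : GradedBimodule) : Hom M (M ⊗ᵍ unit) :=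
  Hom.ofAdd (AddMonoidHom.mk' (fun m => tmul (N := unit) m (1 : R))
      (fun m m' => add_tmul (N := unit) m m' (1 : R)))
    (fun f m => rfl)
    (fun f m => by
      change tmul (N := unit) (M.right f m) (1 : R) = tmul (N := unit) m (f * 1 : R)
      exact tmul_balanced (N := unit) f m (1 : R))

theorem rename_rename (t : Simple) (p : R) :
    MvPolynomial.rename t.perm (MvPolynomial.rename t.perm p) = p := by
  rw [MvPolynomial.rename_rename]
  have : (t.perm : Fin 3 → Fin 3) ∘ t.perm = _root_.id := by
    cases t <;> · funext i; simp [Simple.perm]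
  rw [this, MvPolynomial.rename_id_apply]

theorem mem_invariants {t : Simple} {p : R} :
    p ∈ invariants {t.perm} ↔ MvPolynomial.rename t.perm p = p := by
  change (∀ σ ∈ ({t.perm} : Set _), _) ↔ _
  simp

theorem root_ne_zero (t : Simple) : t.root ≠ 0 := by
  cases t
  · exact sub_ne_zero.2 fun h => absurd (MvPolynomial.X_injective h) (by decide)
  · exact sub_ne_zero.2 fun h => absurd (MvPolynomial.X_injective h) (by decide)

theorem rename_root (t : Simple) : MvPolynomial.rename t.perm t.root = -t.root := by
  cases t <;> simp [Simple.root, Simple.perm]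

theorem exists_divided (t : Simple) (p : R) :
    ∃ q, p - MvPolynomial.rename t.perm p = MvPolynomial.C 2 * t.root * q := by
  have hX : ∀ i, ∃ q, (MvPolynomial.X i : R) - MvPolynomial.X (t.perm i) = t.root * q := by
    intro i
    cases t <;> fin_cases i
    · exact ⟨-1, by simp [Simple.perm, Simple.root]⟩
    · exact ⟨1, by simp [Simple.perm, Simple.root]⟩
    · exact ⟨0, by simp [Simple.perm, Simple.root, Equiv.swap_apply_of_ne_of_ne]⟩
    · exact ⟨0, by simp [Simple.perm, Simple.root, Equiv.swap_apply_of_ne_of_ne]⟩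
    · exact ⟨-1, by simp [Simple.perm, Simple.root]⟩
    · exact ⟨1, by simp [Simple.perm, Simple.root]⟩
  have h : ∃ q, p - MvPolynomial.rename t.perm p = t.root * q := by
    induction p using MvPolynomial.induction_on with
    | C a => exact ⟨0, by simp⟩
    | add p p' h h' =>
      obtain ⟨q, hq⟩ := h
      obtain ⟨q', hq'⟩ := h'
      exact ⟨q + q', by rw [map_add, mul_add, ← hq, ← hq']; ring⟩
    | mul_X p i h =>
      obtain ⟨q, hq⟩ := h
      obtain ⟨q', hq'⟩ := hX i
      refine ⟨q * MvPolynomial.X i + MvPolynomial.rename t.perm p * q', ?_⟩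
      rw [map_mul, MvPolynomial.rename_X]
      linear_combination (MvPolynomial.X i) * hq + MvPolynomial.rename t.perm p * hq'
  obtain ⟨q, hq⟩ := h
  refine ⟨MvPolynomial.C (1 / 2) * q, ?_⟩
  have h2 : (MvPolynomial.C 2 * MvPolynomial.C (1 / 2) : R) = 1 := by
    rw [← MvPolynomial.C_mul]; norm_num
  linear_combination hq - t.root * q * h2

/-- `∂_t(p) = (p - t p) / (2 α_t)`. -/
def partialFun (t : Simple) (p : R) : R := (exists_divided t p).choose

theorem partialFun_spec (t : Simple) (p : R) :
    p - MvPolynomial.rename t.perm p = MvPolynomial.C 2 * t.root * partialFun t p :=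
  (exists_divided t p).choose_spec

theorem partialFun_unique {t : Simple} {p q : R}
    (h : p - MvPolynomial.rename t.perm p = MvPolynomial.C 2 * t.root * q) :
    partialFun t p = q := by
  rw [partialFun_spec] at h
  refine mul_left_cancel₀ (mul_ne_zero ?_ (root_ne_zero t)) h
  rw [Ne, MvPolynomial.C_eq_zero]
  norm_num

/-- `∂_t` as a map of `R^t`-modules. -/
def partialLin (t : Simple) : R →ₗ[invariants {t.perm}] R where
  toFun := partialFun t
  map_add' := fun p q => partialFun_unique (by
    rw [map_add]
    linear_combination partialFun_spec t p + partialFun_spec t q)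
  map_smul' := fun a p => partialFun_unique (by
    have ha := mem_invariants.1 a.2
    change a.1 * p - MvPolynomial.rename t.perm (a.1 * p) = _ * (a.1 * _)
    rw [map_mul, ha]
    linear_combination a.1 * partialFun_spec t p)

theorem partialFun_mem (t : Simple) (p : R) : partialFun t p ∈ invariants {t.perm} := by
  rw [mem_invariants]
  refine (partialFun_unique ?_).symm
  have h := congrArg (MvPolynomial.rename t.perm) (partialFun_spec t p)
  simp only [map_sub, map_mul, rename_rename, MvPolynomial.rename_C, rename_root] at h
  linear_combination -h

theorem symmPart_mem (t : Simple) (p : R) : p - t.root * partialFun t p ∈ invariants {t.perm} := by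
  rw [mem_invariants, map_sub, map_mul, rename_root, mem_invariants.1 (partialFun_mem t p)]
  have h := partialFun_spec t p
  rw [show (MvPolynomial.C 2 : R) = 2 from map_ofNat _ 2] at h
  linear_combination -h

theorem root_sq_mem (t : Simple) : t.root * t.root ∈ invariants {t.perm} := by
  rw [mem_invariants, map_mul, rename_root, neg_mul_neg]

theorem tmul_comm_of_mem {A : Subalgebra ℝ R} {a : R} (ha : a ∈ A) (p q : R) :
    (a * p) ⊗ₜ[A] q = p ⊗ₜ[A] (a * q) :=
  TensorProduct.smul_tmul (⟨a, ha⟩ : A) p q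

/-- The multiplication `m_t : B_t → R`, `p ⊗ q ↦ p q`. -/
def mul (t : Simple) : Hom (B t) unit where
  toLin := ((Algebra.TensorProduct.lmul' (invariants {t.perm}) :
    R ⊗[invariants {t.perm}] R →ₐ[invariants {t.perm}] R).restrictScalars ℝ).toLinearMap
  map_left := fun f m => by
    change Algebra.TensorProduct.lmul' (invariants {t.perm}) (f ⊗ₜ 1 * (show R ⊗[invariants {t.perm}] R from m)) = f * Algebra.TensorProduct.lmul' (invariants {t.perm}) (show R ⊗[invariants {t.perm}] R from m)
    rw [map_mul, Algebra.TensorProduct.lmul'_apply_tmul, mul_one]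
  map_right := fun f m => by
    change Algebra.TensorProduct.lmul' (invariants {t.perm}) (1 ⊗ₜ f * (show R ⊗[invariants {t.perm}] R from m)) = f * Algebra.TensorProduct.lmul' (invariants {t.perm}) (show R ⊗[invariants {t.perm}] R from m)
    rw [map_mul, Algebra.TensorProduct.lmul'_apply_tmul, one_mul]

/-- The element `α_t ⊗ 1 + 1 ⊗ α_t`. -/
def casimir (t : Simple) : R ⊗[invariants {t.perm}] R :=
  t.root ⊗ₜ 1 + 1 ⊗ₜ t.root

theorem casimir_comm (t : Simple) (p : R) :
    (p ⊗ₜ 1) * casimir t = (1 ⊗ₜ p) * casimir t := by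
  have key : ∀ P D : R, P ∈ invariants {t.perm} → D ∈ invariants {t.perm} →
      ((P + t.root * D) ⊗ₜ 1) * casimir t = (1 ⊗ₜ (P + t.root * D)) * casimir t := by
    intro P D hP hD
    have h1 : (P ⊗ₜ 1 : R ⊗[invariants {t.perm}] R) = 1 ⊗ₜ P := by
      simpa using tmul_comm_of_mem hP 1 1
    have h2 : (D ⊗ₜ 1 : R ⊗[invariants {t.perm}] R) = 1 ⊗ₜ D := by
      simpa using tmul_comm_of_mem hD 1 1
    have h3 : ((t.root * t.root) ⊗ₜ 1 : R ⊗[invariants {t.perm}] R) = 1 ⊗ₜ (t.root * t.root) := by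
      simpa using tmul_comm_of_mem (root_sq_mem t) 1 1
    have e1 : ((P + t.root * D) ⊗ₜ 1 : R ⊗[invariants {t.perm}] R)
        = P ⊗ₜ 1 + t.root ⊗ₜ 1 * D ⊗ₜ 1 := by
      simp [TensorProduct.add_tmul]
    have e2 : (1 ⊗ₜ (P + t.root * D) : R ⊗[invariants {t.perm}] R)
        = 1 ⊗ₜ P + 1 ⊗ₜ t.root * 1 ⊗ₜ D := by
      simp [TensorProduct.tmul_add]
    have e3 : (t.root ⊗ₜ 1 * t.root ⊗ₜ 1 : R ⊗[invariants {t.perm}] R)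
        = 1 ⊗ₜ t.root * 1 ⊗ₜ t.root := by
      simpa using h3
    rw [e1, e2, casimir, h1, h2]
    linear_combination (1 ⊗ₜ D : R ⊗[invariants {t.perm}] R) * e3
  have := key _ _ (symmPart_mem t p) (partialFun_mem t p)
  rwa [sub_add_cancel] at this

/-- The adjoint `m_t^a : R → B_t`, `1 ↦ α_t ⊗ 1 + 1 ⊗ α_t`. -/
def mulAdj (t : Simple) : Hom unit (B t) where
  toLin := (LinearMap.mulRight ℝ (casimir t)) ∘ₗ
    (Algebra.TensorProduct.includeLeft : R →ₐ[ℝ] R ⊗[invariants {t.perm}] R).toLinearMap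
  map_left := fun f (p : R) => by
    change ((f * p) ⊗ₜ 1) * casimir t = (f ⊗ₜ 1) * ((p ⊗ₜ 1) * casimir t)
    rw [← mul_assoc, Algebra.TensorProduct.tmul_mul_tmul, mul_one]
  map_right := fun f (p : R) => by
    change ((f * p) ⊗ₜ 1) * casimir t = (1 ⊗ₜ f) * ((p ⊗ₜ 1) * casimir t)
    rw [mul_left_comm, ← casimir_comm, ← mul_assoc, Algebra.TensorProduct.tmul_mul_tmul, mul_one,
      mul_comm p f]

section Contract

variable {S A : Type*} [CommRing S] [CommRing A] [Algebra S A] (D : A →ₗ[S] A)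

/-- The map `(p ⊗ q, q' ⊗ h) ↦ p D(q q') ⊗ h` for an `S`-linear map `D : A → A`. -/
def contractAux : A ⊗[S] A →ₗ[S] A ⊗[S] A →ₗ[S] A ⊗[S] A :=
  TensorProduct.lift <| LinearMap.mk₂ S
    (fun p q => TensorProduct.map
      (LinearMap.mulLeft S p ∘ₗ D ∘ₗ LinearMap.mulLeft S q) LinearMap.id)
    (fun p p' q => TensorProduct.ext' fun a b => by
      rw [LinearMap.add_apply]; simp [add_mul, TensorProduct.add_tmul])
    (fun c p q => TensorProduct.ext' fun a b => by
      rw [LinearMap.smul_apply]; simp [TensorProduct.smul_tmul'])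
    (fun p q q' => TensorProduct.ext' fun a b => by
      rw [LinearMap.add_apply]; simp [add_mul, mul_add, TensorProduct.add_tmul])
    (fun c p q => TensorProduct.ext' fun a b => by
      rw [LinearMap.smul_apply]; simp [TensorProduct.smul_tmul'])

theorem contractAux_tmul (p q q' h : A) :
    contractAux D (p ⊗ₜ q) (q' ⊗ₜ h) = (p * D (q * q')) ⊗ₜ h := rfl

theorem contractAux_balanced (f : A) (x y : A ⊗[S] A) :
    contractAux D (1 ⊗ₜ f * x) y = contractAux D x (f ⊗ₜ 1 * y) := by
  induction x with
  | zero => simp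
  | add a b h1 h2 => simp only [mul_add, map_add, LinearMap.add_apply, h1, h2]
  | tmul p q =>
    induction y with
    | zero => simp
    | add a b h1 h2 => simp only [mul_add, map_add, h1, h2]
    | tmul q' h =>
      simp only [Algebra.TensorProduct.tmul_mul_tmul, one_mul, contractAux_tmul]
      rw [mul_left_comm q f q', mul_assoc f q q']

theorem contractAux_left (f : A) (x y : A ⊗[S] A) :
    contractAux D (f ⊗ₜ 1 * x) y = f ⊗ₜ 1 * contractAux D x y := by
  induction x with
  | zero => simp
  | add a b h1 h2 => simp only [mul_add, map_add, LinearMap.add_apply, h1, h2]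
  | tmul p q =>
    induction y with
    | zero => simp
    | add a b h1 h2 => simp only [mul_add, map_add, h1, h2]
    | tmul q' h =>
      simp only [Algebra.TensorProduct.tmul_mul_tmul, one_mul, contractAux_tmul, mul_assoc]

theorem contractAux_right (f : A) (x y : A ⊗[S] A) :
    contractAux D x (1 ⊗ₜ f * y) = 1 ⊗ₜ f * contractAux D x y := by
  induction x with
  | zero => simp
  | add a b h1 h2 => simp only [mul_add, map_add, LinearMap.add_apply, h1, h2]
  | tmul p q =>
    induction y with
    | zero => simp
    | add a b h1 h2 => simp only [mul_add, map_add, h1, h2]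
    | tmul q' h =>
      simp only [Algebra.TensorProduct.tmul_mul_tmul, one_mul, contractAux_tmul]

end Contract

/-- The morphism `j_t : B_t B_t → B_t`, `(p ⊗ q) ⊗ (q' ⊗ h) ↦ p ∂_t(q q') ⊗ h`; under
`B_t B_t ≅ R ⊗_{R^t} R ⊗_{R^t} R(2)` it is `p ⊗ q ⊗ h ↦ p ∂_t(q) ⊗ h`. -/
def contract (t : Simple) : Hom (B t ⊗ᵍ B t) (B t) :=
  Hom.ofTensor (M := B t) (N := B t) (P := B t)
    (AddMonoidHom.mk' (fun x => (contractAux (partialLin t) x).toAddMonoidHom)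
      (fun x x' => AddMonoidHom.ext fun y =>
        LinearMap.congr_fun ((contractAux (partialLin t)).map_add x x') y))
    (fun f x y => contractAux_balanced (partialLin t) f x y)
    (fun f x y => contractAux_left (partialLin t) f x y)
    (fun f x y => contractAux_right (partialLin t) f x y)

/-- The element `p ⊗ q` of `B_t`. -/
def B.tmul (t : Simple) (p q : R) : (B t).carrier := p ⊗ₜ[invariants {t.perm}] q

theorem B.tmul_add (t : Simple) (p q q' : R) :
    B.tmul t p (q + q') = B.tmul t p q + B.tmul t p q' := TensorProduct.tmul_add ..

theorem B.add_tmul (t : Simple) (p p' q : R) :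
    B.tmul t (p + p') q = B.tmul t p q + B.tmul t p' q := TensorProduct.add_tmul ..

theorem B.left_tmul (t : Simple) (f p q : R) :
    (B t).left f (B.tmul t p q) = B.tmul t (f * p) q := by
  refine (Algebra.TensorProduct.tmul_mul_tmul (R := invariants {t.perm}) f p (1 : R) q).trans ?_
  rw [one_mul]; rfl

theorem B.right_tmul (t : Simple) (f p q : R) :
    (B t).right f (B.tmul t p q) = B.tmul t p (f * q) := by
  refine (Algebra.TensorProduct.tmul_mul_tmul (R := invariants {t.perm}) (1 : R) p f q).trans ?_
  rw [one_mul]; rfl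

theorem B.tmul_comm (t : Simple) {a : R} (ha : a ∈ invariants {t.perm}) (p q : R) :
    B.tmul t (a * p) q = B.tmul t p (a * q) := tmul_comm_of_mem ha p q

theorem B.induction {t : Simple} {motive : (B t).carrier → Prop} (zero : motive 0)
    (tmul : ∀ p q, motive (B.tmul t p q)) (add : ∀ a b, motive a → motive b → motive (a + b))
    (x : (B t).carrier) : motive x :=
  TensorProduct.induction_on x zero tmul add

/-- The additive map `p ⊗ q ↦ φ p q` given by an `R^t`-balanced biadditive map `φ`. -/
def B.liftAdd (t : Simple) {P : Type*} [AddCommGroup P] (φ : R →+ R →+ P)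
    (hb : ∀ a ∈ invariants {t.perm}, ∀ p q, φ (a * p) q = φ p (a * q)) : (B t).carrier →+ P :=
  TensorProduct.liftAddHom (R := invariants {t.perm}) (M := R) (N := R) φ
    (fun a p q => hb a.1 a.2 p q)

theorem B.liftAdd_tmul (t : Simple) {P : Type*} [AddCommGroup P] (φ : R →+ R →+ P)
    (hb : ∀ a ∈ invariants {t.perm}, ∀ p q, φ (a * p) q = φ p (a * q)) (p q : R) :
    B.liftAdd t φ hb (B.tmul t p q) = φ p q := rfl

/-- The biadditive map `(p, q) ↦ (p ⊗ 1) ⊗ (1 ⊗ q)` to `B_t B_t`. -/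
def contractAdjAux (t : Simple) : R →+ R →+ (B t ⊗ᵍ B t).carrier :=
  AddMonoidHom.mk' (fun p => AddMonoidHom.mk' (fun q => tmul (B.tmul t p 1) (B.tmul t 1 q))
      (fun q q' => by rw [B.tmul_add, tmul_add]))
    (fun p p' => AddMonoidHom.ext fun q =>
      (congrArg (fun x => tmul x (B.tmul t 1 q)) (B.add_tmul t p p' 1)).trans (add_tmul _ _ _))

theorem contractAdjAux_apply (t : Simple) (p q : R) :
    contractAdjAux t p q = tmul (B.tmul t p 1) (B.tmul t 1 q) := rfl

/-- The adjoint `j_t^a : B_t → B_t B_t`, `p ⊗ q ↦ (p ⊗ 1) ⊗ (1 ⊗ q)`; under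
`B_t B_t ≅ R ⊗_{R^t} R ⊗_{R^t} R(2)` it is `p ⊗ q ↦ p ⊗ 1 ⊗ q`. -/
def contractAdj (t : Simple) : Hom (B t) (B t ⊗ᵍ B t) :=
  Hom.ofAdd
    (B.liftAdd t (contractAdjAux t) (fun a ha p q => by
      rw [contractAdjAux_apply, contractAdjAux_apply, B.tmul_comm t ha, ← B.right_tmul,
        tmul_balanced, B.left_tmul, B.tmul_comm t ha]))
    (fun f x => by
      induction x using B.induction with
      | zero => rw [map_zero, map_zero, map_zero]
      | add a b h1 h2 => rw [map_add, map_add, map_add, map_add, h1, h2]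
      | tmul p q =>
        rw [B.left_tmul, B.liftAdd_tmul, B.liftAdd_tmul, contractAdjAux_apply,
          contractAdjAux_apply, left_tmul, B.left_tmul])
    (fun f x => by
      induction x using B.induction with
      | zero => rw [map_zero, map_zero, map_zero]
      | add a b h1 h2 => rw [map_add, map_add, map_add, map_add, h1, h2]
      | tmul p q =>
        rw [B.right_tmul, B.liftAdd_tmul, B.liftAdd_tmul, contractAdjAux_apply,
          contractAdjAux_apply, right_tmul, B.right_tmul])

/-- The endomorphism `e = - m_u^a ∘ j_t^a ∘ j_t ∘ m_u` of `B_t B_u B_t`, where `m_u` stands for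
`id ⊗ m_u ⊗ id : B_t B_u B_t → B_t B_t` and `m_u^a` for `id ⊗ m_u^a ⊗ id`. -/
def idem (t u : Simple) : Hom (B t ⊗ᵍ B u ⊗ᵍ B t) (B t ⊗ᵍ B u ⊗ᵍ B t) :=
  let m : Hom (B t ⊗ᵍ B u ⊗ᵍ B t) (B t ⊗ᵍ B t) :=
    Hom.whiskerRight ((rightUnitor (B t)).comp (Hom.whiskerLeft (B t) (mul u))) (B t)
  let ma : Hom (B t ⊗ᵍ B t) (B t ⊗ᵍ B u ⊗ᵍ B t) :=
    Hom.whiskerRight ((Hom.whiskerLeft (B t) (mulAdj u)).comp (rightUnitorInv (B t))) (B t)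
  (ma.comp ((contractAdj t).comp ((contract t).comp m))).neg

end Soergel

end

universe u v

open scoped TensorProduct

noncomputable section

namespace Soergel

/-! ### Isomorphisms of graded bimodules -/

section Basics

variable {M : GradedBimodule} {N : GradedBimodule} {P : GradedBimodule}

/-! Write `W = S₃`. Everything rests on divided differences and on bases of `R` over rings of
invariants. `R` is free over `R^t` on `1, α_t`. `R^t` is free over `R^W` on `w², w, 1`, where `w` is
a `t`-invariant linear form with `∂_u w = 1`. The products of these elements form a basis of `R`
over `R^W` in degrees 0, 2, 2, 4, 4, 6 (`fullBasis`). The point behind the second basis is that `∂_t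
∂_u` maps `R^t` into `R^W` (`partial_partial_mem`).

If `R^{T'} ⊆ R^T` and `R` has a homogeneous basis `e_i` over `R^T`, then `(R ⊗_{R^T} R)(R ⊗_{R^{T'}}
R) = R ⊗_{R^T} R ⊗_{R^{T'}} R` splits along the basis of the middle factor: each `e_i` contributes a
copy of `R ⊗_{R^{T'}} R` shifted by `-deg e_i` (`induced_tensor_induced_left`). This yields the
decompositions of `B_t B_t`, `B_t B_{srs}` and `B_{srs} B_{srs}`; the mirror image yields that of
`B_{srs} B_t`.

For `B_t B_u B_t = R ⊗_{R^t} R ⊗_{R^u} R ⊗_{R^t} R(3)`, the idempotent factors as `e = -ι ∘ ρ`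
through `B_t`, with `ρ` = `retract` and `ι` = `coretract`. The identity `ρ ∘ ι = -1` comes down to
`∂_t(2 α_u) = -1`; hence `e` is idempotent with image `ι(B_t) ≅ B_t`. The complement is the image of
`long : B_{srs} → B_t B_u B_t`, `1 ⊗ 1 ↦ 1 ⊗ 1 ⊗ 1 ⊗ 1`, which `ρ` kills because `∂_t 1 = 0`. Two
facts remain. The images of `long` and `ι` together span, since their generators generate the
bimodule (`middle_generates`). And `long` is injective, since the coordinates on `R ⊗_{R^W} R`
vanish on its kernel: they are built from compositions of `R^t`-, `R^u`- and `R^t`-linear maps, and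
these extend to functionals on `B_t B_u B_t` (`long_injective`).

Closure under tensor products then needs only additivity and associativity: a product of two of the
six bimodules is computed by multiplying repeatedly by `B_s`, `B_r` or `B_{srs}`, and each such
product is covered by the isomorphisms above. -/

theorem Hom.HasDegree.comp {ψ : Hom N P} {φ : Hom M N} {a b : ℤ} (hψ : ψ.HasDegree b)
    (hφ : φ.HasDegree a) : (ψ.comp φ).HasDegree (a + b) := fun k m hm => by
  rw [← add_assoc]
  exact hψ _ _ (hφ k m hm)

theorem Hom.HasDegree.cast {φ : Hom M N} {a b : ℤ} (h : φ.HasDegree a) (hab : a = b) :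
    φ.HasDegree b := hab ▸ h

theorem GradedBimodule.deg_cast {M : GradedBimodule} {i j : ℤ} {m : M.carrier} (h : m ∈ M.deg i)
    (hij : i = j) : m ∈ M.deg j := hij ▸ h

/-- The decomposition of the elements of `M` into homogeneous components. -/
theorem GradedBimodule.exists_decomposition (M : GradedBimodule) :
    ∃ d : M.carrier →ₗ[ℝ] (ℤ →₀ M.carrier), (∀ i, ∀ m ∈ M.deg i, d m = Finsupp.single i m) ∧
      (∀ m i, d m i ∈ M.deg i) ∧ ∀ m, ((d m).sum fun _ x => x) = m := by
  classical
  obtain ⟨d, hd⟩ := exists_components M.isInternal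
  have ht := M.isInternal.submodule_iSup_eq_top
  refine ⟨d, hd, fun m i => ?_, fun m => ?_⟩
  · have hm : m ∈ ⨆ k, M.deg k := ht ▸ Submodule.mem_top
    induction hm using Submodule.iSup_induction' with
    | zero => simp
    | add a b _ _ h1 h2 => rw [map_add, Finsupp.add_apply]; exact Submodule.add_mem _ h1 h2
    | mem k m hm =>
      rw [hd k m hm, Finsupp.single_apply]
      split_ifs with h
      · exact h ▸ hm
      · exact Submodule.zero_mem _
  · have hm : m ∈ ⨆ k, M.deg k := ht ▸ Submodule.mem_top
    induction hm using Submodule.iSup_induction' with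
    | zero => simp
    | add a b _ _ h1 h2 =>
      rw [map_add, Finsupp.sum_add_index' (fun _ => rfl) (fun _ _ _ => rfl), h1, h2]
    | mem k m hm => rw [hd k m hm, Finsupp.sum_single_index rfl]

/-- A morphism of degree 0 commutes with taking homogeneous components. If `φ m` has only a
component in degree `k`, injectivity kills all other components of `m`. Hence, when an isomorphism
is built, only one direction of compatibility with the gradings has to be checked. -/
theorem Hom.HasDegree.mem_deg_of_injective {φ : Hom M N} (hφ : φ.HasDegree 0)
    (hi : Function.Injective φ.toLin) {k : ℤ} {m : M.carrier} (hm : φ.toLin m ∈ N.deg k) :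
    m ∈ M.deg k := by
  classical
  obtain ⟨d, hd, hd', hs⟩ := M.exists_decomposition
  obtain ⟨e, he, -, -⟩ := N.exists_decomposition
  have h : ∀ m, ∀ j, e (φ.toLin m) j = φ.toLin (d m j) := by
    intro m j
    have hm : m ∈ ⨆ k, M.deg k := M.isInternal.submodule_iSup_eq_top ▸ Submodule.mem_top
    induction hm using Submodule.iSup_induction' with
    | zero => simp
    | add a b _ _ h1 h2 => simp [h1, h2]
    | mem i m hm =>
      have := hφ i m hm
      rw [add_zero] at this
      rw [hd i m hm, he i _ this, Finsupp.single_apply, Finsupp.single_apply]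
      split_ifs <;> simp
  have h1 : d m = Finsupp.single k (d m k) := by
    ext j
    rw [Finsupp.single_apply]
    split_ifs with hj
    · rw [hj]
    · apply hi
      rw [← h, he k _ hm, Finsupp.single_apply, if_neg hj, map_zero]
  rw [← hs m, h1, Finsupp.sum_single_index rfl]
  exact hd' m k

/-- A bijective morphism of degree `0` is an isomorphism. -/
theorem Hom.HasDegree.isIsomorphic {φ : Hom M N} (hφ : φ.HasDegree 0)
    (hb : Function.Bijective φ.toLin) : M ≅ᵍ N :=
  ⟨{ toEquiv := LinearEquiv.ofBijective φ.toLin hb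
     map_left := φ.map_left
     map_right := φ.map_right
     map_deg := fun k m => ⟨fun hm => N.deg_cast (hφ k m hm) (add_zero k),
      hφ.mem_deg_of_injective hb.1⟩ }⟩

/-- A morphism of degree `0` with a set-theoretic inverse is an isomorphism. -/
theorem Hom.HasDegree.isIsomorphic_of_inverse {φ : Hom M N} (hφ : φ.HasDegree 0)
    (ψ : N.carrier → M.carrier) (h1 : ∀ m, ψ (φ.toLin m) = m) (h2 : ∀ n, φ.toLin (ψ n) = n) :
    M ≅ᵍ N :=
  hφ.isIsomorphic ⟨Function.LeftInverse.injective h1, Function.RightInverse.surjective h2⟩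

/-- The morphism underlying an isomorphism. -/
def Iso.hom (e : Iso M N) : Hom M N := ⟨e.toEquiv.toLinearMap, e.map_left, e.map_right⟩

theorem Iso.hom_hasDegree (e : Iso M N) : e.hom.HasDegree 0 := fun k m hm =>
  N.deg_cast ((e.map_deg k m).1 hm) (add_zero k).symm

/-- The inverse of an isomorphism. -/
def Iso.symm (e : Iso M N) : Iso N M where
  toEquiv := e.toEquiv.symm
  map_left := fun f n => by
    rw [LinearEquiv.symm_apply_eq, e.map_left, LinearEquiv.apply_symm_apply]
  map_right := fun f n => by
    rw [LinearEquiv.symm_apply_eq, e.map_right, LinearEquiv.apply_symm_apply]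
  map_deg := fun k n => by rw [e.map_deg, LinearEquiv.apply_symm_apply]

/-- The composition of isomorphisms. -/
def Iso.trans (e : Iso M N) (e' : Iso N P) : Iso M P where
  toEquiv := e.toEquiv.trans e'.toEquiv
  map_left := fun f m => by simp [e.map_left, e'.map_left]
  map_right := fun f m => by simp [e.map_right, e'.map_right]
  map_deg := fun k m => by rw [e.map_deg, e'.map_deg, LinearEquiv.trans_apply]

theorem IsIsomorphic.symm (h : M ≅ᵍ N) : N ≅ᵍ M := h.map Iso.symm

theorem IsIsomorphic.trans (h : M ≅ᵍ N) (h' : N ≅ᵍ P) : M ≅ᵍ P :=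
  h.elim fun e => h'.elim fun e' => ⟨e.trans e'⟩

end Basics

/-! ### Shifts -/

section Shift

variable {M : GradedBimodule} {N : GradedBimodule}

theorem IsIsomorphic.shift (h : M ≅ᵍ N) (n : ℤ) : M.shift n ≅ᵍ N.shift n :=
  h.map fun e => ⟨e.toEquiv, e.map_left, e.map_right, fun k m => e.map_deg (n + k) m⟩

theorem shift_shift (M : GradedBimodule) {a b c : ℤ} (h : a + b = c) :
    (M.shift a).shift b ≅ᵍ M.shift c :=
  ⟨⟨LinearEquiv.refl ℝ _, fun _ _ => rfl, fun _ _ => rfl, fun k m => by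
    change m ∈ M.deg (a + (b + k)) ↔ m ∈ M.deg (c + k)
    rw [← h, add_assoc]⟩⟩

theorem shift_zero (M : GradedBimodule) : M.shift 0 ≅ᵍ M :=
  ⟨⟨LinearEquiv.refl ℝ _, fun _ _ => rfl, fun _ _ => rfl, fun k m => by
    change m ∈ M.deg (0 + k) ↔ m ∈ M.deg k
    rw [zero_add]⟩⟩

end Shift

/-! ### Direct sums -/

section DirectSum

variable {ι κ : Type} [Fintype ι] [Fintype κ] {M N : ι → GradedBimodule}

theorem IsIsomorphic.directSum (h : ∀ i, M i ≅ᵍ N i) :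
    Soergel.directSum M ≅ᵍ Soergel.directSum N :=
  let e := fun i => Classical.choice (h i)
  ⟨⟨LinearEquiv.piCongrRight fun i => (e i).toEquiv,
    fun f m => funext fun i => (e i).map_left f (m i),
    fun f m => funext fun i => (e i).map_right f (m i),
    fun k m => forall₂_congr fun i _ => (e i).map_deg k (m i)⟩⟩

theorem directSum_shift (M : ι → GradedBimodule) (n : ℤ) :
    (directSum M).shift n ≅ᵍ directSum fun i => (M i).shift n :=
  ⟨⟨LinearEquiv.refl ℝ _, fun _ _ => rfl, fun _ _ => rfl, fun _ _ => Iff.rfl⟩⟩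

/-- The projection of a direct sum to a summand. -/
def Hom.proj (M : ι → GradedBimodule) (i : ι) : Hom (Soergel.directSum M) (M i) :=
  ⟨LinearMap.proj i, fun _ _ => rfl, fun _ _ => rfl⟩

theorem Hom.proj_hasDegree (M : ι → GradedBimodule) (i : ι) : (Hom.proj M i).HasDegree 0 :=
  fun k _ hm => (M i).deg_cast (hm i trivial) (add_zero k).symm

/-- The morphism to a direct sum with given components. -/
def Hom.pi {P : GradedBimodule} (φ : ∀ i, Hom P (M i)) : Hom P (Soergel.directSum M) :=
  ⟨LinearMap.pi fun i => (φ i).toLin, fun f m => funext fun i => (φ i).map_left f m,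
    fun f m => funext fun i => (φ i).map_right f m⟩

theorem Hom.HasDegree.pi {P : GradedBimodule} {φ : ∀ i, Hom P (M i)} {d : ℤ}
    (h : ∀ i, (φ i).HasDegree d) : (Hom.pi φ).HasDegree d :=
  fun k m hm i _ => h i k m hm

open scoped Classical in
/-- The inclusion of a summand into a direct sum. -/
def Hom.single (M : ι → GradedBimodule) (i : ι) : Hom (M i) (Soergel.directSum M) :=
  ⟨LinearMap.single ℝ (fun i => (M i).carrier) i,
    fun f m => by
      funext j
      change Pi.single (M := fun i => (M i).carrier) i ((M i).left f m) j =
        (M j).left f (Pi.single (M := fun i => (M i).carrier) i m j)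
      by_cases h : j = i
      · subst h; simp
      · simp [h],
    fun f m => by
      funext j
      change Pi.single (M := fun i => (M i).carrier) i ((M i).right f m) j =
        (M j).right f (Pi.single (M := fun i => (M i).carrier) i m j)
      by_cases h : j = i
      · subst h; simp
      · simp [h]⟩

theorem proj_single_same (i : ι) (m : (M i).carrier) :
    (Hom.proj M i).toLin ((Hom.single M i).toLin m) = m :=
  open scoped Classical in Pi.single_eq_same (M := fun i => (M i).carrier) i m

theorem proj_single_ne {i j : ι} (h : j ≠ i) (m : (M i).carrier) :
    (Hom.proj M j).toLin ((Hom.single M i).toLin m) = 0 :=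
  open scoped Classical in Pi.single_eq_of_ne (M := fun i => (M i).carrier) h m

theorem sum_single_proj (m : (directSum M).carrier) :
    ∑ i, (Hom.single M i).toLin ((Hom.proj M i).toLin m) = m := by
  funext j
  refine (map_sum (Hom.proj M j).toLin _ _).trans ?_
  rw [Finset.sum_eq_single j (fun i _ h => proj_single_ne h.symm _)
    (fun h => absurd (Finset.mem_univ j) h), proj_single_same]
  rfl

theorem directSum_reindex (M : ι → GradedBimodule) (e : κ ≃ ι) :
    directSum M ≅ᵍ directSum fun k => M (e k) := by
  refine Hom.HasDegree.isIsomorphic (φ := Hom.pi fun k => Hom.proj M (e k))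
    (Hom.HasDegree.pi fun k => Hom.proj_hasDegree M (e k)) ⟨fun m m' h => ?_, fun n => ?_⟩
  · funext i
    obtain ⟨k, rfl⟩ := e.surjective i
    exact congrFun h k
  · refine ⟨Equiv.piCongrLeft (fun i => (M i).carrier) e n, funext fun k => ?_⟩
    exact Equiv.piCongrLeft_apply_apply (fun i => (M i).carrier) e n k

theorem directSum_sigma {κ : ι → Type} [∀ i, Fintype (κ i)] (M : ∀ i, κ i → GradedBimodule) :
    (directSum fun i => directSum (M i)) ≅ᵍ directSum fun p : Σ i, κ i => M p.1 p.2 :=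
  Hom.HasDegree.isIsomorphic_of_inverse
    (φ := Hom.pi fun p : Σ i, κ i =>
      (Hom.proj (M p.1) p.2).comp (Hom.proj (fun i => directSum (M i)) p.1))
    (Hom.HasDegree.pi fun p => (Hom.proj_hasDegree (M p.1) p.2).comp
      (Hom.proj_hasDegree (fun i => directSum (M i)) p.1))
    (fun n i j => n ⟨i, j⟩) (fun _ => rfl) (fun _ => rfl)

end DirectSum

/-! ### Tensor products -/

section TensorDeg

variable (S : Type*) {M N : Type*} [CommRing S] [Algebra ℝ S] [AddCommGroup M] [Module ℝ M]
  [Module S M] [IsScalarTower ℝ S M] [AddCommGroup N] [Module ℝ N] [Module S N]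
  {ℳ : ℤ → Submodule ℝ M} {𝒩 : ℤ → Submodule ℝ N}

theorem tmul_mem_tensorDeg {i j k : ℤ} {m : M} {n : N} (hm : m ∈ ℳ i) (hn : n ∈ 𝒩 j)
    (h : i + j = k) : m ⊗ₜ[S] n ∈ tensorDeg S ℳ 𝒩 k :=
  Submodule.subset_span ⟨i, j, h, m, hm, n, hn, rfl⟩

theorem tensorDeg_le {k : ℤ} {V : Submodule ℝ (M ⊗[S] N)}
    (h : ∀ i j, i + j = k → ∀ m ∈ ℳ i, ∀ n ∈ 𝒩 j, m ⊗ₜ[S] n ∈ V) :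
    tensorDeg S ℳ 𝒩 k ≤ V := by
  refine Submodule.span_le.2 ?_
  rintro t ⟨i, j, hij, m, hm, n, hn, rfl⟩
  exact h i j hij m hm n hn

end TensorDeg

section Tensor

variable {M : GradedBimodule} {N : GradedBimodule} {P : GradedBimodule}

theorem tmul_mem {i j k : ℤ} {m : M.carrier} {n : N.carrier} (hm : m ∈ M.deg i)
    (hn : n ∈ N.deg j) (h : i + j = k) : tmul m n ∈ (M ⊗ᵍ N).deg k :=
  tmul_mem_tensorDeg R (M := M.RightMod) (N := N.LeftMod) (ℳ := M.deg) (𝒩 := N.deg) hm hn h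

theorem deg_tensor_le {k : ℤ} {S : Submodule ℝ (M ⊗ᵍ N).carrier}
    (h : ∀ i j, i + j = k → ∀ m ∈ M.deg i, ∀ n ∈ N.deg j, tmul m n ∈ S) :
    (M ⊗ᵍ N).deg k ≤ S := by
  exact tensorDeg_le R (M := M.RightMod) (N := N.LeftMod) (ℳ := M.deg) (𝒩 := N.deg) h

theorem Hom.HasDegree.of_tmul {φ : Hom (M ⊗ᵍ N) P} {d : ℤ}
    (h : ∀ i j, ∀ m ∈ M.deg i, ∀ n ∈ N.deg j, φ.toLin (tmul m n) ∈ P.deg (i + j + d)) :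
    φ.HasDegree d := fun k =>
  deg_tensor_le (S := (P.deg (k + d)).comap φ.toLin) fun i j hij m hm n hn => by
    rw [← hij]
    exact h i j m hm n hn

theorem addHom_ext {A : Type*} [AddCommGroup A] {φ ψ : (M ⊗ᵍ N).carrier →+ A}
    (h : ∀ m n, φ (tmul m n) = ψ (tmul m n)) : φ = ψ := by
  ext t
  induction t using tensor_induction with
  | zero => rw [map_zero, map_zero]
  | tmul m n => exact h m n
  | add a b h1 h2 => rw [map_add, map_add, h1, h2]

theorem Hom.ext_tmul {φ ψ : Hom (M ⊗ᵍ N) P}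
    (h : ∀ m n, φ.toLin (tmul m n) = ψ.toLin (tmul m n)) : φ = ψ :=
  Hom.ext (LinearMap.toAddMonoidHom_injective (addHom_ext h))

theorem Hom.congr_apply {φ ψ : Hom M N} (h : φ = ψ) (m : M.carrier) : φ.toLin m = ψ.toLin m := by
  rw [h]

/-- The linear map `m ↦ m ⊗ n`. -/
def tmulRight (M : GradedBimodule) {N : GradedBimodule} (n : N.carrier) :
    M.carrier →ₗ[ℝ] (M ⊗ᵍ N).carrier where
  toFun m := tmul m n
  map_add' m m' := add_tmul m m' n
  map_smul' c m := by
    rw [← left_algebraMap, ← left_tmul, left_algebraMap]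
    rfl

theorem whiskerRight_tmul (φ : Hom M P) (m : M.carrier) (n : N.carrier) :
    (φ.whiskerRight N).toLin (tmul m n) = tmul (φ.toLin m) n := rfl

theorem whiskerLeft_tmul (φ : Hom N P) (m : M.carrier) (n : N.carrier) :
    (Hom.whiskerLeft M φ).toLin (tmul m n) = tmul m (φ.toLin n) := rfl

theorem Hom.HasDegree.whiskerRight {φ : Hom M P} {d : ℤ} (h : φ.HasDegree d)
    (N : GradedBimodule) : (φ.whiskerRight N).HasDegree d :=
  Hom.HasDegree.of_tmul fun i j m hm n hn => by
    rw [whiskerRight_tmul]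
    exact tmul_mem (h i m hm) hn (add_right_comm ..)

theorem Hom.HasDegree.whiskerLeft (M : GradedBimodule) {φ : Hom N P} {d : ℤ} (h : φ.HasDegree d) :
    (Hom.whiskerLeft M φ).HasDegree d :=
  Hom.HasDegree.of_tmul fun i j m hm n hn => by
    rw [whiskerLeft_tmul]
    exact tmul_mem hm (h j n hn) (add_assoc ..).symm

theorem IsIsomorphic.tensor_right (h : M ≅ᵍ P) (N : GradedBimodule) : M ⊗ᵍ N ≅ᵍ P ⊗ᵍ N := by
  obtain ⟨e⟩ := h
  refine Hom.HasDegree.isIsomorphic_of_inverse (e.hom_hasDegree.whiskerRight N)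
    (e.symm.hom.whiskerRight N).toLin (fun t => ?_) (fun t => ?_)
  · refine Hom.congr_apply (φ := (e.symm.hom.whiskerRight N).comp (e.hom.whiskerRight N))
      (ψ := Hom.id _) (Hom.ext_tmul fun m n => ?_) t
    exact congrArg (tmul · n) (e.toEquiv.symm_apply_apply m)
  · refine Hom.congr_apply (φ := (e.hom.whiskerRight N).comp (e.symm.hom.whiskerRight N))
      (ψ := Hom.id _) (Hom.ext_tmul fun m n => ?_) t
    exact congrArg (tmul · n) (e.toEquiv.apply_symm_apply m)

theorem IsIsomorphic.tensor_left (M : GradedBimodule) (h : N ≅ᵍ P) : M ⊗ᵍ N ≅ᵍ M ⊗ᵍ P := by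
  obtain ⟨e⟩ := h
  refine Hom.HasDegree.isIsomorphic_of_inverse (e.hom_hasDegree.whiskerLeft M)
    (Hom.whiskerLeft M e.symm.hom).toLin (fun t => ?_) (fun t => ?_)
  · refine Hom.congr_apply (φ := (Hom.whiskerLeft M e.symm.hom).comp (Hom.whiskerLeft M e.hom))
      (ψ := Hom.id _) (Hom.ext_tmul fun m n => ?_) t
    exact congrArg (tmul m ·) (e.toEquiv.symm_apply_apply n)
  · refine Hom.congr_apply (φ := (Hom.whiskerLeft M e.hom).comp (Hom.whiskerLeft M e.symm.hom))
      (ψ := Hom.id _) (Hom.ext_tmul fun m n => ?_) t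
    exact congrArg (tmul m ·) (e.toEquiv.apply_symm_apply n)

theorem tensor_shift_shift (M : GradedBimodule) (N : GradedBimodule) {a b c : ℤ} (h : a + b = c) :
    M.shift a ⊗ᵍ N.shift b ≅ᵍ (M ⊗ᵍ N).shift c := by
  refine Hom.HasDegree.isIsomorphic_of_inverse (M := M.shift a ⊗ᵍ N.shift b)
    (N := (M ⊗ᵍ N).shift c) (φ := ⟨LinearMap.id, fun _ _ => rfl, fun _ _ => rfl⟩)
    (Hom.HasDegree.of_tmul fun i j m hm n hn => ?_) (fun t => t) (fun _ => rfl) (fun _ => rfl)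
  -- Degree `i` in `M(a)` is degree `a + i` in `M`, and likewise for `N`, so the identity of the
  -- underlying tensor product preserves degrees.
  exact tmul_mem (M := M) (N := N) (i := a + i) (j := b + j) hm hn (by rw [← h]; ring)

theorem rightUnitor_hasDegree (M : GradedBimodule) : (rightUnitor M).HasDegree 0 :=
  Hom.HasDegree.of_tmul fun i j m hm (f : R) hf =>
    M.deg_cast (M.right_mem (f := f) hf hm) (by ring)

theorem R.one_mem : (1 : R) ∈ R.deg 0 := MvPolynomial.isWeightedHomogeneous_one ℝ _

theorem rightUnitorInv_hasDegree (M : GradedBimodule) : (rightUnitorInv M).HasDegree 0 :=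
  fun _ _ hm => tmul_mem (N := unit) hm R.one_mem rfl

theorem tensor_unit (M : GradedBimodule) : M ⊗ᵍ unit ≅ᵍ M := by
  refine (rightUnitor_hasDegree M).isIsomorphic_of_inverse (rightUnitorInv M).toLin
    (fun t => ?_) (fun m => ?_)
  · refine Hom.congr_apply (φ := (rightUnitorInv M).comp (rightUnitor M)) (ψ := Hom.id _)
      (Hom.ext_tmul fun m (f : R) => ?_) t
    refine (tmul_balanced (N := unit) f m (1 : R)).trans ?_
    exact congrArg (tmul (N := unit) m) (mul_one f)
  · exact LinearMap.congr_fun (map_one M.right) m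

/-- The canonical map `R M → M`, `f ⊗ m ↦ f m`. -/
def leftUnitor (M : GradedBimodule) : Hom (unit ⊗ᵍ M) M :=
  Hom.ofTensor (M := unit)
    (AddMonoidHom.mk' (fun f : R => (M.left f).toAddMonoidHom)
      (fun f g : R => AddMonoidHom.ext fun m => LinearMap.congr_fun (M.left.map_add f g) m))
    (fun f (g : R) m => by
      change M.left (f * g) m = M.left g (M.left f m)
      rw [mul_comm, map_mul]; rfl)
    (fun f (g : R) m => by
      change M.left (f * g) m = M.left f (M.left g m)
      rw [map_mul]; rfl)
    (fun f (g : R) m => M.left_right g f m)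

theorem unit_tensor (M : GradedBimodule) : unit ⊗ᵍ M ≅ᵍ M := by
  have h : (leftUnitor M).HasDegree 0 := Hom.HasDegree.of_tmul fun i j (f : R) hf m hm =>
    M.deg_cast (M.left_mem (f := f) hf hm) (by ring)
  refine h.isIsomorphic_of_inverse (fun m => tmul (M := unit) (1 : R) m)
    (fun t => ?_) (fun m => LinearMap.congr_fun (map_one M.left) m)
  refine DFunLike.congr_fun (addHom_ext (M := unit) (N := M)
    (φ := (tmulHom unit M (1 : R)).comp (leftUnitor M).toLin.toAddMonoidHom)
    (ψ := AddMonoidHom.id _) fun (f : R) m => ?_) t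
  refine (tmul_balanced (M := unit) f (1 : R) m).symm.trans ?_
  exact congrArg (tmul (M := unit) · m) (mul_one f)

/-- The associator `(M N) P → M (N P)`. -/
def assocHom (M : GradedBimodule) (N : GradedBimodule) (P : GradedBimodule) :
    Hom (M ⊗ᵍ N ⊗ᵍ P) (M ⊗ᵍ (N ⊗ᵍ P)) :=
  Hom.ofTensor
    (liftAdd (AddMonoidHom.mk' (fun m => (AddMonoidHom.compHom (tmulHom M (N ⊗ᵍ P) m)).comp
        (tmulHom N P)) (fun m m' => AddMonoidHom.ext fun n => AddMonoidHom.ext fun p =>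
          add_tmul (N := N ⊗ᵍ P) m m' (tmul n p)))
      (fun f m n => AddMonoidHom.ext fun p => tmul_balanced (N := N ⊗ᵍ P) f m (tmul n p)))
    (fun f t p => by
      induction t using tensor_induction with
      | zero => simp only [map_zero, AddMonoidHom.zero_apply]
      | add a b h1 h2 => simp only [map_add, AddMonoidHom.add_apply, h1, h2]
      | tmul m n => exact congrArg (tmul (N := N ⊗ᵍ P) m) (tmul_balanced f n p))
    (fun f t p => by
      induction t using tensor_induction with
      | zero => simp only [map_zero, AddMonoidHom.zero_apply]
      | add a b h1 h2 => simp only [map_add, AddMonoidHom.add_apply, h1, h2]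
      | tmul m n => rfl)
    (fun f t p => by
      induction t using tensor_induction with
      | zero => simp only [map_zero, AddMonoidHom.zero_apply]
      | add a b h1 h2 => simp only [map_add, AddMonoidHom.add_apply, h1, h2]
      | tmul m n => rfl)

/-- The inverse associator `M (N P) → (M N) P`. -/
def assocInv (M : GradedBimodule) (N : GradedBimodule) (P : GradedBimodule) :
    (M ⊗ᵍ (N ⊗ᵍ P)).carrier →+ (M ⊗ᵍ N ⊗ᵍ P).carrier :=
  liftAdd (AddMonoidHom.mk' (fun m => liftAdd ((tmulHom (M ⊗ᵍ N) P).comp (tmulHom M N m))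
      (fun f n p => tmul_balanced f (tmul m n) p))
      (fun m m' => addHom_ext fun n p =>
        (congrArg (tmul · p) (add_tmul m m' n)).trans (add_tmul (tmul m n) (tmul m' n) p)))
    (fun f m t => DFunLike.congr_fun (addHom_ext
      (φ := liftAdd ((tmulHom (M ⊗ᵍ N) P).comp (tmulHom M N (M.right f m)))
        (fun f n p => tmul_balanced f (tmul _ n) p))
      (ψ := (liftAdd ((tmulHom (M ⊗ᵍ N) P).comp (tmulHom M N m))
        (fun f n p => tmul_balanced f (tmul m n) p)).comp ((N ⊗ᵍ P).left f).toAddMonoidHom)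
      fun n p => congrArg (tmul · p) (tmul_balanced f m n)) t)

theorem tensor_assoc (M : GradedBimodule) (N : GradedBimodule) (P : GradedBimodule) :
    M ⊗ᵍ N ⊗ᵍ P ≅ᵍ M ⊗ᵍ (N ⊗ᵍ P) := by
  have h : (assocHom M N P).HasDegree 0 := Hom.HasDegree.of_tmul fun i j t ht p hp => by
    -- With `p` fixed, the condition on `t` defines a subspace, so it may be checked on pure tensors
    -- `m ⊗ n`.
    refine deg_tensor_le (S := ((M ⊗ᵍ (N ⊗ᵍ P)).deg (i + j + 0)).comap
      ((assocHom M N P).toLin ∘ₗ tmulRight (M ⊗ᵍ N) p)) (fun k l hkl m hm n hn => ?_) ht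
    exact tmul_mem hm (tmul_mem hn hp rfl) (by rw [← hkl]; ring)
  refine h.isIsomorphic_of_inverse (assocInv M N P) (fun t => ?_) (fun t => ?_)
  · refine DFunLike.congr_fun (addHom_ext
      (φ := (assocInv M N P).comp (assocHom M N P).toLin.toAddMonoidHom)
      (ψ := AddMonoidHom.id _) fun t p => ?_) t
    -- The two nested uses of `addHom_ext` reduce the claim to triple tensors, where both sides
    -- agree by definition.
    refine DFunLike.congr_fun (addHom_ext
      (φ := AddMonoidHom.comp ((assocInv M N P).comp (assocHom M N P).toLin.toAddMonoidHom)
        ((tmulHom (M ⊗ᵍ N) P).flip p))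
      (ψ := (tmulHom (M ⊗ᵍ N) P).flip p) fun m n => rfl) t
  · refine DFunLike.congr_fun (addHom_ext
      (φ := AddMonoidHom.comp (assocHom M N P).toLin.toAddMonoidHom (assocInv M N P))
      (ψ := AddMonoidHom.id _) fun m t => ?_) t
    refine DFunLike.congr_fun (addHom_ext
      (φ := AddMonoidHom.comp (AddMonoidHom.comp (assocHom M N P).toLin.toAddMonoidHom
        (assocInv M N P)) (tmulHom M (N ⊗ᵍ P) m))
      (ψ := tmulHom M (N ⊗ᵍ P) m) fun n p => rfl) t

variable {ι : Type} [Fintype ι]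

theorem directSum_tensor (M : ι → GradedBimodule) (N : GradedBimodule) :
    directSum M ⊗ᵍ N ≅ᵍ directSum fun i => M i ⊗ᵍ N := by
  have h : (Hom.pi fun i => (Hom.proj M i).whiskerRight N).HasDegree 0 :=
    Hom.HasDegree.pi fun i => (Hom.proj_hasDegree M i).whiskerRight N
  refine h.isIsomorphic_of_inverse
    (fun x => ∑ i, ((Hom.single M i).whiskerRight N).toLin (x i)) (fun t => ?_) (fun x => ?_)
  · change ∑ i, ((Hom.single M i).whiskerRight N).toLin (((Hom.proj M i).whiskerRight N).toLin t) = t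
    induction t using tensor_induction with
    | zero => simp only [map_zero, Finset.sum_const_zero]
    | add a b h1 h2 => simp only [map_add, Finset.sum_add_distrib, h1, h2]
    | tmul m n =>
      refine (map_sum ((tmulHom _ N).flip n) _ _).symm.trans ?_
      exact congrArg (tmul · n) (sum_single_proj m)
  · funext j
    refine (map_sum ((Hom.proj M j).whiskerRight N).toLin _ _).trans ?_
    rw [Finset.sum_eq_single j]
    · refine Hom.congr_apply (φ := ((Hom.proj M j).whiskerRight N).comp
        ((Hom.single M j).whiskerRight N)) (ψ := Hom.id _) (Hom.ext_tmul fun m n => ?_) (x j)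
      exact congrArg (tmul · n) (proj_single_same j m)
    · intro i _ hij
      refine DFunLike.congr_fun (addHom_ext (φ := (((Hom.proj M j).whiskerRight N).comp
        ((Hom.single M i).whiskerRight N)).toLin.toAddMonoidHom) (ψ := 0) fun m n => ?_) (x i)
      refine (congrArg ((tmulHom _ N).flip n) (proj_single_ne hij.symm m)).trans ?_
      exact map_zero _
    · exact fun h => absurd (Finset.mem_univ j) h

theorem tensor_directSum (M : GradedBimodule) (N : ι → GradedBimodule) :
    M ⊗ᵍ directSum N ≅ᵍ directSum fun i => M ⊗ᵍ N i := by
  have h : (Hom.pi fun i => Hom.whiskerLeft M (Hom.proj N i)).HasDegree 0 :=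
    Hom.HasDegree.pi fun i => (Hom.proj_hasDegree N i).whiskerLeft M
  refine h.isIsomorphic_of_inverse
    (fun x => ∑ i, (Hom.whiskerLeft M (Hom.single N i)).toLin (x i)) (fun t => ?_) (fun x => ?_)
  · change ∑ i, (Hom.whiskerLeft M (Hom.single N i)).toLin ((Hom.whiskerLeft M (Hom.proj N i)).toLin t) = t
    induction t using tensor_induction with
    | zero => simp only [map_zero, Finset.sum_const_zero]
    | add a b h1 h2 => simp only [map_add, Finset.sum_add_distrib, h1, h2]
    | tmul m n =>
      refine (map_sum (tmulHom M _ m) _ _).symm.trans ?_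
      exact congrArg (tmul m ·) (sum_single_proj n)
  · funext j
    refine (map_sum (Hom.whiskerLeft M (Hom.proj N j)).toLin _ _).trans ?_
    rw [Finset.sum_eq_single j]
    · refine Hom.congr_apply (φ := (Hom.whiskerLeft M (Hom.proj N j)).comp
        (Hom.whiskerLeft M (Hom.single N j))) (ψ := Hom.id _) (Hom.ext_tmul fun m n => ?_) (x j)
      exact congrArg (tmul m ·) (proj_single_same j n)
    · intro i _ hij
      refine DFunLike.congr_fun (addHom_ext (φ := ((Hom.whiskerLeft M (Hom.proj N j)).comp
        (Hom.whiskerLeft M (Hom.single N i))).toLin.toAddMonoidHom) (ψ := 0) fun m n => ?_) (x i)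
      refine (congrArg (tmulHom M _ m) (proj_single_ne hij.symm n)).trans ?_
      exact map_zero _
    · exact fun h => absurd (Finset.mem_univ j) h

end Tensor

/-! ### The category `𝓑(S₃)` -/

section Category

theorem IsSoergel.of_iso {M : GradedBimodule} {N : GradedBimodule} (h : M ≅ᵍ N)
    (hN : IsSoergel N) : IsSoergel M := by
  obtain ⟨n, w, d, hd⟩ := hN
  exact ⟨n, w, d, h.trans hd⟩

theorem IsSoergel.of_fintype {M : GradedBimodule} {ι : Type} [Fintype ι] (w : ι → Label)
    (d : ι → ℤ) (h : M ≅ᵍ directSum fun i => (w i).bimodule.shift (d i)) : IsSoergel M :=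
  ⟨Fintype.card ι, fun k => w ((Fintype.equivFin ι).symm k),
    fun k => d ((Fintype.equivFin ι).symm k),
    h.trans (directSum_reindex _ (Fintype.equivFin ι).symm)⟩

theorem IsSoergel.shift {M : GradedBimodule} (h : IsSoergel M) (n : ℤ) :
    IsSoergel (M.shift n) := by
  obtain ⟨k, w, d, hd⟩ := h
  exact ⟨k, w, fun i => d i + n, (hd.shift n).trans ((directSum_shift _ n).trans
    (IsIsomorphic.directSum fun i => shift_shift _ rfl))⟩

theorem IsSoergel.directSum {ι : Type} [Fintype ι] {M : ι → GradedBimodule}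
    (h : ∀ i, IsSoergel (M i)) : IsSoergel (Soergel.directSum M) := by
  choose n w d hd using h
  exact IsSoergel.of_fintype (ι := Σ i, Fin (n i)) (fun p => w p.1 p.2) (fun p => d p.1 p.2)
    ((IsIsomorphic.directSum hd).trans
      (directSum_sigma fun i k => (w i k).bimodule.shift (d i k)))

theorem directSum_unique {ι : Type} [Fintype ι] [Unique ι] (M : ι → GradedBimodule) :
    directSum M ≅ᵍ M default := by
  refine (Hom.proj_hasDegree M default).isIsomorphic ⟨fun m m' h => ?_, fun n => ?_⟩
  · funext i
    obtain rfl := Unique.eq_default i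
    exact h
  · exact ⟨(Hom.single M default).toLin n, proj_single_same default n⟩

theorem IsSoergel.of_label (w : Label) : IsSoergel w.bimodule :=
  ⟨1, fun _ => w, fun _ => 0, ((directSum_unique _).trans (shift_zero _)).symm⟩

theorem tensor_shift (M : GradedBimodule) (N : GradedBimodule) (n : ℤ) :
    M ⊗ᵍ N.shift n ≅ᵍ (M ⊗ᵍ N).shift n :=
  ((shift_zero M).symm.tensor_right _).trans (tensor_shift_shift M N (zero_add n))

theorem shift_tensor (M : GradedBimodule) (N : GradedBimodule) (n : ℤ) :
    M.shift n ⊗ᵍ N ≅ᵍ (M ⊗ᵍ N).shift n :=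
  (IsIsomorphic.tensor_left _ (shift_zero N).symm).trans (tensor_shift_shift M N (add_zero n))

theorem IsSoergel.tensor_left {M : GradedBimodule} (h : ∀ w : Label, IsSoergel (M ⊗ᵍ w.bimodule))
    {N : GradedBimodule} (hN : IsSoergel N) : IsSoergel (M ⊗ᵍ N) := by
  obtain ⟨n, w, d, hd⟩ := hN
  exact IsSoergel.of_iso ((IsIsomorphic.tensor_left M hd).trans (tensor_directSum M _))
    (IsSoergel.directSum fun i => IsSoergel.of_iso (tensor_shift _ _ _) ((h (w i)).shift (d i)))

theorem IsSoergel.tensor_right {N : GradedBimodule} (h : ∀ w : Label, IsSoergel (w.bimodule ⊗ᵍ N))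
    {M : GradedBimodule} (hM : IsSoergel M) : IsSoergel (M ⊗ᵍ N) := by
  obtain ⟨n, w, d, hd⟩ := hM
  exact IsSoergel.of_iso ((hd.tensor_right N).trans (directSum_tensor _ N))
    (IsSoergel.directSum fun i => IsSoergel.of_iso (shift_tensor _ _ _) ((h (w i)).shift (d i)))

theorem isSoergel_B (t : Simple) : IsSoergel (B t) := by
  cases t
  · exact IsSoergel.of_label .s
  · exact IsSoergel.of_label .r

theorem isSoergel_B_tensor_B {t u : Simple} (h : t ≠ u) : IsSoergel (B t ⊗ᵍ B u) := by
  cases t <;> cases u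
  · exact absurd rfl h
  · exact IsSoergel.of_label .sr
  · exact IsSoergel.of_label .rs
  · exact absurd rfl h

theorem Label.cases_simple {p : GradedBimodule → Prop} (h1 : p unit) (h2 : ∀ t, p (B t))
    (h3 : ∀ t u, t ≠ u → p (B t ⊗ᵍ B u)) (h4 : p Bsrs) (w : Label) : p w.bimodule := by
  cases w
  · exact h1
  · exact h2 .s
  · exact h2 .r
  · exact h3 .s .r (by simp)
  · exact h3 .r .s (by simp)
  · exact h4

/-- `𝓑(S₃)` is closed under tensor products as soon as it contains the products of two of the
indecomposables `B_s`, `B_r`, `B_{srs}`, and `B_t B_u B_t` for `t ≠ u`, and the square of `B_t` is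
a sum of shifts of `B_t`. -/
theorem IsSoergel.tensor_of_generators
    (hBB : ∀ t, B t ⊗ᵍ B t ≅ᵍ Soergel.directSum ![(B t).shift 1, (B t).shift (-1)])
    (hBS : ∀ t, IsSoergel (B t ⊗ᵍ Bsrs))
    (hSB : ∀ t, ∃ (n : ℕ) (d : Fin n → ℤ), Bsrs ⊗ᵍ B t ≅ᵍ Soergel.directSum fun i => Bsrs.shift (d i))
    (hSS : IsSoergel (Bsrs ⊗ᵍ Bsrs))
    (hBBB : ∀ t u, t ≠ u → IsSoergel (B t ⊗ᵍ B u ⊗ᵍ B t))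
    {M : GradedBimodule} {N : GradedBimodule} (hM : IsSoergel M) (hN : IsSoergel N) :
    IsSoergel (M ⊗ᵍ N) := by
  -- Left multiplication by `B_t` preserves the category; by additivity this is checked on the six
  -- labels.
  have hB : ∀ t {N : GradedBimodule.{0}}, IsSoergel N → IsSoergel (B t ⊗ᵍ N) := by
    have hne : ∀ t u, t ≠ u → IsSoergel (B t ⊗ᵍ B t ⊗ᵍ B u) := fun t u h => by
      refine IsSoergel.of_iso (((hBB t).tensor_right _).trans (directSum_tensor _ _)) ?_
      refine IsSoergel.directSum (Fin.forall_fin_two.2 ⟨?_, ?_⟩) <;>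
      exact IsSoergel.of_iso (shift_tensor _ _ _) ((isSoergel_B_tensor_B h).shift _)
    intro t N hN
    refine IsSoergel.tensor_left (Label.cases_simple (p := fun X => IsSoergel (B t ⊗ᵍ X)) ?_ ?_ ?_ ?_) hN
    · exact IsSoergel.of_iso (tensor_unit _) (isSoergel_B t)
    · intro u
      by_cases h : t = u
      · subst h
        exact IsSoergel.of_iso (hBB t) (IsSoergel.directSum (Fin.forall_fin_two.2
          ⟨(isSoergel_B t).shift _, (isSoergel_B t).shift _⟩))
      · exact isSoergel_B_tensor_B h
    · intro u v huv
      refine IsSoergel.of_iso (tensor_assoc _ _ _).symm ?_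
      by_cases h : t = u
      · subst h
        exact hne t v huv
      -- There are only two simple reflections, so `t ≠ u` and `u ≠ v` force `v = t`.
      · obtain rfl : t = v := by cases t <;> cases u <;> cases v <;> simp_all
        exact hBBB t u h
    · exact hBS t
  have hS' : ∀ t, IsSoergel (Bsrs ⊗ᵍ B t) := fun t => by
    obtain ⟨n, d, h⟩ := hSB t
    exact ⟨n, fun _ => .srs, d, h⟩
  have hS : ∀ {N : GradedBimodule.{0}}, IsSoergel N → IsSoergel (Bsrs ⊗ᵍ N) := by
    intro N hN
    refine IsSoergel.tensor_left (Label.cases_simple (p := fun X => IsSoergel (Bsrs ⊗ᵍ X)) ?_ hS' ?_ hSS) hN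
    · exact IsSoergel.of_iso (tensor_unit _) (IsSoergel.of_label .srs)
    · intro t u _
      -- Here it matters that `B_{srs} B_t` is a sum of shifts of `B_{srs}` itself and not merely an
      -- object of the category: multiplying by `B_u` then gives shifts of `B_{srs} B_u`.
      obtain ⟨n, d, h⟩ := hSB t
      refine IsSoergel.of_iso ((tensor_assoc _ _ _).symm.trans
        ((h.tensor_right _).trans (directSum_tensor _ _))) (IsSoergel.directSum fun i => ?_)
      exact IsSoergel.of_iso (shift_tensor _ _ _) ((hS' u).shift _)
  refine IsSoergel.tensor_left (fun w => ?_) hN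
  have hw := IsSoergel.of_label w
  refine IsSoergel.tensor_right (Label.cases_simple (p := fun M => IsSoergel (M ⊗ᵍ w.bimodule))
    ?_ (fun t => hB t hw) ?_ (hS hw)) hM
  · exact IsSoergel.of_iso (unit_tensor _) hw
  · exact fun t u _ => IsSoergel.of_iso (tensor_assoc _ _ _) (hB t (hB u hw))

end Category

/-! ### Divided differences -/

section Divided

theorem R.C_mem_deg (c : ℝ) : (MvPolynomial.C c : R) ∈ R.deg 0 :=
  MvPolynomial.isWeightedHomogeneous_C _ c

theorem R.X_mem_deg (i : Fin 3) : (MvPolynomial.X i : R) ∈ R.deg 2 :=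
  MvPolynomial.isWeightedHomogeneous_X ℝ _ i

theorem root_mem_deg (t : Simple) : t.root ∈ R.deg 2 := by
  cases t <;> exact Submodule.sub_mem _ (R.X_mem_deg _) (R.X_mem_deg _)

theorem rename_mem_deg (σ : Equiv.Perm (Fin 3)) {k : ℤ} {p : R} (hp : p ∈ R.deg k) :
    MvPolynomial.rename σ p ∈ R.deg k := by
  intro d hd
  obtain ⟨e, rfl, he⟩ := MvPolynomial.coeff_rename_ne_zero σ p d hd
  rw [← hp he, Finsupp.weight_apply, Finsupp.weight_apply,
    Finsupp.sum_mapDomain_index (by simp) (by intros; rw [add_smul])]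

/-- For `f` homogeneous of degree `i`, the component of `f g` in degree `i + k` is `f` times the
component of `g` in degree `k`. Since `R` is a domain, `f` can be cancelled. This gives the degree
of `∂_t p`, which is defined as a quotient. -/
theorem R.mem_deg_of_mul_mem {i k : ℤ} {f g : R} (hf : f ∈ R.deg i) (hf0 : f ≠ 0)
    (h : f * g ∈ R.deg (i + k)) : g ∈ R.deg k := by
  classical
  let _ := MvPolynomial.weightedGradedAlgebra ℝ (fun _ : Fin 3 => (2 : ℤ))
  have h1 := DirectSum.coe_decompose_mul_add_of_left_mem
    (MvPolynomial.weightedHomogeneousSubmodule ℝ (fun _ : Fin 3 => (2 : ℤ))) (j := k) (b := g) hf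
  rw [DirectSum.decompose_of_mem_same (MvPolynomial.weightedHomogeneousSubmodule ℝ
    (fun _ : Fin 3 => (2 : ℤ))) h] at h1
  rw [mul_left_cancel₀ hf0 h1]
  exact SetLike.coe_mem _

theorem R.C_two : (MvPolynomial.C 2 : R) = 2 := map_ofNat _ 2

theorem partialFun_spec' (t : Simple) (p : R) :
    p - MvPolynomial.rename t.perm p = 2 * t.root * partialFun t p := by
  rw [partialFun_spec, R.C_two]

theorem partialFun_eq {t : Simple} {p q : R}
    (h : p - MvPolynomial.rename t.perm p = 2 * t.root * q) : partialFun t p = q :=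
  partialFun_unique (by rw [h, R.C_two])

theorem partialFun_mem_deg (t : Simple) {k : ℤ} {p : R} (hp : p ∈ R.deg k) :
    partialFun t p ∈ R.deg (k - 2) := by
  refine R.mem_deg_of_mul_mem (i := 2) (f := MvPolynomial.C 2 * t.root) ?_ ?_ ?_
  · exact R.mul_mem_deg (R.C_mem_deg 2) (root_mem_deg t)
  · exact mul_ne_zero (by rw [R.C_two]; exact two_ne_zero) (root_ne_zero t)
  · rw [← partialFun_spec, add_sub_cancel]
    exact Submodule.sub_mem _ hp (rename_mem_deg _ hp)

/-- `∂_t` as an additive map. -/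
def partialAdd (t : Simple) : R →+ R := (partialLin t).toAddMonoidHom

theorem partialAdd_apply (t : Simple) (p : R) : partialAdd t p = partialFun t p := rfl

theorem partialAdd_mul (t : Simple) {a : R} (ha : a ∈ invariants {t.perm}) (p : R) :
    partialAdd t (a * p) = a * partialAdd t p :=
  (partialLin t).map_smul ⟨a, ha⟩ p

theorem partialAdd_mem (t : Simple) (p : R) : partialAdd t p ∈ invariants {t.perm} :=
  partialFun_mem t p

theorem partialAdd_eq_zero {t : Simple} {p : R} : partialAdd t p = 0 ↔ p ∈ invariants {t.perm} := by
  rw [mem_invariants]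
  refine ⟨fun h => ?_, fun h => partialFun_eq (by rw [h]; ring)⟩
  have := partialFun_spec' t p
  rw [← partialAdd_apply, h] at this
  linear_combination -this

theorem partialAdd_root (t : Simple) : partialAdd t t.root = 1 :=
  partialFun_eq (by rw [rename_root]; ring)

theorem rename_root_of_ne {t u : Simple} (h : t ≠ u) :
    MvPolynomial.rename t.perm u.root = u.root + t.root := by
  cases t <;> cases u <;> first | exact absurd rfl h | skip
  all_goals
    simp [Simple.root, Simple.perm, Equiv.swap_apply_of_ne_of_ne]

theorem rename_braid {t u : Simple} (h : t ≠ u) (p : R) :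
    MvPolynomial.rename u.perm (MvPolynomial.rename t.perm (MvPolynomial.rename u.perm p)) =
      MvPolynomial.rename t.perm (MvPolynomial.rename u.perm (MvPolynomial.rename t.perm p)) := by
  have : u.perm * (t.perm * u.perm) = t.perm * (u.perm * t.perm) := by
    cases t <;> cases u <;> first | exact absurd rfl h | decide
  simp only [MvPolynomial.rename_rename, ← Equiv.Perm.coe_mul, this]

/-- `∂_t ∂_u` maps `R^t` to `R^u`, for `t ≠ u`. -/
theorem partial_partial_mem {t u : Simple} (h : t ≠ u) {p : R} (hp : p ∈ invariants {t.perm}) :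
    partialAdd t (partialAdd u p) ∈ invariants {u.perm} := by
  have hp' := mem_invariants.1 hp
  set g := partialAdd u p with hg
  set q := partialAdd t g with hq
  have e1 : p - MvPolynomial.rename u.perm p = 2 * u.root * g := partialFun_spec' u p
  have e2 : g - MvPolynomial.rename t.perm g = 2 * t.root * q := partialFun_spec' t g
  have e3 := congrArg (MvPolynomial.rename t.perm) e1
  simp only [map_sub, map_mul, map_ofNat, hp', rename_root_of_ne h] at e3
  -- The denominators of `∂_t ∂_u p` are cleared, using `t p = p`. The factor `α_t α_u (α_u + α_t)`
  -- is the product of the positive roots, so `u` changes its sign; by the braid relation and `t p =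
  -- p`, `u` also changes the sign of the right-hand side. Hence `q` is fixed by `u`. Conceptually,
  -- `∂_u ∂_t ∂_u = ∂_t ∂_u ∂_t` vanishes on `R^t`.
  have e4 : 4 * t.root * u.root * (u.root + t.root) * q = t.root * p -
      (u.root + t.root) * MvPolynomial.rename u.perm p +
      u.root * MvPolynomial.rename t.perm (MvPolynomial.rename u.perm p) := by
    linear_combination (-2 * u.root * (u.root + t.root)) * e2 - (u.root + t.root) * e1
      + u.root * e3
  have e5 := congrArg (MvPolynomial.rename u.perm) e4
  simp only [map_add, map_sub, map_mul, map_ofNat, rename_root_of_ne h.symm, rename_root,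
    rename_rename, rename_braid h, hp'] at e5
  have h0 : 4 * t.root * u.root * (u.root + t.root) ≠ 0 := by
    refine mul_ne_zero (mul_ne_zero (mul_ne_zero (OfNat.ofNat_ne_zero 4)
      (root_ne_zero t)) (root_ne_zero u)) ?_
    rw [← rename_root_of_ne h]
    intro h0
    exact root_ne_zero u (by rw [← rename_rename t u.root, h0, map_zero])
  rw [mem_invariants]
  refine mul_left_cancel₀ h0 ?_
  linear_combination -e4 - e5

end Divided

/-! ### Bases of invariant rings -/

section GradedBasis

/-- A homogeneous basis of `A` as a module over `S`, with coordinates that extend to `R`. -/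
structure GradedBasis (S A : Subalgebra ℝ R) (ι : Type) [Fintype ι] [DecidableEq ι] where
  elt : ι → R
  degree : ι → ℤ
  coord : ι → R →+ R
  elt_mem : ∀ i, elt i ∈ A
  elt_mem_deg : ∀ i, elt i ∈ R.deg (degree i)
  coord_mul : ∀ i, ∀ a ∈ S, ∀ p, coord i (a * p) = a * coord i p
  coord_mem : ∀ i, ∀ p ∈ A, coord i p ∈ S
  coord_elt : ∀ i j, coord i (elt j) = if i = j then 1 else 0
  sum_coord : ∀ p ∈ A, ∑ i, coord i p * elt i = p

/-- The basis obtained from bases of `A` over `S` and of `R` over `A`. -/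
def GradedBasis.trans {S A : Subalgebra ℝ R} {κ ι : Type} [Fintype κ] [DecidableEq κ] [Fintype ι]
    [DecidableEq ι] (b : GradedBasis S A κ) (c : GradedBasis A ⊤ ι) (hSA : S ≤ A) :
    GradedBasis S ⊤ (κ × ι) where
  elt k := b.elt k.1 * c.elt k.2
  degree k := b.degree k.1 + c.degree k.2
  coord k := (b.coord k.1).comp (c.coord k.2)
  elt_mem _ := trivial
  elt_mem_deg k := R.mul_mem_deg (b.elt_mem_deg _) (c.elt_mem_deg _)
  coord_mul k a ha p := by
    rw [AddMonoidHom.comp_apply, c.coord_mul _ a (hSA ha), b.coord_mul _ a ha,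
      AddMonoidHom.comp_apply]
  coord_mem k p hp := b.coord_mem _ _ (c.coord_mem _ p hp)
  -- `b.elt` lies in `A`, over which the coordinates of `c` are linear, so `c.coord` extracts
  -- `b.elt` times a Kronecker delta.
  coord_elt k l := by
    rw [AddMonoidHom.comp_apply, c.coord_mul _ _ (b.elt_mem _), c.coord_elt]
    by_cases h : k.2 = l.2
    · simp [h, b.coord_elt, Prod.ext_iff]
    · simp [h, Prod.ext_iff]
  sum_coord p _ := by
    rw [Fintype.sum_prod_type_right]
    conv_rhs => rw [← c.sum_coord p trivial]
    refine Finset.sum_congr rfl fun i _ => ?_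
    conv_rhs => rw [← b.sum_coord _ (c.coord_mem i p trivial), Finset.sum_mul]
    exact Finset.sum_congr rfl fun k _ => (mul_assoc _ _ _).symm

/-- The basis `1, α_t` of `R` over `R^t`. -/
def simpleBasis (t : Simple) : GradedBasis (invariants {t.perm}) ⊤ (Fin 2) where
  elt := ![1, t.root]
  degree := ![0, 2]
  coord := ![AddMonoidHom.id R - (AddMonoidHom.mulLeft t.root).comp (partialAdd t), partialAdd t]
  elt_mem _ := trivial
  elt_mem_deg := Fin.forall_fin_two.2 ⟨R.one_mem, root_mem_deg t⟩
  coord_mul := Fin.forall_fin_two.2 ⟨fun a ha p => by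
      change a * p - t.root * partialAdd t (a * p) = a * (p - t.root * partialAdd t p)
      rw [partialAdd_mul t ha]; ring,
    fun a ha p => partialAdd_mul t ha p⟩
  coord_mem := Fin.forall_fin_two.2 ⟨fun p _ => symmPart_mem t p, fun p _ => partialAdd_mem t p⟩
  coord_elt := by
    have h1 : partialAdd t 1 = 0 := partialAdd_eq_zero.2 (one_mem _)
    refine Fin.forall_fin_two.2 ⟨Fin.forall_fin_two.2 ⟨?_, ?_⟩, Fin.forall_fin_two.2 ⟨?_, ?_⟩⟩ <;>
    simp [h1, partialAdd_root]
  sum_coord p _ := by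
    rw [Fin.sum_univ_two]
    change (p - t.root * partialAdd t p) * 1 + partialAdd t p * t.root = p
    ring

/-- A `t`-invariant linear form `w` such that `∂_u w = 1` for `u ≠ t`. -/
def Simple.weight : Simple → R
  | .s => 2 * MvPolynomial.X 2
  | .r => -2 * MvPolynomial.X 0

theorem weight_mem (t : Simple) : t.weight ∈ invariants {t.perm} := by
  rw [mem_invariants]
  cases t <;> simp [map_ofNat, Simple.weight, Simple.perm, Equiv.swap_apply_of_ne_of_ne]

theorem weight_mem_deg (t : Simple) : t.weight ∈ R.deg 2 := by
  cases t
  · exact R.mul_mem_deg (R.C_two ▸ R.C_mem_deg 2) (R.X_mem_deg 2)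
  · exact R.mul_mem_deg (Submodule.neg_mem _ (R.C_two ▸ R.C_mem_deg 2)) (R.X_mem_deg 0)

theorem weight_sub_rename {t u : Simple} (h : t ≠ u) :
    t.weight - MvPolynomial.rename u.perm t.weight = 2 * u.root := by
  cases t <;> cases u <;> first | exact absurd rfl h | skip
  all_goals
    simp [map_ofNat, Simple.weight, Simple.root, Simple.perm]
    ring

theorem partialAdd_weight {t u : Simple} (h : t ≠ u) : partialAdd u t.weight = 1 :=
  partialFun_eq (by rw [weight_sub_rename h, mul_one])

/-- From `w² - (u w)² = (w - u w)(w + u w)` and `w - u w = 2 α_u`, the quotient is `w + u w = 2 (w -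
α_u)`. -/
theorem partialAdd_weight_sq {t u : Simple} (h : t ≠ u) :
    partialAdd u (t.weight ^ 2) = 2 * (t.weight - u.root) :=
  partialFun_eq (by
    rw [map_pow]
    linear_combination (t.weight + MvPolynomial.rename u.perm t.weight - 2 * u.root) *
      weight_sub_rename h)

theorem partialAdd_partialAdd_weight_sq {t u : Simple} (h : t ≠ u) :
    partialAdd t (2 * (t.weight - u.root)) = 1 :=
  partialFun_eq (by
    simp only [map_mul, map_sub, map_ofNat, mem_invariants.1 (weight_mem t), rename_root_of_ne h]
    ring)

/-- The set `{s, r}` of simple reflections. -/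
abbrev simples : Set (Equiv.Perm (Fin 3)) := {Simple.s.perm, Simple.r.perm}

theorem mem_invariants_simples {t u : Simple} (h : t ≠ u) {p : R} :
    p ∈ invariants simples ↔ p ∈ invariants {t.perm} ∧ p ∈ invariants {u.perm} := by
  rw [mem_invariants, mem_invariants]
  change (∀ σ ∈ ({Simple.s.perm, Simple.r.perm} : Set _), _) ↔ _
  rw [Set.forall_mem_insert]
  simp only [Set.mem_singleton_iff, forall_eq]
  cases t <;> cases u <;> first | exact absurd rfl h | exact Iff.rfl | exact and_comm

theorem invariants_simples_le (t : Simple) : invariants simples ≤ invariants {t.perm} := by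
  intro p hp
  cases t
  · exact ((mem_invariants_simples (t := .s) (u := .r) (by simp)).1 hp).1
  · exact ((mem_invariants_simples (t := .s) (u := .r) (by simp)).1 hp).2

theorem invariants_mul_partial {t u : Simple} {a : R} (ha : a ∈ invariants simples)
    (p : R) : partialAdd t (partialAdd u (a * p)) = a * partialAdd t (partialAdd u p) := by
  rw [partialAdd_mul u (invariants_simples_le u ha), partialAdd_mul t (invariants_simples_le t ha)]

/-- The coordinates of a `t`-invariant polynomial in the basis `w², w, 1` of `R^t` over `R^{S₃}`. -/
def weightCoord (t u : Simple) : Fin 3 → R →+ R :=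
  let c₂ := (partialAdd t).comp (partialAdd u)
  let c₁ := partialAdd u - (AddMonoidHom.mulLeft (2 * (t.weight - u.root))).comp c₂
  ![c₂, c₁, AddMonoidHom.id R - (AddMonoidHom.mulRight t.weight).comp c₁ -
    (AddMonoidHom.mulRight (t.weight ^ 2)).comp c₂]

theorem weightCoord_zero (t u : Simple) (p : R) :
    weightCoord t u 0 p = partialAdd t (partialAdd u p) := rfl

theorem weightCoord_one (t u : Simple) (p : R) : weightCoord t u 1 p =
    partialAdd u p - 2 * (t.weight - u.root) * weightCoord t u 0 p := rfl

theorem weightCoord_two (t u : Simple) (p : R) : weightCoord t u 2 p =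
    p - weightCoord t u 1 p * t.weight - weightCoord t u 0 p * t.weight ^ 2 := rfl

theorem forall_fin_three {P : Fin 3 → Prop} : (∀ i, P i) ↔ P 0 ∧ P 1 ∧ P 2 := by
  simp [Fin.forall_fin_succ]

/-- A polynomial is `t`-invariant exactly if `∂_t` kills it. The leading coordinate `c₂` is handled
by `partial_partial_mem`. In `c₁ = ∂_u p - 2 (w - α_u) c₂` the factor `2 (w - α_u)` is `∂_u(w²)`,
hence `u`-invariant, and has `∂_t` equal to 1, so that `∂_t c₁ = c₂ - c₂ = 0`. The constant
coordinate is what remains of `p`, and `∂_u` kills it by the choice of `c₁`. -/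
theorem weightCoord_mem {t u : Simple} (h : t ≠ u) (i : Fin 3) {p : R}
    (hp : p ∈ invariants {t.perm}) : weightCoord t u i p ∈ invariants simples := by
  have h0 : weightCoord t u 0 p ∈ invariants simples :=
    (mem_invariants_simples h).2 ⟨partialAdd_mem _ _, partial_partial_mem h hp⟩
  have h1 : weightCoord t u 1 p ∈ invariants simples := by
    refine (mem_invariants_simples h).2 ⟨?_, ?_⟩ <;> rw [weightCoord_one]
    · rw [← partialAdd_eq_zero, map_sub, mul_comm, partialAdd_mul t (invariants_simples_le t h0),
        partialAdd_partialAdd_weight_sq h, weightCoord_zero]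
      ring
    · refine sub_mem (partialAdd_mem _ _) (mul_mem ?_ (invariants_simples_le u h0))
      rw [← partialAdd_weight_sq h]
      exact partialAdd_mem _ _
  revert i
  refine forall_fin_three.2 ⟨h0, h1, (mem_invariants_simples h).2 ⟨?_, ?_⟩⟩ <;>
  rw [weightCoord_two]
  · exact sub_mem (sub_mem hp (mul_mem (invariants_simples_le t h1) (weight_mem t)))
      (mul_mem (invariants_simples_le t h0) (pow_mem (weight_mem t) 2))
  · rw [← partialAdd_eq_zero, map_sub, map_sub, partialAdd_mul u (invariants_simples_le u h1),
      partialAdd_mul u (invariants_simples_le u h0), partialAdd_weight h, partialAdd_weight_sq h,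
      weightCoord_one]
    ring

/-- The basis `w², w, 1` of `R^t` over `R^{S₃}`. -/
def weightBasis {t u : Simple} (h : t ≠ u) :
    GradedBasis (invariants simples) (invariants {t.perm}) (Fin 3) where
  elt := ![t.weight ^ 2, t.weight, 1]
  degree := ![4, 2, 0]
  coord := weightCoord t u
  elt_mem := forall_fin_three.2 ⟨pow_mem (weight_mem t) 2, weight_mem t, one_mem _⟩
  elt_mem_deg := forall_fin_three.2 ⟨by
      change t.weight ^ 2 ∈ R.deg (2 + 2)
      rw [pow_two]
      exact R.mul_mem_deg (weight_mem_deg t) (weight_mem_deg t), weight_mem_deg t, R.one_mem⟩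
  coord_mul i a ha p := by
    have h0 := invariants_mul_partial (t := t) (u := u) ha p
    have h1 := partialAdd_mul u (invariants_simples_le u ha) p
    revert i
    refine forall_fin_three.2 ⟨h0, ?_, ?_⟩ <;>
    simp only [weightCoord_two, weightCoord_one, weightCoord_zero, h0] <;> rw [h1] <;> ring
  coord_mem i p hp := weightCoord_mem h i hp
  coord_elt := by
    have h1 : ∀ t, partialAdd t 1 = 0 := fun t => partialAdd_eq_zero.2 (one_mem _)
    refine forall_fin_three.2 ⟨?_, ?_, ?_⟩ <;>
    refine forall_fin_three.2 ⟨?_, ?_, ?_⟩ <;>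
    -- The system is triangular: `∂_t ∂_u` maps `w², w, 1` to `1, 0, 0`, and `∂_u` maps `w, 1` to
    -- `1, 0`.
    simp [weightCoord_two, weightCoord_one, weightCoord_zero, h1, partialAdd_weight h,
      partialAdd_weight_sq h, partialAdd_partialAdd_weight_sq h]
  sum_coord p _ := by
    rw [Fin.sum_univ_three]
    simp only [Matrix.cons_val, weightCoord_two]
    ring

/-- The basis of `R` over `R^{S₃}` that consists of the products of `w², w, 1` and `1, α_t`. -/
def fullBasis {t u : Simple} (h : t ≠ u) : GradedBasis (invariants simples) ⊤ (Fin 3 × Fin 2) :=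
  (weightBasis h).trans (simpleBasis t) (invariants_simples_le t)

end GradedBasis

/-! ### Induced bimodules -/

section Induced

variable {T : Set (Equiv.Perm (Fin 3))}

/-- The element `p ⊗ q` of `R ⊗_{R^T} R`. -/
def induced.tmul (T : Set (Equiv.Perm (Fin 3))) (p q : R) : (induced T).carrier :=
  p ⊗ₜ[invariants T] q

theorem induced.tmul_add (p q q' : R) :
    induced.tmul T p (q + q') = induced.tmul T p q + induced.tmul T p q' :=
  TensorProduct.tmul_add ..

theorem induced.add_tmul (p p' q : R) :
    induced.tmul T (p + p') q = induced.tmul T p q + induced.tmul T p' q :=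
  TensorProduct.add_tmul ..

theorem induced.left_tmul (f p q : R) :
    (induced T).left f (induced.tmul T p q) = induced.tmul T (f * p) q := by
  refine (Algebra.TensorProduct.tmul_mul_tmul (R := invariants T) f p (1 : R) q).trans ?_
  rw [one_mul]; rfl

theorem induced.right_tmul (f p q : R) :
    (induced T).right f (induced.tmul T p q) = induced.tmul T p (f * q) := by
  refine (Algebra.TensorProduct.tmul_mul_tmul (R := invariants T) (1 : R) p f q).trans ?_
  rw [one_mul]; rfl

theorem induced.tmul_comm {a : R} (ha : a ∈ invariants T) (p q : R) :
    induced.tmul T (a * p) q = induced.tmul T p (a * q) := tmul_comm_of_mem ha p q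

theorem induced.tmul_mem {i j k : ℤ} {p q : R} (hp : p ∈ R.deg i) (hq : q ∈ R.deg j)
    (h : i + j = k) : induced.tmul T p q ∈ (induced T).deg k :=
  tmul_mem_tensorDeg (invariants T) hp hq h

theorem induced.induction {motive : (induced T).carrier → Prop} (zero : motive 0)
    (tmul : ∀ p q, motive (induced.tmul T p q))
    (add : ∀ a b, motive a → motive b → motive (a + b)) (x : (induced T).carrier) : motive x :=
  TensorProduct.induction_on x zero tmul add

/-- The additive map `p ⊗ q ↦ φ p q` given by an `R^T`-balanced biadditive map `φ`. -/
def induced.liftAdd (T : Set (Equiv.Perm (Fin 3))) {P : Type*} [AddCommGroup P] (φ : R →+ R →+ P)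
    (hb : ∀ a ∈ invariants T, ∀ p q, φ (a * p) q = φ p (a * q)) : (induced T).carrier →+ P :=
  TensorProduct.liftAddHom (R := invariants T) (M := R) (N := R) φ (fun a p q => hb a.1 a.2 p q)

theorem induced.addHom_ext {P : Type*} [AddCommGroup P] {φ ψ : (induced T).carrier →+ P}
    (h : ∀ p q, φ (induced.tmul T p q) = ψ (induced.tmul T p q)) : φ = ψ := by
  ext x
  induction x using induced.induction with
  | zero => rw [map_zero, map_zero]
  | tmul p q => exact h p q
  | add a b h1 h2 => rw [map_add, map_add, h1, h2]

theorem GradedBimodule.left_mul (M : GradedBimodule) (f g : R) (m : M.carrier) :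
    M.left (f * g) m = M.left f (M.left g m) := by rw [map_mul]; rfl

theorem GradedBimodule.right_mul (M : GradedBimodule) (f g : R) (m : M.carrier) :
    M.right (f * g) m = M.right f (M.right g m) := by rw [map_mul]; rfl

theorem GradedBimodule.left_one (M : GradedBimodule) (m : M.carrier) : M.left 1 m = m := by
  rw [map_one]; rfl

theorem GradedBimodule.right_one (M : GradedBimodule) (m : M.carrier) : M.right 1 m = m := by
  rw [map_one]; rfl

/-- The left action as a biadditive map. -/
def GradedBimodule.leftAdd (M : GradedBimodule) : R →+ M.carrier →+ M.carrier :=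
  AddMonoidHom.mk' (fun f => (M.left f).toAddMonoidHom) (fun f g => by rw [map_add]; rfl)

/-- The right action as a biadditive map. -/
def GradedBimodule.rightAdd (M : GradedBimodule) : R →+ M.carrier →+ M.carrier :=
  AddMonoidHom.mk' (fun f => (M.right f).toAddMonoidHom) (fun f g => by rw [map_add]; rfl)

/-- The morphism `R ⊗_{R^T} R → N`, `p ⊗ q ↦ p u q`, for an element `u` that commutes with
`R^T`. -/
def Hom.ofCentral {N : GradedBimodule} (u : N.carrier)
    (hu : ∀ a ∈ invariants T, N.left a u = N.right a u) : Hom (induced T) N :=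
  Hom.ofAdd
    (induced.liftAdd T
      (AddMonoidHom.mk' (fun p => (N.leftAdd p).comp (N.rightAdd.flip u))
        (fun p p' => by rw [map_add, AddMonoidHom.add_comp]))
      (fun a ha p q => by
        change N.left (a * p) (N.right q u) = N.left p (N.right (a * q) u)
        rw [mul_comm a p, mul_comm a q, N.left_mul, N.right_mul, N.left_right a, hu a ha]))
    (fun f x => by
      induction x using induced.induction with
      | zero => simp only [map_zero]
      | add a b h1 h2 => simp only [map_add, h1, h2]
      | tmul p q =>
        rw [induced.left_tmul]
        exact N.left_mul f p (N.right q u))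
    (fun f x => by
      induction x using induced.induction with
      | zero => simp only [map_zero]
      | add a b h1 h2 => simp only [map_add, h1, h2]
      | tmul p q =>
        rw [induced.right_tmul]
        change N.left p (N.right (f * q) u) = N.right f (N.left p (N.right q u))
        rw [N.right_mul, N.left_right])

theorem Hom.ofCentral_tmul {N : GradedBimodule} (u : N.carrier)
    (hu : ∀ a ∈ invariants T, N.left a u = N.right a u) (p q : R) :
    (Hom.ofCentral u hu).toLin (induced.tmul T p q) = N.left p (N.right q u) := rfl

theorem induced.hasDegree_of_tmul {N : GradedBimodule} {φ : Hom (induced T) N} {d : ℤ}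
    (h : ∀ i j, ∀ p ∈ R.deg i, ∀ q ∈ R.deg j,
      φ.toLin (induced.tmul T p q) ∈ N.deg (i + j + d)) : φ.HasDegree d := fun k =>
  tensorDeg_le (invariants T) (V := (N.deg (k + d)).comap φ.toLin) fun i j hij p hp q hq =>
    N.deg_cast (h i j p hp q hq) (by rw [hij])

theorem Hom.ofCentral_hasDegree {N : GradedBimodule} (u : N.carrier)
    (hu : ∀ a ∈ invariants T, N.left a u = N.right a u) {d : ℤ} (hd : u ∈ N.deg d) :
    (Hom.ofCentral u hu).HasDegree d :=
  induced.hasDegree_of_tmul fun _ _ _ hp _ hq =>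
    N.deg_cast (N.left_mem hp (N.right_mem hq hd)) (add_assoc ..).symm

/-- The additive map `(R ⊗_{R^T} R) N → P`, `(p ⊗ f) ⊗ n ↦ p Λ(f n)`, for a left `R^T`-linear
map `Λ : N → P`. -/
def induced.liftLeft {N : GradedBimodule} {P : GradedBimodule} (Λ : N.carrier →+ P.carrier)
    (hΛ : ∀ a ∈ invariants T, ∀ n, Λ (N.left a n) = P.left a (Λ n)) :
    (induced T ⊗ᵍ N).carrier →+ P.carrier :=
  Soergel.liftAdd
    (induced.liftAdd T
      (AddMonoidHom.mk' (fun p => (AddMonoidHom.compHom ((P.leftAdd p).comp Λ)).comp N.leftAdd)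
        (fun p p' => by rw [map_add, AddMonoidHom.add_comp, map_add, AddMonoidHom.add_comp]))
      (fun a ha p q => AddMonoidHom.ext fun n => by
        change P.left (a * p) (Λ (N.left q n)) = P.left p (Λ (N.left (a * q) n))
        rw [N.left_mul, hΛ a ha, mul_comm, P.left_mul]))
    (fun f x n => by
      induction x using induced.induction with
      | zero => simp only [map_zero, AddMonoidHom.zero_apply]
      | add a b h1 h2 => simp only [map_add, AddMonoidHom.add_apply, h1, h2]
      | tmul p q =>
        rw [induced.right_tmul]
        change P.left p (Λ (N.left (f * q) n)) = P.left p (Λ (N.left q (N.left f n)))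
        rw [mul_comm, N.left_mul])

theorem induced.liftLeft_tmul {N : GradedBimodule} {P : GradedBimodule}
    (Λ : N.carrier →+ P.carrier)
    (hΛ : ∀ a ∈ invariants T, ∀ n, Λ (N.left a n) = P.left a (Λ n)) (p f : R) (n : N.carrier) :
    induced.liftLeft Λ hΛ (Soergel.tmul (induced.tmul T p f) n) = P.left p (Λ (N.left f n)) := rfl

/-- The additive map `N (R ⊗_{R^T} R) → P`, `n ⊗ (f ⊗ p) ↦ Λ(n f) p`, for a right `R^T`-linear
map `Λ : N → P`. -/
def induced.liftRight {N : GradedBimodule} {P : GradedBimodule} (Λ : N.carrier →+ P.carrier)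
    (hΛ : ∀ a ∈ invariants T, ∀ n, Λ (N.right a n) = P.right a (Λ n)) :
    (N ⊗ᵍ induced T).carrier →+ P.carrier :=
  Soergel.liftAdd
    (AddMonoidHom.flip (induced.liftAdd T
      (AddMonoidHom.flip (AddMonoidHom.mk'
        (fun p => (AddMonoidHom.compHom ((P.rightAdd p).comp Λ)).comp N.rightAdd)
        (fun p p' => by rw [map_add, AddMonoidHom.add_comp, map_add, AddMonoidHom.add_comp])))
      (fun a ha q p => AddMonoidHom.ext fun n => by
        change P.right p (Λ (N.right (a * q) n)) = P.right (a * p) (Λ (N.right q n))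
        rw [N.right_mul, hΛ a ha, mul_comm, P.right_mul])))
    (fun f n x => by
      simp only [AddMonoidHom.flip_apply]
      induction x using induced.induction with
      | zero => simp only [map_zero, AddMonoidHom.zero_apply]
      | add a b h1 h2 => simp only [map_add, AddMonoidHom.add_apply, h1, h2]
      | tmul q p =>
        rw [induced.left_tmul]
        change P.right p (Λ (N.right q (N.right f n))) = P.right p (Λ (N.right (f * q) n))
        rw [mul_comm, N.right_mul])

theorem induced.liftRight_tmul {N : GradedBimodule} {P : GradedBimodule}
    (Λ : N.carrier →+ P.carrier)
    (hΛ : ∀ a ∈ invariants T, ∀ n, Λ (N.right a n) = P.right a (Λ n)) (f p : R) (n : N.carrier) :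
    induced.liftRight Λ hΛ (Soergel.tmul n (induced.tmul T f p)) = P.right p (Λ (N.right f n)) := rfl

/-- The biadditive map `(p, q) ↦ p ⊗ q`. -/
def induced.tmulHom (T : Set (Equiv.Perm (Fin 3))) : R →+ R →+ (induced T).carrier :=
  AddMonoidHom.mk' (fun p => AddMonoidHom.mk' (fun q => induced.tmul T p q) (induced.tmul_add p))
    (fun p p' => AddMonoidHom.ext fun q => induced.add_tmul p p' q)

/-- The map `p ⊗ q ↦ c(p) ⊗ q`. -/
def induced.mapLeft (T : Set (Equiv.Perm (Fin 3))) (c : R →+ R)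
    (hc : ∀ a ∈ invariants T, ∀ p, c (a * p) = a * c p) :
    (induced T).carrier →+ (induced T).carrier :=
  induced.liftAdd T ((induced.tmulHom T).comp c) (fun a ha p q => by
    change induced.tmul T (c (a * p)) q = induced.tmul T (c p) (a * q)
    rw [hc a ha, induced.tmul_comm ha])

theorem induced.mapLeft_tmul (c : R →+ R)
    (hc : ∀ a ∈ invariants T, ∀ p, c (a * p) = a * c p) (p q : R) :
    induced.mapLeft T c hc (induced.tmul T p q) = induced.tmul T (c p) q := rfl

/-- The map `p ⊗ q ↦ p ⊗ c(q)`. -/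
def induced.mapRight (T : Set (Equiv.Perm (Fin 3))) (c : R →+ R)
    (hc : ∀ a ∈ invariants T, ∀ p, c (a * p) = a * c p) :
    (induced T).carrier →+ (induced T).carrier :=
  induced.liftAdd T ((AddMonoidHom.compHom' c).comp (induced.tmulHom T)) (fun a ha p q => by
    change induced.tmul T (a * p) (c q) = induced.tmul T p (c (a * q))
    rw [hc a ha, induced.tmul_comm ha])

theorem induced.mapRight_tmul (c : R →+ R)
    (hc : ∀ a ∈ invariants T, ∀ p, c (a * p) = a * c p) (p q : R) :
    induced.mapRight T c hc (induced.tmul T p q) = induced.tmul T p (c q) := rfl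

/-- The ring `A` over which `c` is linear may be larger than `R^T`. In `induced_tensor_induced_left`
the tensor sign is over the smaller invariant ring and `c` is a coordinate over the larger one. -/
theorem induced.mapLeft_left (c : R →+ R) {A : Subalgebra ℝ R}
    (hc : ∀ a ∈ A, ∀ p, c (a * p) = a * c p) (hA : invariants T ≤ A) (a : R) (ha : a ∈ A)
    (x : (induced T).carrier) :
    induced.mapLeft T c (fun a ha => hc a (hA ha)) ((induced T).left a x) =
      (induced T).left a (induced.mapLeft T c (fun a ha => hc a (hA ha)) x) := by
  induction x using induced.induction with
  | zero => simp only [map_zero]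
  | add a b h1 h2 => simp only [map_add, h1, h2]
  | tmul p q =>
    rw [induced.left_tmul, induced.mapLeft_tmul, induced.mapLeft_tmul, induced.left_tmul, hc a ha]

theorem induced.mapRight_right (c : R →+ R) {A : Subalgebra ℝ R}
    (hc : ∀ a ∈ A, ∀ p, c (a * p) = a * c p) (hA : invariants T ≤ A) (a : R) (ha : a ∈ A)
    (x : (induced T).carrier) :
    induced.mapRight T c (fun a ha => hc a (hA ha)) ((induced T).right a x) =
      (induced T).right a (induced.mapRight T c (fun a ha => hc a (hA ha)) x) := by
  induction x using induced.induction with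
  | zero => simp only [map_zero]
  | add a b h1 h2 => simp only [map_add, h1, h2]
  | tmul p q =>
    rw [induced.right_tmul, induced.mapRight_tmul, induced.mapRight_tmul, induced.right_tmul,
      hc a ha]

end Induced

/-! ### Products of induced bimodules -/

section Product

variable {ι : Type} [Fintype ι]

/-- The morphism from a direct sum with given components. -/
def Hom.desc {M : ι → GradedBimodule} {P : GradedBimodule} (φ : ∀ i, Hom (M i) P) :
    Hom (Soergel.directSum M) P where
  toLin := ∑ i, (φ i).toLin ∘ₗ (Hom.proj M i).toLin
  map_left f m := by
    simp only [LinearMap.sum_apply, map_sum, LinearMap.comp_apply, Hom.map_left]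
  map_right f m := by
    simp only [LinearMap.sum_apply, map_sum, LinearMap.comp_apply, Hom.map_right]

theorem Hom.desc_apply {M : ι → GradedBimodule} {P : GradedBimodule} (φ : ∀ i, Hom (M i) P)
    (m : (Soergel.directSum M).carrier) :
    (Hom.desc φ).toLin m = ∑ i, (φ i).toLin ((Hom.proj M i).toLin m) := by
  simp only [Hom.desc, LinearMap.sum_apply, LinearMap.comp_apply]

theorem Hom.HasDegree.desc {M : ι → GradedBimodule} {P : GradedBimodule} {φ : ∀ i, Hom (M i) P}
    {d : ℤ} (h : ∀ i, (φ i).HasDegree d) : (Hom.desc φ).HasDegree d := fun k m hm => by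
  rw [Hom.desc_apply]
  exact Submodule.sum_mem _ fun i _ => h i k _ (hm i trivial)

/-- A homomorphism from `M(n)`, given as a homomorphism from `M`. -/
def Hom.ofShift {M : GradedBimodule} {P : GradedBimodule} (φ : Hom M P) (n : ℤ) :
    Hom (M.shift n) P := ⟨φ.toLin, φ.map_left, φ.map_right⟩

theorem Hom.HasDegree.ofShift {M : GradedBimodule} {P : GradedBimodule} {φ : Hom M P} {d : ℤ}
    (h : φ.HasDegree d) (n : ℤ) : (φ.ofShift n).HasDegree (n + d) := fun k m hm =>
  P.deg_cast (h (n + k) m hm) (by ring)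

theorem directSum_congr_shift {M : GradedBimodule.{0}} {P : GradedBimodule} {d e : ι → ℤ} {n : ℤ}
    (h : P ≅ᵍ directSum fun i => M.shift (d i)) (he : ∀ i, d i + n = e i) :
    P.shift n ≅ᵍ directSum fun i => M.shift (e i) :=
  (h.shift n).trans ((directSum_shift _ n).trans
    (IsIsomorphic.directSum fun i => shift_shift M (he i)))

variable [DecidableEq ι] {T T' : Set (Equiv.Perm (Fin 3))}

theorem sum_ite_proj {M : GradedBimodule} {φ : ι → M.carrier →+ M.carrier}
    (j : ι) (h : ∀ i, φ i = if j = i then AddMonoidHom.id _ else 0) (x : ι → M.carrier) :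
    ∑ i, φ i (x i) = x j := by
  rw [Finset.sum_eq_single j]
  · rw [h, if_pos rfl, AddMonoidHom.id_apply]
  · intro i _ hij
    rw [h, if_neg (Ne.symm hij), AddMonoidHom.zero_apply]
  · exact fun h => absurd (Finset.mem_univ j) h

/-- `(R ⊗_{R^T} R)(R ⊗_{R^{T'}} R)` is a sum of shifts of `R ⊗_{R^{T'}} R` if `R^{T'} ⊆ R^T` and
`R` is free over `R^T`. -/
theorem induced_tensor_induced_left (b : GradedBasis (invariants T) ⊤ ι)
    (hT : invariants T' ≤ invariants T) :
    induced T ⊗ᵍ induced T' ≅ᵍ directSum fun i => (induced T').shift (-b.degree i) := by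
  -- In `R ⊗_{R^T} R ⊗_{R^{T'}} R` this is `1 ⊗ e_i ⊗ 1`, the generator of the `i`-th summand. It
  -- commutes with `R^{T'}`, since such invariants pass both tensor signs.
  let u : ι → (induced T ⊗ᵍ induced T').carrier := fun i =>
    tmul (induced.tmul T 1 (b.elt i)) (induced.tmul T' 1 1)
  have hu : ∀ i, ∀ a ∈ invariants T', (induced T ⊗ᵍ induced T').left a (u i) =
      (induced T ⊗ᵍ induced T').right a (u i) := by
    intro i a ha
    rw [left_tmul, right_tmul, induced.left_tmul, induced.right_tmul, induced.tmul_comm (hT ha),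
      ← induced.right_tmul, tmul_balanced, induced.left_tmul, induced.tmul_comm ha]
  have hud : ∀ i, u i ∈ (induced T ⊗ᵍ induced T').deg (b.degree i) := fun i =>
    Soergel.tmul_mem (induced.tmul_mem R.one_mem (b.elt_mem_deg i) (zero_add _))
      (induced.tmul_mem R.one_mem R.one_mem (zero_add _)) (add_zero _)
  let ψ : ι → Hom (induced T') (induced T ⊗ᵍ induced T') := fun i => Hom.ofCentral (u i) (hu i)
  have hψ : ∀ i p q, (ψ i).toLin (induced.tmul T' p q) =
      tmul (induced.tmul T p (b.elt i)) (induced.tmul T' 1 q) := fun i p q => by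
    rw [Hom.ofCentral_tmul, right_tmul, left_tmul, induced.right_tmul, induced.left_tmul, mul_one,
      mul_one]
  -- The shift by `-deg e_i` compensates the degree of the generator `u i`.
  have hψd : (Hom.desc fun i => (ψ i).ofShift (-b.degree i)).HasDegree 0 :=
    Hom.HasDegree.desc fun i =>
      ((Hom.ofCentral_hasDegree (u i) (hu i) (hud i)).ofShift _).cast (neg_add_cancel _)
  -- The components of the inverse, `p ⊗ f ⊗ q ↦ p c_i(f) ⊗ q`. They need only be additive, as a
  -- set-theoretic inverse suffices.
  let Λ : ι → (induced T ⊗ᵍ induced T').carrier →+ (induced T').carrier := fun i =>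
    induced.liftLeft (induced.mapLeft T' (b.coord i) fun a ha => b.coord_mul i a (hT ha))
      (induced.mapLeft_left (b.coord i) (b.coord_mul i) hT)
  have hΛ : ∀ i p f g q, Λ i (tmul (induced.tmul T p f) (induced.tmul T' g q)) =
      induced.tmul T' (p * b.coord i (f * g)) q := fun i p f g q => by
    rw [induced.liftLeft_tmul, induced.left_tmul, induced.mapLeft_tmul, induced.left_tmul]
  refine (hψd.isIsomorphic_of_inverse (fun x i => Λ i x) (fun m => ?_) (fun n => ?_)).symm
  · funext j
    rw [Hom.desc_apply, map_sum]
    refine sum_ite_proj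
      (φ := fun i => (Λ j).comp (ψ i).toLin.toAddMonoidHom) j (fun i => ?_) m
    refine induced.addHom_ext fun p q => ?_
    rw [AddMonoidHom.comp_apply]
    change Λ j ((ψ i).toLin (induced.tmul T' p q)) = _
    rw [hψ, hΛ, mul_one, b.coord_elt]
    split_ifs
    · rw [mul_one]; rfl
    · rw [mul_zero]; exact TensorProduct.zero_tmul _ _
  · refine (Hom.desc_apply _ _).trans ?_
    change ∑ i, (ψ i).toLin (Λ i n) = n
    induction n using tensor_induction with
    | zero => simp only [map_zero, Finset.sum_const_zero]
    | add a b h1 h2 => simp only [map_add, Finset.sum_add_distrib, h1, h2]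
    | tmul x y =>
      induction x using induced.induction with
      | zero =>
        rw [← tmulHom_apply, map_zero, AddMonoidHom.zero_apply]
        simp only [map_zero, Finset.sum_const_zero]
      | add a b h1 h2 =>
        rw [add_tmul]
        simp only [map_add, Finset.sum_add_distrib, h1, h2]
      | tmul p f =>
        induction y using induced.induction with
        | zero =>
          rw [← tmulHom_apply, map_zero]
          simp only [map_zero, Finset.sum_const_zero]
        | add a b h1 h2 =>
          rw [tmul_add]
          simp only [map_add, Finset.sum_add_distrib, h1, h2]
        | tmul g q =>
          -- The coefficient `c_i(f g)` lies in `R^T`, so it can be moved across the first tensor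
          -- sign to stand next to `e_i`; the sum over `i` then reassembles `f g`.
          have h : ∀ i, (ψ i).toLin (Λ i (tmul (induced.tmul T p f) (induced.tmul T' g q))) =
              (tmulHom (induced T) (induced T')).flip (induced.tmul T' 1 q)
                (induced.tmulHom T p (b.coord i (f * g) * b.elt i)) := fun i => by
            rw [hΛ, hψ, mul_comm p, induced.tmul_comm (b.coord_mem i _ trivial)]
            rfl
          rw [Finset.sum_congr rfl fun i _ => h i, ← map_sum, ← map_sum, b.sum_coord _ trivial]
          change tmul (induced.tmul T p (f * g)) (induced.tmul T' 1 q) = _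
          rw [mul_comm f, ← induced.right_tmul, tmul_balanced, induced.left_tmul, mul_one]

/-- `(R ⊗_{R^{T'}} R)(R ⊗_{R^T} R)` is a sum of shifts of `R ⊗_{R^{T'}} R` if `R^{T'} ⊆ R^T` and
`R` is free over `R^T`. -/
theorem induced_tensor_induced_right (b : GradedBasis (invariants T) ⊤ ι)
    (hT : invariants T' ≤ invariants T) :
    induced T' ⊗ᵍ induced T ≅ᵍ directSum fun i => (induced T').shift (-b.degree i) := by
  -- The generator `1 ⊗ e_i ⊗ 1` of `R ⊗_{R^{T'}} R ⊗_{R^T} R`; now the basis coefficients leave the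
  -- middle factor to the right.
  let u : ι → (induced T' ⊗ᵍ induced T).carrier := fun i =>
    tmul (induced.tmul T' 1 1) (induced.tmul T (b.elt i) 1)
  have hu : ∀ i, ∀ a ∈ invariants T', (induced T' ⊗ᵍ induced T).left a (u i) =
      (induced T' ⊗ᵍ induced T).right a (u i) := by
    intro i a ha
    rw [left_tmul, right_tmul, induced.left_tmul, induced.right_tmul, induced.tmul_comm ha,
      ← induced.right_tmul, tmul_balanced, induced.left_tmul, induced.tmul_comm (hT ha)]
  have hud : ∀ i, u i ∈ (induced T' ⊗ᵍ induced T).deg (b.degree i) := fun i =>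
    Soergel.tmul_mem (induced.tmul_mem R.one_mem R.one_mem (zero_add _))
      (induced.tmul_mem (b.elt_mem_deg i) R.one_mem (add_zero _)) (zero_add _)
  let ψ : ι → Hom (induced T') (induced T' ⊗ᵍ induced T) := fun i => Hom.ofCentral (u i) (hu i)
  have hψ : ∀ i p q, (ψ i).toLin (induced.tmul T' p q) =
      tmul (induced.tmul T' p 1) (induced.tmul T (b.elt i) q) := fun i p q => by
    rw [Hom.ofCentral_tmul, right_tmul, left_tmul, induced.right_tmul, induced.left_tmul, mul_one,
      mul_one]
  have hψd : (Hom.desc fun i => (ψ i).ofShift (-b.degree i)).HasDegree 0 :=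
    Hom.HasDegree.desc fun i =>
      ((Hom.ofCentral_hasDegree (u i) (hu i) (hud i)).ofShift _).cast (neg_add_cancel _)
  let Λ : ι → (induced T' ⊗ᵍ induced T).carrier →+ (induced T').carrier := fun i =>
    induced.liftRight (induced.mapRight T' (b.coord i) fun a ha => b.coord_mul i a (hT ha))
      (induced.mapRight_right (b.coord i) (b.coord_mul i) hT)
  have hΛ : ∀ i p f g q, Λ i (tmul (induced.tmul T' p f) (induced.tmul T g q)) =
      induced.tmul T' p (q * b.coord i (g * f)) := fun i p f g q => by
    rw [induced.liftRight_tmul, induced.right_tmul, induced.mapRight_tmul, induced.right_tmul]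
  refine (hψd.isIsomorphic_of_inverse (fun x i => Λ i x) (fun m => ?_) (fun n => ?_)).symm
  · funext j
    rw [Hom.desc_apply, map_sum]
    refine sum_ite_proj
      (φ := fun i => (Λ j).comp (ψ i).toLin.toAddMonoidHom) j (fun i => ?_) m
    refine induced.addHom_ext fun p q => ?_
    rw [AddMonoidHom.comp_apply]
    change Λ j ((ψ i).toLin (induced.tmul T' p q)) = _
    rw [hψ, hΛ, mul_one, b.coord_elt]
    split_ifs
    · rw [mul_one]; rfl
    · rw [mul_zero]; exact TensorProduct.tmul_zero _ _
  · refine (Hom.desc_apply _ _).trans ?_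
    change ∑ i, (ψ i).toLin (Λ i n) = n
    induction n using tensor_induction with
    | zero => simp only [map_zero, Finset.sum_const_zero]
    | add a b h1 h2 => simp only [map_add, Finset.sum_add_distrib, h1, h2]
    | tmul x y =>
      induction x using induced.induction with
      | zero =>
        rw [← tmulHom_apply, map_zero, AddMonoidHom.zero_apply]
        simp only [map_zero, Finset.sum_const_zero]
      | add a b h1 h2 =>
        rw [add_tmul]
        simp only [map_add, Finset.sum_add_distrib, h1, h2]
      | tmul p f =>
        induction y using induced.induction with
        | zero =>
          rw [← tmulHom_apply, map_zero]
          simp only [map_zero, Finset.sum_const_zero]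
        | add a b h1 h2 =>
          rw [tmul_add]
          simp only [map_add, Finset.sum_add_distrib, h1, h2]
        | tmul g q =>
          have h : ∀ i, (ψ i).toLin (Λ i (tmul (induced.tmul T' p f) (induced.tmul T g q))) =
              tmulHom (induced T') (induced T) (induced.tmul T' p 1)
                -- As `c_i(g f)` lies in `R^T`, it returns from the right factor to the side of
                -- `e_i`, and the expansion of `g f` is recovered.
                ((induced.tmulHom T).flip q (b.coord i (g * f) * b.elt i)) := fun i => by
            rw [hΛ, hψ, mul_comm q, ← induced.tmul_comm (b.coord_mem i _ trivial)]
            rfl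
          rw [Finset.sum_congr rfl fun i _ => h i, ← map_sum, ← map_sum, b.sum_coord _ trivial]
          change tmul (induced.tmul T' p 1) (induced.tmul T (g * f) q) = _
          rw [mul_comm g, ← induced.left_tmul, ← tmul_balanced, induced.right_tmul, mul_one]

end Product

/-! ### Products of the generators -/

section Generators

theorem B_tensor_B (t : Simple) :
    B t ⊗ᵍ B t ≅ᵍ directSum ![(B t).shift 1, (B t).shift (-1)] := by
  refine (tensor_shift_shift _ _ (show (1 : ℤ) + 1 = 2 by norm_num)).trans
    ((directSum_congr_shift (induced_tensor_induced_left (simpleBasis t) le_rfl)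
      (e := ![2, 0]) (Fin.forall_fin_two.2 ⟨by simp [simpleBasis], by simp [simpleBasis]⟩)).trans
      (IsIsomorphic.directSum (Fin.forall_fin_two.2 ⟨?_, ?_⟩)))
  · exact (shift_shift _ (by norm_num)).symm
  · exact (shift_shift _ (by norm_num)).symm

theorem B_tensor_Bsrs (t : Simple) :
    B t ⊗ᵍ Bsrs ≅ᵍ directSum ![Bsrs.shift 1, Bsrs.shift (-1)] := by
  refine (tensor_shift_shift _ _ (show (1 : ℤ) + 3 = 4 by norm_num)).trans
    ((directSum_congr_shift (induced_tensor_induced_left (simpleBasis t)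
      (invariants_simples_le t))
      (e := ![4, 2]) (Fin.forall_fin_two.2 ⟨by simp [simpleBasis], by simp [simpleBasis]⟩)).trans
      (IsIsomorphic.directSum (Fin.forall_fin_two.2 ⟨?_, ?_⟩)))
  · exact (shift_shift _ (by norm_num)).symm
  · exact (shift_shift _ (by norm_num)).symm

/-- Used only for closure: multiplication by `B_t` on the right reproduces shifts of `B_{srs}`. -/
theorem Bsrs_tensor_B (t : Simple) :
    Bsrs ⊗ᵍ B t ≅ᵍ directSum fun i => Bsrs.shift ((![1, -1] : Fin 2 → ℤ) i) := by
  refine (tensor_shift_shift _ _ (show (3 : ℤ) + 1 = 4 by norm_num)).trans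
    ((directSum_congr_shift (induced_tensor_induced_right (simpleBasis t)
      (invariants_simples_le t))
      (e := ![4, 2]) (Fin.forall_fin_two.2 ⟨by simp [simpleBasis], by simp [simpleBasis]⟩)).trans
      (IsIsomorphic.directSum (Fin.forall_fin_two.2 ⟨?_, ?_⟩)))
  · exact (shift_shift _ (by norm_num)).symm
  · exact (shift_shift _ (by norm_num)).symm

theorem Bsrs_tensor_Bsrs :
    Bsrs ⊗ᵍ Bsrs ≅ᵍ directSum ![Bsrs.shift (-3), Bsrs.shift (-1), Bsrs.shift (-1), Bsrs.shift 1,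
      Bsrs.shift 1, Bsrs.shift 3] := by
  let b := fullBasis (t := .s) (u := .r) (by simp)
  -- Lists the basis as `w² α, w², w α, w, α, 1`, with degrees 6, 4, 4, 2, 2, 0, so that the shifts
  -- `3 - deg` of `B_{srs}` appear in the order `-3, -1, -1, 1, 1, 3`.
  let ε : Fin 6 ≃ Fin 3 × Fin 2 :=
    ⟨![(0, 1), (0, 0), (1, 1), (1, 0), (2, 1), (2, 0)],
      fun p => ![![1, 0], ![3, 2], ![5, 4]] p.1 p.2, by decide, by decide⟩
  refine (tensor_shift_shift _ _ (show (3 : ℤ) + 3 = 6 by norm_num)).trans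
    ((directSum_congr_shift ((induced_tensor_induced_left b le_rfl).trans (directSum_reindex _ ε))
      (n := 6) (fun i => rfl)).trans (IsIsomorphic.directSum fun i => ?_))
  fin_cases i <;>
  exact (shift_shift _ (by
    simp [ε, b, fullBasis, GradedBasis.trans, weightBasis, simpleBasis])).symm

end Generators

/-! ### The idempotent -/

section Idempotent

variable {t u : Simple}

/-! ### Degrees and values of the structure morphisms. -/

theorem B.hom_ext {N : GradedBimodule} {φ ψ : Hom (B t) N}
    (h : ∀ p q, φ.toLin (B.tmul t p q) = ψ.toLin (B.tmul t p q)) : φ = ψ :=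
  Hom.ext (LinearMap.toAddMonoidHom_injective (induced.addHom_ext h))

/-- Here `d` is measured against the polynomial degree of `p ⊗ q`; the shift in `B_t = R ⊗_{R^t}
R(1)` adds 1. -/
theorem B.hasDegree_of_tmul {N : GradedBimodule} {φ : Hom (B t) N} {d e : ℤ}
    (h : ∀ i j, ∀ p ∈ R.deg i, ∀ q ∈ R.deg j, φ.toLin (B.tmul t p q) ∈ N.deg (i + j + d))
    (hd : 1 + d = e) : φ.HasDegree e := by
  have := (induced.hasDegree_of_tmul (φ := (⟨φ.toLin, φ.map_left, φ.map_right⟩ :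
    Hom (induced {t.perm}) N)) h).ofShift 1
  exact hd ▸ this

theorem B.tmul_mem {i j k : ℤ} {p q : R} (hp : p ∈ R.deg i) (hq : q ∈ R.deg j)
    (h : i + j = 1 + k) : B.tmul t p q ∈ (B t).deg k :=
  induced.tmul_mem hp hq h

theorem mul_tmul (p q : R) : (mul t).toLin (B.tmul t p q) = p * q :=
  Algebra.TensorProduct.lmul'_apply_tmul (R := invariants {t.perm}) (S := R) p q

theorem mul_hasDegree (t : Simple) : (mul t).HasDegree 1 :=
  B.hasDegree_of_tmul (d := 0) (fun i j p hp q hq => by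
    rw [mul_tmul, add_zero]
    exact R.mul_mem_deg hp hq) (by norm_num)

theorem mulAdj_one (t : Simple) :
    (mulAdj t).toLin (1 : R) = B.tmul t t.root 1 + B.tmul t 1 t.root :=
  one_mul (casimir t)

theorem mulAdj_hasDegree (t : Simple) : (mulAdj t).HasDegree 1 := fun k (p : R) hp => by
  have h : (mulAdj t).toLin (1 : R) ∈ (B t).deg 1 := by
    rw [mulAdj_one]
    exact Submodule.add_mem _ (B.tmul_mem (root_mem_deg t) R.one_mem (by norm_num))
      (B.tmul_mem R.one_mem (root_mem_deg t) (by norm_num))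
  have h2 := (mulAdj t).map_left p (1 : R)
  have h3 := (B t).left_mem hp h
  rw [← h2] at h3
  have h4 : unit.left p (1 : R) = p := mul_one p
  rwa [h4] at h3

theorem contract_tmul (p q q' h : R) :
    (contract t).toLin (tmul (B.tmul t p q) (B.tmul t q' h)) =
      B.tmul t (p * partialAdd t (q * q')) h := rfl

/-- The linear map `n ↦ m ⊗ n`. -/
def tmulLeft {M : GradedBimodule} (m : M.carrier) (N : GradedBimodule) :
    N.carrier →ₗ[ℝ] (M ⊗ᵍ N).carrier where
  toFun n := tmul m n
  map_add' n n' := tmul_add m n n'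
  map_smul' c n := by
    -- The real structure of `M N` is carried by the left factor; the right action of constants
    -- transports scalars to `N`.
    have h : (algebraMap ℝ (Module.End ℝ (M ⊗ᵍ N).carrier) c) (tmul m n) = c • tmul m n := rfl
    rw [RingHom.id_apply, ← h, ← (M ⊗ᵍ N).right.commutes, right_tmul, N.right.commutes]
    rfl

theorem B.deg_le {k : ℤ} {V : Submodule ℝ (B t).carrier}
    (h : ∀ i j, i + j = 1 + k → ∀ p ∈ R.deg i, ∀ q ∈ R.deg j, B.tmul t p q ∈ V) :
    (B t).deg k ≤ V :=
  tensorDeg_le (invariants {t.perm}) (V := V) h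

/-- `∂_t` lowers the polynomial degree by 2, and passing from two shifts by 1 to a single one gains
1. -/
theorem contract_hasDegree (t : Simple) : (contract t).HasDegree (-1) :=
  Hom.HasDegree.of_tmul fun i j x hx y hy => by
    refine B.deg_le (V := ((B t).deg (i + j + -1)).comap
      ((contract t).toLin ∘ₗ tmulRight (B t) y)) (fun a b hab p hp q hq => ?_) hx
    refine B.deg_le (V := ((B t).deg (i + j + -1)).comap
      ((contract t).toLin ∘ₗ tmulLeft (B.tmul t p q) (B t))) (fun c d hcd q' hq' h hh => ?_) hy
    change (contract t).toLin (tmul (B.tmul t p q) (B.tmul t q' h)) ∈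
      (B t).deg (i + j + -1)
    rw [contract_tmul]
    exact B.tmul_mem (R.mul_mem_deg hp (partialFun_mem_deg t (R.mul_mem_deg hq hq'))) hh
      (by linarith)

theorem contractAdj_tmul (p q : R) :
    (contractAdj t).toLin (B.tmul t p q) = tmul (B.tmul t p 1) (B.tmul t 1 q) := rfl

theorem contractAdj_hasDegree (t : Simple) : (contractAdj t).HasDegree (-1) :=
  -- The polynomial degree is unchanged and the target carries the shift 2, hence `-2`; the shift of
  -- the source makes it `-1`.
  B.hasDegree_of_tmul (d := -2) (fun i j p hp q hq => by
    rw [contractAdj_tmul]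
    exact tmul_mem (i := i - 1) (j := j - 1) (B.tmul_mem hp R.one_mem (by ring))
      (B.tmul_mem R.one_mem hq (by ring)) (by ring)) (by norm_num)

/-- The morphism `j_t ∘ (id ⊗ m_u ⊗ id) : B_t B_u B_t → B_t`. -/
def retract (t u : Simple) : Hom (B t ⊗ᵍ B u ⊗ᵍ B t) (B t) :=
  (contract t).comp
    (Hom.whiskerRight ((rightUnitor (B t)).comp (Hom.whiskerLeft (B t) (mul u))) (B t))

/-- The morphism `(id ⊗ m_u^a ⊗ id) ∘ j_t^a : B_t → B_t B_u B_t`. -/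
def coretract (t u : Simple) : Hom (B t) (B t ⊗ᵍ B u ⊗ᵍ B t) :=
  (Hom.whiskerRight ((Hom.whiskerLeft (B t) (mulAdj u)).comp (rightUnitorInv (B t))) (B t)).comp
    (contractAdj t)

theorem idem_apply (x : (B t ⊗ᵍ B u ⊗ᵍ B t).carrier) :
    (idem t u).toLin x = -(coretract t u).toLin ((retract t u).toLin x) := rfl

theorem retract_hasDegree (t u : Simple) : (retract t u).HasDegree 0 :=
  ((contract_hasDegree t).comp (((rightUnitor_hasDegree _).comp
    ((mul_hasDegree u).whiskerLeft _)).whiskerRight _)).cast (by norm_num)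

theorem coretract_hasDegree (t u : Simple) : (coretract t u).HasDegree 0 :=
  ((((mulAdj_hasDegree u).whiskerLeft _).comp (rightUnitorInv_hasDegree _)).whiskerRight _ |>.comp
    (contractAdj_hasDegree t)).cast (by norm_num)

theorem retract_tmul (p f g h k l : R) :
    (retract t u).toLin (tmul (tmul (B.tmul t p f) (B.tmul u g h)) (B.tmul t k l)) =
      B.tmul t (p * partialAdd t (g * h * f * k)) l := by
  have h1 : (retract t u).toLin (tmul (tmul (B.tmul t p f) (B.tmul u g h)) (B.tmul t k l)) =
    (contract t).toLin (tmul ((B t).right ((mul u).toLin (B.tmul u g h)) (B.tmul t p f))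
      (B.tmul t k l)) := rfl
  rw [h1, mul_tmul, B.right_tmul, contract_tmul]

theorem coretract_tmul (p q : R) : (coretract t u).toLin (B.tmul t p q) =
    tmul (tmul (B.tmul t p 1) (B.tmul u u.root 1)) (B.tmul t 1 q) +
      tmul (tmul (B.tmul t p 1) (B.tmul u 1 u.root)) (B.tmul t 1 q) := by
  have h1 : (coretract t u).toLin (B.tmul t p q) =
    tmul (tmul (B.tmul t p 1) ((mulAdj u).toLin (1 : R))) (B.tmul t 1 q) := rfl
  rw [h1, mulAdj_one, tmul_add, add_tmul]

/-! ### Idempotency of `e` and its image. -/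

theorem partialAdd_root_of_ne (h : t ≠ u) : partialAdd t (u.root + u.root) = -1 :=
  partialFun_eq (by rw [map_add, rename_root_of_ne h]; ring)

/-- `ι(p ⊗ q) = p ⊗ α_u ⊗ 1 ⊗ q + p ⊗ 1 ⊗ α_u ⊗ q`. Multiplying the two middle factors gives `p ⊗ 2
α_u ⊗ q`, and `∂_t(2 α_u) = -1` because `t α_u = α_u + α_t`. This accounts for the sign in the
definition of `e`. -/
theorem retract_coretract (h : t ≠ u) (x : (B t).carrier) :
    (retract t u).toLin ((coretract t u).toLin x) = -x := by
  refine Hom.congr_apply (φ := (retract t u).comp (coretract t u)) (ψ := (Hom.id _).neg)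
    (B.hom_ext fun p q => ?_) x
  change (retract t u).toLin ((coretract t u).toLin (B.tmul t p q)) = -B.tmul t p q
  rw [coretract_tmul, map_add, retract_tmul, retract_tmul, ← B.add_tmul, ← mul_add, ← map_add]
  have h1 : u.root * 1 * 1 * 1 + 1 * u.root * 1 * 1 = u.root + u.root := by ring
  rw [h1, partialAdd_root_of_ne h, mul_neg_one]
  exact TensorProduct.neg_tmul _ _

theorem idem_coretract (h : t ≠ u) (x : (B t).carrier) :
    (idem t u).toLin ((coretract t u).toLin x) = (coretract t u).toLin x := by
  rw [idem_apply, retract_coretract h, map_neg, neg_neg]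

theorem idem_hasDegree (t u : Simple) : (idem t u).HasDegree 0 := fun k x hx => by
  rw [idem_apply]
  exact Submodule.neg_mem _ 
    (((coretract_hasDegree t u).comp (retract_hasDegree t u)) k x hx)

theorem sub_idem_hasDegree (t u : Simple) : ((Hom.id _).sub (idem t u)).HasDegree 0 :=
  fun k x hx => Submodule.sub_mem _
    (GradedBimodule.deg_cast (m := x) hx (add_zero k).symm) (idem_hasDegree t u k x hx)

/-- The image of `e = -ι ρ` lies in that of `ι`, and `e` is the identity there since `ρ ι = -1`. -/
theorem idem_comp_idem (h : t ≠ u) : (idem t u).comp (idem t u) = idem t u := by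
  refine Hom.ext (LinearMap.ext fun x => ?_)
  change (idem t u).toLin ((idem t u).toLin x) = (idem t u).toLin x
  rw [idem_apply x, map_neg, idem_coretract h]

/-- The image of `e` is isomorphic to the source of an injective morphism with the same range. -/
theorem Hom.image_isIsomorphic {M : GradedBimodule} {N : GradedBimodule} {P : GradedBimodule}
    {e : Hom M P} (he : e.HasDegree 0) {φ : Hom N P} (hφ : φ.HasDegree 0)
    (hi : Function.Injective φ.toLin) (hr : LinearMap.range φ.toLin = LinearMap.range e.toLin) :
    e.image he ≅ᵍ N := by
  let ψ : Hom N (e.image he) :=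
    ⟨φ.toLin.codRestrict (LinearMap.range e.toLin) fun n => hr ▸ ⟨n, rfl⟩,
      fun f n => Subtype.ext (φ.map_left f n), fun f n => Subtype.ext (φ.map_right f n)⟩
  have hψ : ψ.HasDegree 0 := fun k n hn => hφ k n hn
  refine (hψ.isIsomorphic ⟨fun n n' h => hi (congrArg Subtype.val h), ?_⟩).symm
  rintro ⟨p, hp⟩
  obtain ⟨n, hn⟩ := hr.symm ▸ hp
  exact ⟨n, Subtype.ext hn⟩

theorem coretract_injective (h : t ≠ u) : Function.Injective (coretract t u).toLin := fun x y hxy => by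
  have := congrArg (retract t u).toLin hxy
  rw [retract_coretract h, retract_coretract h] at this
  exact neg_injective this

theorem image_idem (h : t ≠ u) : (idem t u).image (idem_hasDegree t u) ≅ᵍ B t := by
  refine Hom.image_isIsomorphic _ (coretract_hasDegree t u) (coretract_injective h)
    (le_antisymm ?_ ?_)
  · rintro _ ⟨x, rfl⟩
    exact ⟨(coretract t u).toLin x, idem_coretract h x⟩
  · rintro _ ⟨x, rfl⟩
    exact ⟨-(retract t u).toLin x, by rw [map_neg, idem_apply]⟩

/-! ### Generators of `B_t B_u B_t`. -/

/-- The element `(1 ⊗ f) ⊗ (1 ⊗ g) ⊗ (1 ⊗ 1)` of `B_t B_u B_t`. -/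
def middle (t u : Simple) (f g : R) : (B t ⊗ᵍ B u ⊗ᵍ B t).carrier :=
  tmul (tmul (B.tmul t 1 f) (B.tmul u 1 g)) (B.tmul t 1 1)

theorem middle_add_left (f f' g : R) :
    middle t u (f + f') g = middle t u f g + middle t u f' g := by
  rw [middle, B.tmul_add, add_tmul, add_tmul]; rfl

theorem middle_add_right (f g g' : R) :
    middle t u f (g + g') = middle t u f g + middle t u f g' := by
  rw [middle, B.tmul_add, tmul_add, add_tmul]; rfl

/-- Viewed as `1 ⊗ f ⊗ g ⊗ 1`, such an element lets `t`-invariants pass through the outer tensor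
signs and `u`-invariants through the middle one. This lemma and the next two are the rules by which
`middle_generates` computes. -/
theorem left_middle {a : R} (ha : a ∈ invariants {t.perm}) (f g : R) :
    (B t ⊗ᵍ B u ⊗ᵍ B t).left a (middle t u f g) = middle t u (a * f) g := by
  rw [middle, left_tmul, left_tmul, B.left_tmul, B.tmul_comm t ha, middle]

theorem right_middle {a : R} (ha : a ∈ invariants {t.perm}) (f g : R) :
    (B t ⊗ᵍ B u ⊗ᵍ B t).right a (middle t u f g) = middle t u f (a * g) := by
  rw [middle, right_tmul, B.right_tmul, ← B.tmul_comm t ha, ← B.left_tmul, ← tmul_balanced,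
    right_tmul, B.right_tmul, middle]

theorem middle_mul {b : R} (hb : b ∈ invariants {u.perm}) (f g : R) :
    middle t u (b * f) g = middle t u f (b * g) := by
  rw [middle, ← B.right_tmul, tmul_balanced, B.left_tmul, B.tmul_comm u hb, middle]

/-- The inner factors `g` and `k` cross the two tensor signs over `R`; the outer factors are the
bimodule actions. So the elements `middle t u f g` generate. -/
theorem tmul_eq_middle (p f g h k l : R) :
    (tmul (tmul (B.tmul t p f) (B.tmul u g h)) (B.tmul t k l) : (B t ⊗ᵍ B u ⊗ᵍ B t).carrier) =
      (B t ⊗ᵍ B u ⊗ᵍ B t).left p ((B t ⊗ᵍ B u ⊗ᵍ B t).right l (middle t u (g * f) (k * h))) := by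
  rw [middle, right_tmul, left_tmul, left_tmul, B.left_tmul, B.right_tmul, ← B.right_tmul t g,
    tmul_balanced, B.left_tmul, ← B.right_tmul u k, ← right_tmul, tmul_balanced, B.left_tmul,
    mul_one, mul_one, mul_one, mul_one]

theorem symmPart_mem' (t : Simple) (p : R) : p - t.root * partialAdd t p ∈ invariants {t.perm} :=
  symmPart_mem t p

/-- The elements are `a = ϖ_u` and `b = -ϖ_t` for the fundamental weights `ϖ_u = (2 α_u + α_t)/3`
and `ϖ_t = (2 α_t + α_u)/3`, which are fixed by `t` and `u` respectively. The first identity is `α_u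
= 2 ϖ_u - ϖ_t`. -/
theorem exists_root_decomposition (h : t ≠ u) : ∃ a ∈ invariants {t.perm},
    ∃ b ∈ invariants {u.perm}, u.root = (a + a) + b ∧ b + u.root + t.root = a := by
  have hc : (3 : R) * MvPolynomial.C (1 / 3) = 1 := by
    rw [← map_ofNat (MvPolynomial.C (R := ℝ) (σ := Fin 3)) 3, ← MvPolynomial.C_mul]
    norm_num
  refine ⟨MvPolynomial.C (1 / 3) * (2 * u.root + t.root), ?_,
    -(MvPolynomial.C (1 / 3) * (2 * t.root + u.root)), ?_, ?_, ?_⟩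
  · rw [mem_invariants]
    simp only [map_mul, map_add, map_ofNat, MvPolynomial.rename_C, rename_root_of_ne h, rename_root]
    ring
  · rw [mem_invariants]
    simp only [map_neg, map_mul, map_add, map_ofNat, MvPolynomial.rename_C,
      rename_root_of_ne h.symm, rename_root]
    ring
  · linear_combination -u.root * hc
  · linear_combination -(u.root + t.root) * hc

/-- A sub-bimodule of `B_t B_u B_t` that contains the generators is everything. -/
theorem middle_generates (h : t ≠ u) (V : Submodule ℝ (B t ⊗ᵍ B u ⊗ᵍ B t).carrier)
    (hl : ∀ f, ∀ x ∈ V, (B t ⊗ᵍ B u ⊗ᵍ B t).left f x ∈ V)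
    (hr : ∀ f, ∀ x ∈ V, (B t ⊗ᵍ B u ⊗ᵍ B t).right f x ∈ V)
    (h1 : middle t u 1 1 ∈ V) (h2 : (coretract t u).toLin (B.tmul t 1 1) ∈ V) : V = ⊤ := by
  obtain ⟨a, ha, b, hb, hab, hba⟩ := exists_root_decomposition h
  have ha' : a + a ∈ invariants {t.perm} := add_mem ha ha
  have e1 : (coretract t u).toLin (B.tmul t 1 1) = middle t u u.root 1 + middle t u 1 u.root := by
    rw [coretract_tmul, tmul_eq_middle, GradedBimodule.left_one, GradedBimodule.right_one, mul_one,
      mul_one]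
    rfl
  -- In `α_u = 2a + b`, the `t`-invariant `2a` leaves to the left and the `u`-invariant `b` crosses
  -- the middle tensor sign.
  have hu : ∀ g, middle t u u.root g =
      (B t ⊗ᵍ B u ⊗ᵍ B t).left (a + a) (middle t u 1 g) + middle t u 1 (b * g) := fun g => by
    rw [left_middle ha', ← middle_mul hb, mul_one, mul_one, ← middle_add_left, ← hab]
  -- By the preceding step `ι(1 ⊗ 1)` is `2a` acting on the left of `1 ⊗ 1 ⊗ 1 ⊗ 1`, plus `1 ⊗ 1 ⊗
  -- (b + α_u) ⊗ 1`. Adding `α_t` to `b + α_u` gives `a`, which is `t`-invariant and leaves to the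
  -- right. So `1 ⊗ 1 ⊗ α_t ⊗ 1` lies in `V`.
  have e2 : (coretract t u).toLin (B.tmul t 1 1) + middle t u 1 t.root =
      (B t ⊗ᵍ B u ⊗ᵍ B t).left (a + a) (middle t u 1 1) +
        (B t ⊗ᵍ B u ⊗ᵍ B t).right a (middle t u 1 1) := by
    rw [e1, hu, right_middle ha, mul_one, mul_one, add_assoc, add_assoc, ← middle_add_right,
      ← middle_add_right, ← add_assoc, hba]
  have h3 : middle t u 1 t.root ∈ V := by
    rw [← V.add_mem_iff_right h2, e2]
    exact V.add_mem (hl _ _ h1) (hr _ _ h1)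
  -- Expansion of `g` over `R^t` in `1, α_t`; the coefficients leave to the right.
  have h4 : ∀ g, middle t u 1 g ∈ V := fun g => by
    have hg : g = (g - t.root * partialAdd t g) * 1 + partialAdd t g * t.root := by ring
    rw [hg, middle_add_right, ← right_middle (symmPart_mem' t g),
      ← right_middle (partialAdd_mem t g)]
    exact V.add_mem (hr _ _ h1) (hr _ _ h3)
  -- Expansion of `f` over `R^u` in `1, α_u`; the coefficients cross the middle tensor sign and the
  -- remaining `α_u` is removed by `hu`.
  have h5 : ∀ f g, middle t u f g ∈ V := fun f g => by
    have hf : f = (f - u.root * partialAdd u f) * 1 + partialAdd u f * u.root := by ring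
    rw [hf, middle_add_left, middle_mul (symmPart_mem' u f), middle_mul (partialAdd_mem u f), hu]
    exact V.add_mem (h4 _) (V.add_mem (hl _ _ (h4 _)) (h4 _))
  rw [Submodule.eq_top_iff']
  intro x
  induction x using tensor_induction with
  | zero => exact V.zero_mem
  | add a b h1 h2 => exact V.add_mem h1 h2
  | tmul x y =>
    induction x using tensor_induction with
    | zero =>
      rw [← tmulHom_apply, map_zero]
      exact V.zero_mem
    | add a b h1 h2 => rw [add_tmul]; exact V.add_mem h1 h2
    | tmul x z =>
      induction x using B.induction with
      | zero =>
        rw [← tmulHom_apply, ← tmulHom_apply, map_zero, AddMonoidHom.zero_apply, map_zero]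
        exact V.zero_mem
      | add a b h1 h2 => rw [add_tmul, add_tmul]; exact V.add_mem h1 h2
      | tmul p f =>
        induction z using B.induction with
        | zero =>
          rw [← tmulHom_apply, ← tmulHom_apply, map_zero, map_zero]
          exact V.zero_mem
        | add a b h1 h2 => rw [tmul_add, add_tmul]; exact V.add_mem h1 h2
        | tmul g h =>
          induction y using B.induction with
          | zero =>
            rw [← tmulHom_apply, map_zero]
            exact V.zero_mem
          | add a b h1 h2 => rw [tmul_add]; exact V.add_mem h1 h2
          | tmul k l =>
            rw [tmul_eq_middle]
            exact hl _ _ (hr _ _ (h5 _ _))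

theorem middle_central (t u : Simple) {a : R} (ha : a ∈ invariants simples) :
    (B t ⊗ᵍ B u ⊗ᵍ B t).left a (middle t u 1 1) = (B t ⊗ᵍ B u ⊗ᵍ B t).right a (middle t u 1 1) := by
  rw [left_middle (invariants_simples_le t ha), right_middle (invariants_simples_le t ha),
    middle_mul (invariants_simples_le u ha)]

/-- The morphism `B_{srs} → B_t B_u B_t`, `p ⊗ q ↦ (p ⊗ 1) ⊗ (1 ⊗ 1) ⊗ (1 ⊗ q)`. -/
def long (t u : Simple) : Hom Bsrs (B t ⊗ᵍ B u ⊗ᵍ B t) :=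
  (Hom.ofCentral (middle t u 1 1) fun _ ha => middle_central t u ha).ofShift 3

theorem long_hasDegree (t u : Simple) : (long t u).HasDegree 0 := by
  -- The generator is a product of three elements `1 ⊗ 1`, each of degree `-1`; this matches the
  -- shift 3 in `B_{srs}`.
  refine ((Hom.ofCentral_hasDegree _ _ (d := -3) ?_).ofShift 3).cast (by norm_num)
  have h : B.tmul t 1 1 ∈ (B t).deg (-1) := B.tmul_mem R.one_mem R.one_mem (by norm_num)
  have h' : B.tmul u 1 1 ∈ (B u).deg (-1) := B.tmul_mem R.one_mem R.one_mem (by norm_num)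
  exact tmul_mem (tmul_mem h h' rfl) h (by norm_num)

theorem long_tmul (p q : R) : (long t u).toLin (induced.tmul simples p q) =
    tmul (tmul (B.tmul t p 1) (B.tmul u 1 1)) (B.tmul t 1 q) := by
  rw [tmul_eq_middle, mul_one]; rfl

/-- The inner factors are all 1, and `∂_t 1 = 0`. -/
theorem retract_long (x : Bsrs.carrier) : (retract t u).toLin ((long t u).toLin x) = 0 := by
  refine DFunLike.congr_fun (induced.addHom_ext (T := simples)
    (φ := ((retract t u).comp (long t u)).toLin.toAddMonoidHom) (ψ := 0) fun p q => ?_) x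
  change (retract t u).toLin ((long t u).toLin (induced.tmul simples p q)) = 0
  have h1 : partialAdd t 1 = 0 := partialAdd_eq_zero.2 (one_mem _)
  rw [long_tmul, retract_tmul]
  simp only [mul_one, h1, mul_zero]
  exact TensorProduct.zero_tmul _ _

theorem long_add_coretract_surjective (h : t ≠ u) (x : (B t ⊗ᵍ B u ⊗ᵍ B t).carrier) :
    ∃ b c, (long t u).toLin b + (coretract t u).toLin c = x := by
  have := middle_generates h
    (LinearMap.range (long t u).toLin ⊔ LinearMap.range (coretract t u).toLin) ?_ ?_ ?_ ?_
  · obtain ⟨_, ⟨b, rfl⟩, _, ⟨c, rfl⟩, hbc⟩ := Submodule.mem_sup.1 (this ▸ Submodule.mem_top (x := x))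
    exact ⟨b, c, hbc⟩
  · intro f x hx
    obtain ⟨_, ⟨b, rfl⟩, _, ⟨c, rfl⟩, rfl⟩ := Submodule.mem_sup.1 hx
    rw [map_add, ← Hom.map_left, ← Hom.map_left]
    exact Submodule.add_mem_sup ⟨_, rfl⟩ ⟨_, rfl⟩
  · intro f x hx
    obtain ⟨_, ⟨b, rfl⟩, _, ⟨c, rfl⟩, rfl⟩ := Submodule.mem_sup.1 hx
    rw [map_add, ← Hom.map_right, ← Hom.map_right]
    exact Submodule.add_mem_sup ⟨_, rfl⟩ ⟨_, rfl⟩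
  · exact Submodule.mem_sup_left ⟨induced.tmul simples 1 1, long_tmul 1 1⟩
  · exact Submodule.mem_sup_right ⟨_, rfl⟩

/-! ### Injectivity of `B_{srs} → B_t B_u B_t` by functionals. -/

/-- The functional `p ⊗ q ↦ c(p) q`. -/
def induced.functional (T : Set (Equiv.Perm (Fin 3))) (c : R →+ R)
    (hc : ∀ a ∈ invariants T, ∀ p, c (a * p) = a * c p) : (induced T).carrier →+ R :=
  induced.liftAdd T (AddMonoidHom.mul.comp c) (fun a ha p q => by
    change c (a * p) * q = c p * (a * q)
    rw [hc a ha]; ring)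

theorem induced.functional_tmul {T : Set (Equiv.Perm (Fin 3))} (c : R →+ R)
    (hc : ∀ a ∈ invariants T, ∀ p, c (a * p) = a * c p) (p q : R) :
    induced.functional T c hc (induced.tmul T p q) = c p * q := rfl

theorem induced.functional_right {T : Set (Equiv.Perm (Fin 3))} (c : R →+ R)
    (hc : ∀ a ∈ invariants T, ∀ p, c (a * p) = a * c p) (f : R) (x : (induced T).carrier) :
    induced.functional T c hc ((induced T).right f x) = f * induced.functional T c hc x := by
  induction x using induced.induction with
  | zero => simp only [map_zero, mul_zero]
  | add a b h1 h2 => simp only [map_add, mul_add, h1, h2]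
  | tmul p q =>
    rw [induced.right_tmul, induced.functional_tmul, induced.functional_tmul, mul_left_comm]

/-- Moving coordinates across the tensor sign gives `x = ∑ e_i ⊗ λ_i(x)` with `λ_i(p ⊗ q) = c_i(p)
q`, so the functionals `λ_i` separate points. -/
theorem induced.eq_zero_of_functional {T : Set (Equiv.Perm (Fin 3))} {ι : Type} [Fintype ι]
    [DecidableEq ι] (b : GradedBasis (invariants T) ⊤ ι) {x : (induced T).carrier}
    (hx : ∀ i, induced.functional T (b.coord i) (b.coord_mul i) x = 0) : x = 0 := by
  have h : x = ∑ i, induced.tmulHom T (b.elt i)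
      (induced.functional T (b.coord i) (b.coord_mul i) x) := by
    clear hx
    induction x using induced.induction with
    | zero => simp only [map_zero, Finset.sum_const_zero]
    | add a b h1 h2 =>
      simp only [map_add, Finset.sum_add_distrib]
      rw [← h1, ← h2]
    | tmul p q =>
      have h : ∀ i, induced.tmulHom T (b.elt i) (b.coord i p * q) =
          (induced.tmulHom T).flip q (b.coord i p * b.elt i) := fun i =>
        (induced.tmul_comm (b.coord_mem i p trivial) (b.elt i) q).symm
      simp only [induced.functional_tmul]
      rw [Finset.sum_congr rfl fun i _ => h i, ← map_sum, b.sum_coord p trivial]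
      rfl
  rw [h]
  exact Finset.sum_eq_zero fun i _ => by rw [hx, map_zero]

theorem induced.liftRight_right {T : Set (Equiv.Perm (Fin 3))} {N : GradedBimodule}
    {P : GradedBimodule} (Λ : N.carrier →+ P.carrier)
    (hΛ : ∀ a ∈ invariants T, ∀ n, Λ (N.right a n) = P.right a (Λ n)) (f : R)
    (x : (N ⊗ᵍ induced T).carrier) :
    induced.liftRight Λ hΛ ((N ⊗ᵍ induced T).right f x) = P.right f (induced.liftRight Λ hΛ x) := by
  induction x using tensor_induction with
  | zero => simp only [map_zero]
  | add a b h1 h2 => simp only [map_add, h1, h2]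
  | tmul n y =>
    induction y using induced.induction with
    | zero =>
      rw [← tmulHom_apply, map_zero]
      simp only [map_zero]
    | add a b h1 h2 =>
      rw [Soergel.tmul_add]
      simp only [map_add, h1, h2]
    | tmul g p =>
      rw [Soergel.right_tmul, induced.right_tmul, induced.liftRight_tmul, induced.liftRight_tmul,
        P.right_mul]

/-- A right `R`-linear functional `Λ` on `N` and an `R^T`-linear map `b` give the functional
`n ⊗ (f ⊗ p) ↦ b(Λ(n f)) p`. -/
theorem exists_functional_tensor_induced {T : Set (Equiv.Perm (Fin 3))} {N : GradedBimodule}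
    (Λ : N.carrier →+ R) (hΛ : ∀ f x, Λ (N.right f x) = f * Λ x) (b : R →+ R)
    (hb : ∀ f ∈ invariants T, ∀ p, b (f * p) = f * b p) :
    ∃ Λ' : (N ⊗ᵍ induced T).carrier →+ R, (∀ f x, Λ' ((N ⊗ᵍ induced T).right f x) = f * Λ' x) ∧
      ∀ n f p, Λ' (tmul n (induced.tmul T f p)) = p * b (f * Λ n) := by
  have h : ∀ f ∈ invariants T, ∀ n, (b.comp Λ) (N.right f n) = f * (b.comp Λ) n :=
    fun f hf n => (congrArg b (hΛ f n)).trans (hb f hf _)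
  refine ⟨induced.liftRight (P := unit) (b.comp Λ) h,
    fun f x => induced.liftRight_right (P := unit) (b.comp Λ) h f x, fun n f p => ?_⟩
  refine (induced.liftRight_tmul (P := unit) (b.comp Λ) h f p n).trans ?_
  rw [← hΛ]
  rfl

theorem exists_functional_tensor_B {N : GradedBimodule}
    (Λ : N.carrier →+ R) (hΛ : ∀ f x, Λ (N.right f x) = f * Λ x) (b : R →+ R)
    (hb : ∀ f ∈ invariants {t.perm}, ∀ p, b (f * p) = f * b p) :
    ∃ Λ' : (N ⊗ᵍ B t).carrier →+ R, (∀ f x, Λ' ((N ⊗ᵍ B t).right f x) = f * Λ' x) ∧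
      ∀ n f p, Λ' (tmul n (B.tmul t f p)) = p * b (f * Λ n) :=
  exists_functional_tensor_induced Λ hΛ b hb

/-- The four polynomial factors are contracted from the left: `p ⊗ f ⊗ g ⊗ h ↦ a(b(c(p) f) g) h`.
Linearity of `c`, `b`, `a` over `R^t`, `R^u`, `R^t` makes this well defined at the three tensor
signs. -/
theorem exists_functional (a b c : R →+ R)
    (ha : ∀ f ∈ invariants {t.perm}, ∀ p, a (f * p) = f * a p)
    (hb : ∀ f ∈ invariants {u.perm}, ∀ p, b (f * p) = f * b p)
    (hc : ∀ f ∈ invariants {t.perm}, ∀ p, c (f * p) = f * c p) :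
    ∃ Λ : (B t ⊗ᵍ B u ⊗ᵍ B t).carrier →+ R,
      ∀ p q, Λ ((long t u).toLin (induced.tmul simples p q)) = a (b (c p)) * q := by
  obtain ⟨Λ₁, h1, h1'⟩ : ∃ Λ : (B t).carrier →+ R, (∀ f x, Λ ((B t).right f x) = f * Λ x) ∧
      ∀ p q, Λ (B.tmul t p q) = c p * q := by
    exact ⟨induced.functional {t.perm} c hc, induced.functional_right c hc, fun _ _ => rfl⟩
  obtain ⟨Λ₂, h2, h2'⟩ := exists_functional_tensor_B (t := u) Λ₁ h1 b hb
  obtain ⟨Λ₃, -, h3⟩ := exists_functional_tensor_B (t := t) Λ₂ h2 a ha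
  refine ⟨Λ₃, fun p q => ?_⟩
  rw [long_tmul, h3, h2', h1']
  simp only [one_mul, mul_one]
  ring

/-- A functional on `B_{srs}` whose left part is a composition `a ∘ b ∘ c` of this kind factors
through `long`, so it vanishes on the kernel. -/
theorem functional_comp_eq_zero {a b c : R →+ R}
    (ha : ∀ f ∈ invariants {t.perm}, ∀ p, a (f * p) = f * a p)
    (hb : ∀ f ∈ invariants {u.perm}, ∀ p, b (f * p) = f * b p)
    (hc : ∀ f ∈ invariants {t.perm}, ∀ p, c (f * p) = f * c p) {d : R →+ R}
    (hd : ∀ f ∈ invariants simples, ∀ p, d (f * p) = f * d p) (habc : ∀ p, d p = a (b (c p)))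
    {x : Bsrs.carrier} (hx : (long t u).toLin x = 0) : induced.functional simples d hd x = 0 := by
  obtain ⟨Λ, hΛ⟩ := exists_functional a b c ha hb hc
  have h : induced.functional simples d hd = Λ.comp (long t u).toLin.toAddMonoidHom :=
    induced.addHom_ext fun p q => by
      rw [induced.functional_tmul, habc]
      exact (hΛ p q).symm
  rw [h]
  exact (congrArg Λ hx).trans (map_zero Λ)

/-- Each coordinate over `R^W` is a coordinate of `R^t` over `R^W` after a coordinate `c` of `R`
over `R^t`. Those along `w²` and `w` are compositions of the form required by
`functional_comp_eq_zero`; the one along 1 is an `R`-linear combination of such functionals. -/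
theorem long_injective (h : t ≠ u) : Function.Injective (long t u).toLin := by
  refine (injective_iff_map_eq_zero (long t u).toLin).2 fun x hx => ?_
  refine induced.eq_zero_of_functional (fullBasis h) fun ⟨k, i⟩ => ?_
  let c := (simpleBasis t).coord i
  have hc := (simpleBasis t).coord_mul i
  have hcW : ∀ f ∈ invariants simples, ∀ p, c (f * p) = f * c p :=
    fun f hf => hc f (invariants_simples_le t hf)
  have h0 : induced.functional simples _ ((fullBasis h).coord_mul (0, i)) x = 0 :=
    functional_comp_eq_zero (fun f hf => partialAdd_mul t hf) (fun f hf => partialAdd_mul u hf)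
      hc _ (fun p => rfl) hx
  have h1 : induced.functional simples _ ((fullBasis h).coord_mul (1, i)) x = 0 :=
    functional_comp_eq_zero
      -- The coordinate along `w` is `(1 - 2 (w - α_u) ∂_t) ∘ ∂_u`, whose outer map is `R^t`-linear.
      (a := AddMonoidHom.id R -
        (AddMonoidHom.mulLeft (2 * (t.weight - u.root))).comp (partialAdd t))
      (fun f hf p => by
        change f * p - 2 * (t.weight - u.root) * partialAdd t (f * p) =
          f * (p - 2 * (t.weight - u.root) * partialAdd t p)
        rw [partialAdd_mul t hf]
        ring) (fun f hf => partialAdd_mul u hf) hc _ (fun p => rfl) hx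
  have h2 : induced.functional simples _ ((fullBasis h).coord_mul (2, i)) x = 0 := by
    -- The coordinate along 1 is the identity minus multiples of the other two. The identity term
    -- has the required form with `a = b = id`; the multipliers `w` and `w²` act on the values of
    -- the functionals.
    have hid : induced.functional simples c hcW x = 0 :=
      functional_comp_eq_zero (t := t) (u := u) (a := AddMonoidHom.id R) (b := AddMonoidHom.id R)
        (fun _ _ _ => rfl) (fun _ _ _ => rfl) hc _ (fun p => rfl) hx
    have hsum : ∀ x : (induced simples).carrier, induced.functional simples _ ((fullBasis h).coord_mul (2, i)) x =
        induced.functional simples c hcW x -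
        induced.functional simples _ ((fullBasis h).coord_mul (1, i)) x * t.weight -
        induced.functional simples _ ((fullBasis h).coord_mul (0, i)) x * t.weight ^ 2 := by
      intro x
      induction x using induced.induction with
      | zero => simp only [map_zero, zero_mul, sub_zero]
      | add a b h1 h2 =>
        simp only [map_add, h1, h2]
        ring
      | tmul p q =>
        simp only [induced.functional_tmul]
        change weightCoord t u 2 (c p) * q = c p * q - weightCoord t u 1 (c p) * q * t.weight -
          weightCoord t u 0 (c p) * q * t.weight ^ 2
        rw [weightCoord_two]
        ring
    have hzero : ∀ x : (induced simples).carrier, induced.functional simples c hcW x = 0 →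
        induced.functional simples _ ((fullBasis h).coord_mul (1, i)) x = 0 →
        induced.functional simples _ ((fullBasis h).coord_mul (0, i)) x = 0 →
        induced.functional simples _ ((fullBasis h).coord_mul (2, i)) x = 0 := by
      intro x hid h1 h0
      rw [hsum, hid, h1, h0]
      ring
    exact hzero x hid h1 h0
  revert k
  exact forall_fin_three.2 ⟨h0, h1, h2⟩

/-! ### The splitting `B_t B_u B_t ≅ B_{srs} ⊕ B_t`. -/

theorem eq_zero_of_long_add_coretract (h : t ≠ u) {b : Bsrs.carrier} {c : (B t).carrier}
    (hbc : (long t u).toLin b + (coretract t u).toLin c = 0) : b = 0 ∧ c = 0 := by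
  have h1 : c = 0 := by
    -- `ρ` kills the image of `long` and satisfies `ρ ι = -1`, so it isolates `c`.
    have := congrArg (retract t u).toLin hbc
    rw [map_add, retract_long, retract_coretract h, map_zero, zero_add] at this
    exact neg_eq_zero.1 this
  rw [h1, map_zero, add_zero] at hbc
  exact ⟨long_injective h (hbc.trans (map_zero _).symm), h1⟩

/-- `1 - e` is the identity on the image of `long` and zero on the image of `ι`, and the two images
span. -/
theorem image_sub_idem (h : t ≠ u) :
    ((Hom.id _).sub (idem t u)).image (sub_idem_hasDegree t u) ≅ᵍ Bsrs := by
  have h1 : ∀ b, ((Hom.id _).sub (idem t u)).toLin ((long t u).toLin b) = (long t u).toLin b := by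
    intro b
    change (long t u).toLin b - (idem t u).toLin ((long t u).toLin b) = _
    rw [idem_apply, retract_long, map_zero, neg_zero, sub_zero]
  refine Hom.image_isIsomorphic _ (long_hasDegree t u) (long_injective h) (le_antisymm ?_ ?_)
  · rintro _ ⟨b, rfl⟩
    exact ⟨_, h1 b⟩
  · rintro _ ⟨x, rfl⟩
    obtain ⟨b, c, rfl⟩ := long_add_coretract_surjective h x
    refine ⟨b, ?_⟩
    rw [map_add, h1]
    change _ = _ + ((coretract t u).toLin c - (idem t u).toLin ((coretract t u).toLin c))
    rw [idem_coretract h, sub_self, add_zero]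

theorem B_tensor_B_tensor_B (h : t ≠ u) : B t ⊗ᵍ B u ⊗ᵍ B t ≅ᵍ directSum ![Bsrs, B t] := by
  let φ : ∀ i : Fin 2, Hom ((![Bsrs, B t] : Fin 2 → GradedBimodule) i) (B t ⊗ᵍ B u ⊗ᵍ B t) :=
    Fin.cons (long t u) (Fin.cons (coretract t u) (fun i => i.elim0))
  have hφ : (Hom.desc φ).HasDegree 0 := Hom.HasDegree.desc
    (Fin.forall_fin_two.2 ⟨long_hasDegree t u, coretract_hasDegree t u⟩)
  have hd : ∀ m, (Hom.desc φ).toLin m =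
      (long t u).toLin (m 0) + (coretract t u).toLin (m 1) := fun m => by
    rw [Hom.desc_apply, Fin.sum_univ_two]
    rfl
  refine (hφ.isIsomorphic ⟨?_, fun x => ?_⟩).symm
  · refine (injective_iff_map_eq_zero (Hom.desc φ).toLin).2 fun m hm => ?_
    have h01 := eq_zero_of_long_add_coretract h ((hd m).symm.trans hm)
    exact funext (Fin.forall_fin_two.2 h01)
  · obtain ⟨b, c, hbc⟩ := long_add_coretract_surjective h x
    exact ⟨Fin.cons b (Fin.cons c fun i => i.elim0), (hd _).trans hbc⟩

end Idempotent

end Soergel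

end

theorem mainTheorem3 :
    -- the category `𝓑(S₃)` is closed under the tensor product over `R`
    (∀ (M : Soergel.GradedBimodule.{u}) (N : Soergel.GradedBimodule.{v}),
      Soergel.IsSoergel M → Soergel.IsSoergel N → Soergel.IsSoergel (M ⊗ᵍ N)) ∧
    -- `B_t B_t ≅ B_t(1) ⊕ B_t(-1)`
    (∀ t : Soergel.Simple,
      Soergel.B t ⊗ᵍ Soergel.B t ≅ᵍ
        Soergel.directSum ![(Soergel.B t).shift 1, (Soergel.B t).shift (-1)]) ∧
    -- `B_t B_{srs} ≅ B_{srs}(1) ⊕ B_{srs}(-1)`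
    (∀ t : Soergel.Simple,
      Soergel.B t ⊗ᵍ Soergel.Bsrs ≅ᵍ
        Soergel.directSum ![Soergel.Bsrs.shift 1, Soergel.Bsrs.shift (-1)]) ∧
    -- `B_{srs} B_{srs} ≅ B_{srs}(-3) ⊕ B_{srs}(-1)^2 ⊕ B_{srs}(1)^2 ⊕ B_{srs}(3)`
    (Soergel.Bsrs ⊗ᵍ Soergel.Bsrs ≅ᵍ
      Soergel.directSum ![Soergel.Bsrs.shift (-3), Soergel.Bsrs.shift (-1),
        Soergel.Bsrs.shift (-1), Soergel.Bsrs.shift 1, Soergel.Bsrs.shift 1,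
        Soergel.Bsrs.shift 3]) ∧
    -- `B_t B_u B_t ≅ B_{srs} ⊕ B_t` for `{t, u} = {s, r}`
    (∀ t u : Soergel.Simple, t ≠ u →
      Soergel.B t ⊗ᵍ Soergel.B u ⊗ᵍ Soergel.B t ≅ᵍ
        Soergel.directSum ![Soergel.Bsrs, Soergel.B t]) ∧
    -- `e` is a homogeneous idempotent of degree `0` with `im e ≅ B_t` and `im (1 - e) ≅ B_{srs}`
    (∀ t u : Soergel.Simple, t ≠ u →
      ∃ (h₀ : (Soergel.idem t u).HasDegree 0)
        (h₁ : ((Soergel.Hom.id _).sub (Soergel.idem t u)).HasDegree 0),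
        (Soergel.idem t u).comp (Soergel.idem t u) = Soergel.idem t u ∧
        (Soergel.idem t u).image h₀ ≅ᵍ Soergel.B t ∧
        ((Soergel.Hom.id _).sub (Soergel.idem t u)).image h₁ ≅ᵍ Soergel.Bsrs) := by
  refine ⟨fun M N hM hN => ?_, Soergel.B_tensor_B, Soergel.B_tensor_Bsrs, Soergel.Bsrs_tensor_Bsrs,
    fun t u h => Soergel.B_tensor_B_tensor_B h, fun t u h => ?_⟩
  · refine Soergel.IsSoergel.tensor_of_generators Soergel.B_tensor_B (fun t => ?_)
      (fun t => ⟨2, _, Soergel.Bsrs_tensor_B t⟩) ?_ (fun t u h => ?_) hM hN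
    · exact Soergel.IsSoergel.of_iso (Soergel.B_tensor_Bsrs t) (Soergel.IsSoergel.directSum
        (Fin.forall_fin_two.2 ⟨(Soergel.IsSoergel.of_label .srs).shift _,
          (Soergel.IsSoergel.of_label .srs).shift _⟩))
    · refine Soergel.IsSoergel.of_iso Soergel.Bsrs_tensor_Bsrs
        (Soergel.IsSoergel.directSum fun i => ?_)
      fin_cases i <;> exact (Soergel.IsSoergel.of_label .srs).shift _
    · exact Soergel.IsSoergel.of_iso (Soergel.B_tensor_B_tensor_B h) (Soergel.IsSoergel.directSum
        (Fin.forall_fin_two.2 ⟨Soergel.IsSoergel.of_label .srs, Soergel.isSoergel_B t⟩))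
  · exact ⟨Soergel.idem_hasDegree t u, Soergel.sub_idem_hasDegree t u, Soergel.idem_comp_idem h,
      Soergel.image_idem h, Soergel.image_sub_idem h⟩
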